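/- Let $\sigma\in\mathbb R$, $\mathbf q_0\in\mathbb C^2\setminus\{0\}$, $q_0=\|\mathbf q_0\|$, $\delta_\pm\in\mathbb R$, $\mathbf q_\pm=\mathbf q_0e^{i\delta_\pm}$, and let $\mathbf q:\mathbb R^2\to\mathbb C^2$ be a classical solution of the coupled Lakshmanan--Porsezian--Daniel equation $$i\mathbf q_t+\mathbf q_{xx}+2(\|\mathbf q\|^2-q_0^2)\mathbf q+\sigma\big[\mathbf q_{xxxx}+2\|\mathbf q_x\|^2\mathbf q+2(\mathbf q_x^\dagger\mathbf q)\mathbf q_x+6(\mathbf q^\dagger\mathbf q_x)\mathbf q_x+4\|\mathbf q\|^2\mathbf q_{xx}+4(\mathbf q^\dagger\mathbf q_{xx})\mathbf q+2(\mathbf q_{xx}^\dagger\mathbf q)\mathbf q+6(\|\mathbf q\|^4-q_0^4)\mathbf q\big]=0 .$$ Here classical means: for each $t$, $\mathbf q(\cdot,t)$ is $C^4$; $\partial_x^j\mathbf q$ ($0\le j\le4$) is continuous in $(x,t)$; and $\mathbf q$ is differentiable in $t$. Assume for every $t$ that $\mathbf q\to\mathbf q_\pm$ and $\partial_x^j\mathbf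 q\to0$ ($j=1,2,3$) as $x\to\pm\infty$, that $\mathbf q(\cdot,t)-\mathbf q_-\in L^1(-\infty,a)$ and $\mathbf q(\cdot,t)-\mathbf q_+\in L^1(a,\infty)$ for all $a\in\mathbb R$, and that $\partial_x^j\mathbf q$ ($0\le j\le3$) is bounded on $\mathbb R\times[-T,T]$ for every $T$. Put $k=\frac12(z-q_0^2/z)$, $\lambda=\frac12(z+q_0^2/z)$, $J=\operatorname{diag}(1,-1,-1)$, $J_1=\operatorname{diag}(1,0,0)$, $Q=\begin{pmatrix}0&\mathbf q^\dagger\\-\mathbf q&0\end{pmatrix}$, $A=-ikJ+Q$, $$\begin{aligned}E&=2k[\sigma(Q_xQ-QQ_x)-2\sigma\|\mathbf q\|^2Q-\sigma Q_{xx}-Q]+iq_0^2J+3i\sigma q_0^4J+4ik^2[J_1+\sigma J(Q_x-Q^2)]+8\sigma k^3Q-8i\sigma k^4J\\&\quad+3i\sigma J(Q_xQ^2+Q^2Q_x)+i\sigma J(Q_{xx}Q+QQ_{xx}-Q_{xxx}-Q_x^2)+i(1+3\sigma\|\mathbf q\|^2)JQ^2-iJQ_x,\end{aligned}$$ $$Y_\pm=\begin{pmatrix}1&0&-iq_0/z\\-i\mathbf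 q_\pm/z&\mathbf q_\pm^\perp/q_0&\mathbf q_\pm/q_0\end{pmatrix},\qquad (v_1,v_2)^{T\,\perp}=(v_2,-v_1)^\dagger,$$ $\delta_1=-\lambda x+2(k^2+k\lambda-4k^3\lambda\sigma+2k\lambda\sigma q_0^2)t$, $\delta_2=kx+(8k^4\sigma-3\sigma q_0^4-q_0^2)t$, $\delta_3=\lambda x+2(k^2-k\lambda+4k^3\lambda\sigma-2k\lambda\sigma q_0^2)t$. The Jost eigenfunction $\psi_{\pm,j}(x,t,z)$ is the solution of $\psi_x=A\psi$, $\psi_t=E\psi$ with $\nu_{\pm,j}:=e^{-i\delta_j}\psi_{\pm,j}\to Y_{\pm,j}$ (the $j$-th column of $Y_\pm$) as $x\to\pm\infty$, for all $t$. With $U_1=\{\operatorname{Im}z>0,|z|>q_0\}$, $U_2=\{\operatorname{Im}z<0,|z|>q_0\}$, $U_3=\{\operatorname{Im}z<0,|z|<q_0\}$, $U_4=\{\operatorname{Im}z>0,|z|<q_0\}$, these are considered for $z$ in the following sets: $\psi_{-,1}$ in $U_1$, $\psi_{-,2}$ in $U_2\cup U_3$, $\psi_{-,3}$ in $U_4$,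 $\psi_{+,1}$ in $U_2$, $\psi_{+,2}$ in $U_1\cup U_4$, $\psi_{+,3}$ in $U_3$. The adjoint Jost eigenfunctions $\tilde\psi_{\pm,j}$ are defined in the same way, on the complex conjugate sets, from $\tilde A(z)=A(z^*)^*$, $\tilde E(z)=E(z^*)^*$, $\tilde Y_\pm(z)=Y_\pm(z^*)^*$ (entrywise conjugates) and $e^{i\delta_j}\tilde\psi_{\pm,j}\to\tilde Y_{\pm,j}$. The auxiliary eigenfunctions are, with $e=e^{i(\delta_1+\delta_2+\delta_3)}$ and the cross product of $\mathbb C^3$, $$\mu_1=e\,\tilde\psi_{+,1}\times\tilde\psi_{-,2},\quad \mu_2=e\,\tilde\psi_{-,1}\times\tilde\psi_{+,2},\quad \mu_3=e\,\tilde\psi_{+,2}\times\tilde\psi_{-,3},\quad \mu_4=e\,\tilde\psi_{-,2}\times\tilde\psi_{+,3}$$ in $U_1,U_2,U_3,U_4$ respectively. The scattering coefficients on $U_1$ are the (time-independent) limits $$s_{11}(z)=\lim_{x\to+\infty}\big(Y_+^{-1}\nu_{-,1}\big)_1,\qquad h_{22}(z)=\lim_{x\to-\infty}\big(Y_-^{-1}\nu_{+,2}\big)_2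 .$$ Then, with all identities holding for all $(x,t)\in\mathbb R^2$ and all constants complex and independent of $x,t$: (1) If $z_m\in U_1$, $s_{11}(z_m)=0$ and $h_{22}(z_m)\ne0$, there are constants $d_m,\hat d_m,\check d_m,\bar d_m$ with $$\psi_{-,1}(z_m)=\tfrac{d_m}{h_{22}(z_m)}\mu_1(z_m),\quad \mu_2(z_m^*)=\hat d_m\psi_{+,1}(z_m^*),\quad \mu_3(-\tfrac{q_0^2}{z_m^*})=\check d_m\psi_{+,3}(-\tfrac{q_0^2}{z_m^*}),\quad \psi_{-,3}(-\tfrac{q_0^2}{z_m})=\bar d_m\mu_4(-\tfrac{q_0^2}{z_m}).$$ (2) If $\theta_m\in U_1$, $s_{11}(\theta_m)\neq0$ and $h_{22}(\theta_m)=0$, there are constants $g_m,\hat g_m,\check g_m,\bar g_m$ with $$\mu_1(\theta_m)=g_m\psi_{+,2}(\theta_m),\quad \psi_{-,2}(\theta_m^*)=\hat g_m\mu_2(\theta_m^*),\quad \psi_{-,2}(-\tfrac{q_0^2}{\theta_m^*})=\check g_m\mu_3(-\tfrac{q_0^2}{\theta_m^*}),\quad \mu_4(-\tfrac{q_0^2}{\theta_m})=\bar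 g_m\psi_{+,2}(-\tfrac{q_0^2}{\theta_m}).$$ (3) If $\xi_m\in U_1$, $s_{11}(\xi_m)=h_{22}(\xi_m)=0$ and $\mu_1(\xi_m)=\mu_2(\xi_m^*)=0$, there are constants $f_m,\hat f_m,\check f_m,\bar f_m$ with $$\psi_{-,1}(\xi_m)=f_m\psi_{+,2}(\xi_m),\quad \psi_{-,2}(\xi_m^*)=\hat f_m\psi_{+,1}(\xi_m^*),\quad \psi_{-,2}(-\tfrac{q_0^2}{\xi_m^*})=\check f_m\psi_{+,3}(-\tfrac{q_0^2}{\xi_m^*}),\quad \psi_{-,3}(-\tfrac{q_0^2}{\xi_m})=\bar f_m\psi_{+,2}(-\tfrac{q_0^2}{\xi_m}).$$ -/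

import Mathlib

open Filter Topology MeasureTheory Complex Matrix

namespace CoupledLPD

/-- `ℂ²` with its Hermitian norm; `inner ℂ u v` is `u† v`. -/
abbrev Vec2 : Type := EuclideanSpace ℂ (Fin 2)

/-- The two ends `x → -∞` and `x → +∞` of the line. -/
inductive Side : Type where
  | minus : Side
  | plus : Side

/-- The filter of neighbourhoods of an end of the line. -/
def Side.filter : Side → Filter ℝ
  | Side.minus => atBot
  | Side.plus => atTop

/-- The opposite end. -/
def Side.opp : Side → Side
  | Side.minus => Side.plus
  | Side.plus => Side.minus

/-- The raw data: the real parameter `σ` of the equation, the vector `𝐪₀`, the asymptotic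
phases `δ_±`, and a field `q(x, t)`. -/
structure Data : Type where
  sigma : ℝ
  q₀ : Vec2
  delta : Side → ℝ
  q : ℝ → ℝ → Vec2

namespace Data

noncomputable section

variable (D : Data)

/-- The amplitude `q₀ = ‖𝐪₀‖`. -/
def amp : ℝ := ‖D.q₀‖

/-- The boundary values `𝐪_± = 𝐪₀ e^{iδ_±}`. -/
def qInf (s : Side) : Vec2 := Complex.exp (I * (D.delta s : ℂ)) • D.q₀

/-- The spatial derivative `∂ₓʲ q (x, t)`. -/
def jet (j : ℕ) (x t : ℝ) : Vec2 := iteratedDeriv j (fun y => D.q y t) x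

/-- The left-hand side of the coupled Lakshmanan-Porsezian-Daniel equation at `(x, t)`. -/
def lpd (x t : ℝ) : Vec2 :=
  let u := D.q x t
  let ux := D.jet 1 x t
  let uxx := D.jet 2 x t
  I • deriv (fun τ => D.q x τ) t + uxx + ((2 * (‖u‖ ^ 2 - D.amp ^ 2) : ℝ) : ℂ) • u
    + (D.sigma : ℂ) •
      (D.jet 4 x t
        + ((2 * ‖ux‖ ^ 2 : ℝ) : ℂ) • u
        + (2 * inner ℂ ux u) • ux
        + (6 * inner ℂ u ux) • ux
        + ((4 * ‖u‖ ^ 2 : ℝ) : ℂ) • uxx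
        + (4 * inner ℂ u uxx) • u
        + (2 * inner ℂ uxx u) • u
        + ((6 * (‖u‖ ^ 4 - D.amp ^ 4) : ℝ) : ℂ) • u)

/-- `q` is a classical solution of the coupled LPD equation with the nonzero boundary conditions
`q → 𝐪_±` as `x → ±∞`, with `q - 𝐪_±` integrable near `±∞`. The spatial derivatives which enter
the Lax pair vanish at infinity and are bounded uniformly for `t` in bounded sets, so that the
Lax pair has the limits `A_±`, `E_±` as `x → ±∞`. -/
structure IsSolution : Prop where
  q₀_ne_zero : D.q₀ ≠ 0
  contDiff_x : ∀ t, ContDiff ℝ 4 (fun x => D.q x t)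
  continuous_jet : ∀ j ≤ 4, Continuous (fun p : ℝ × ℝ => D.jet j p.1 p.2)
  differentiable_t : ∀ x, Differentiable ℝ (fun t => D.q x t)
  equation : ∀ x t, D.lpd x t = 0
  boundary : ∀ (s : Side) (t : ℝ), Tendsto (fun x => D.q x t) s.filter (𝓝 (D.qInf s))
  integrable_minus : ∀ t a, IntegrableOn (fun x => D.q x t - D.qInf Side.minus) (Set.Iic a)
  integrable_plus : ∀ t a, IntegrableOn (fun x => D.q x t - D.qInf Side.plus) (Set.Ici a)
  boundary_deriv : ∀ j, 1 ≤ j → j ≤ 3 → ∀ (s : Side) (t : ℝ),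
    Tendsto (fun x => D.jet j x t) s.filter (𝓝 0)
  locally_bounded : ∀ T : ℝ, ∃ C : ℝ, ∀ x t, |t| ≤ T → ∀ j ≤ 3, ‖D.jet j x t‖ ≤ C

/-! The spectral variables. -/

/-- `k = (z - q₀² / z) / 2`. -/
def k (z : ℂ) : ℂ := (z - (D.amp : ℂ) ^ 2 / z) / 2

/-- `λ = (z + q₀² / z) / 2`. -/
def lam (z : ℂ) : ℂ := (z + (D.amp : ℂ) ^ 2 / z) / 2

/-- The point `-q₀² / z`. -/
def inv (z : ℂ) : ℂ := -(D.amp : ℂ) ^ 2 / z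

/-- `{Im z > 0, |z| > q₀}`. -/
def U₁ : Set ℂ := {z | 0 < z.im ∧ D.amp < ‖z‖}

/-! The Lax pair. -/

/-- `J = diag(1, -1, -1)`. -/
def J : Matrix (Fin 3) (Fin 3) ℂ := Matrix.diagonal ![1, -1, -1]

/-- `J₁ = diag(1, 0, 0)`. -/
def J₁ : Matrix (Fin 3) (Fin 3) ℂ := Matrix.diagonal ![1, 0, 0]

/-- The block matrix with rows `(0, v†)` and `(-v, 0)`. -/
def blockQ (v : Vec2) : Matrix (Fin 3) (Fin 3) ℂ :=
  !![0, (starRingEnd ℂ) (v 0), (starRingEnd ℂ) (v 1);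
     -v 0, 0, 0;
     -v 1, 0, 0]

/-- `A = -ikJ + Q`. -/
def A (z : ℂ) (x t : ℝ) : Matrix (Fin 3) (Fin 3) ℂ :=
  (-I * D.k z) • J + blockQ (D.q x t)

/-- The temporal matrix `E` of the Lax pair. -/
def E (z : ℂ) (x t : ℝ) : Matrix (Fin 3) (Fin 3) ℂ :=
  let κ := D.k z
  let s : ℂ := (D.sigma : ℂ)
  let a : ℂ := (D.amp : ℂ)
  let n : ℂ := ((‖D.q x t‖ ^ 2 : ℝ) : ℂ)
  let Q := blockQ (D.q x t)
  let Qx := blockQ (D.jet 1 x t)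
  let Qxx := blockQ (D.jet 2 x t)
  let Qxxx := blockQ (D.jet 3 x t)
  (2 * κ) • (s • (Qx * Q - Q * Qx) - (2 * s * n) • Q - s • Qxx - Q)
    + (I * a ^ 2) • J + (3 * I * s * a ^ 4) • J
    + (4 * I * κ ^ 2) • (J₁ + s • (J * (Qx - Q * Q)))
    + (8 * s * κ ^ 3) • Q - (8 * I * s * κ ^ 4) • J
    + (3 * I * s) • (J * (Qx * (Q * Q) + Q * Q * Qx))
    + (I * s) • (J * (Qxx * Q + Q * Qxx - Qxxx - Qx * Qx))
    + (I * (1 + 3 * s * n)) • (J * (Q * Q))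
    - I • (J * Qx)

/-- The spatial matrix of the adjoint Lax pair, `Ã(z) = A(z*)*` (entrywise conjugate). -/
def adjA (z : ℂ) (x t : ℝ) : Matrix (Fin 3) (Fin 3) ℂ :=
  (D.A ((starRingEnd ℂ) z) x t).map (starRingEnd ℂ)

/-- The temporal matrix of the adjoint Lax pair, `Ẽ(z) = E(z*)*` (entrywise conjugate). -/
def adjE (z : ℂ) (x t : ℝ) : Matrix (Fin 3) (Fin 3) ℂ :=
  (D.E ((starRingEnd ℂ) z) x t).map (starRingEnd ℂ)

/-- The matrix of asymptotic eigenvectors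
`Y_±`, with columns `(1, -i𝐪_±/z)`, `(0, 𝐪_±^⊥/q₀)`, `(-iq₀/z, 𝐪_±/q₀)`,
where `v^⊥ = (v₂, -v₁)†`. -/
def Y (s : Side) (z : ℂ) : Matrix (Fin 3) (Fin 3) ℂ :=
  let v := D.qInf s
  let a : ℂ := (D.amp : ℂ)
  !![1, 0, -I * a / z;
     -I / z * v 0, (starRingEnd ℂ) (v 1) / a, v 0 / a;
     -I / z * v 1, -(starRingEnd ℂ) (v 0) / a, v 1 / a]

/-- `Ỹ_±(z) = Y_±(z*)*` (entrywise conjugate). -/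
def adjY (s : Side) (z : ℂ) : Matrix (Fin 3) (Fin 3) ℂ :=
  (D.Y s ((starRingEnd ℂ) z)).map (starRingEnd ℂ)

/-- The phases `δ₁, δ₂, δ₃` (indexed by `0, 1, 2`). -/
def phase (j : Fin 3) (z : ℂ) (x t : ℝ) : ℂ :=
  let κ := D.k z
  let l := D.lam z
  let s : ℂ := (D.sigma : ℂ)
  let a : ℂ := (D.amp : ℂ)
  ![-l * x + 2 * (κ ^ 2 + κ * l - 4 * κ ^ 3 * l * s + 2 * κ * l * s * a ^ 2) * t,
    κ * x + (8 * κ ^ 4 * s - 3 * s * a ^ 4 - a ^ 2) * t,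
    l * x + 2 * (κ ^ 2 - κ * l + 4 * κ ^ 3 * l * s - 2 * κ * l * s * a ^ 2) * t] j

/-- The factor `e^{i(δ₁ + δ₂ + δ₃)}`. -/
def totalExp (z : ℂ) (x t : ℝ) : ℂ :=
  Complex.exp (I * (D.phase 0 z x t + D.phase 1 z x t + D.phase 2 z x t))

end

end Data

noncomputable section

/-- `ψ` solves both `ψ_x = Aψ` and `ψ_t = Eψ`, and `e^{-iφ} ψ → y` at the end `l` of the line,
for every `t`. -/
def IsJost (A E : ℝ → ℝ → Matrix (Fin 3) (Fin 3) ℂ) (φ : ℝ → ℝ → ℂ) (y : Fin 3 → ℂ)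
    (l : Filter ℝ) (ψ : ℝ → ℝ → Fin 3 → ℂ) : Prop :=
  (∀ x t, HasDerivAt (fun x' => ψ x' t) (A x t *ᵥ ψ x t) x) ∧
  (∀ x t, HasDerivAt (fun t' => ψ x t') (E x t *ᵥ ψ x t) t) ∧
  (∀ t, Tendsto (fun x => Complex.exp (-I * φ x t) • ψ x t) l (𝓝 y))

namespace Data

variable (D : Data)

/-- The column `ψ_{±,j}(x, t, z)` of the Jost eigenfunctions: the solution of the Lax pair with
`e^{-iδ_j} ψ_{±,j} → Y_{±,j}` as `x → ±∞`. These conditions determine it in its domain: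
`ψ_{-,1}` for `Im z > 0, |z| > q₀`; `ψ_{-,2}` for `Im z < 0`; `ψ_{-,3}` for `Im z > 0, |z| < q₀`;
`ψ_{+,1}` for `Im z < 0, |z| > q₀`; `ψ_{+,2}` for `Im z > 0`; `ψ_{+,3}` for `Im z < 0, |z| < q₀`
(with `|z| ≠ q₀` in all cases). It is used only there. -/
def psi (s : Side) (j : Fin 3) (z : ℂ) : ℝ → ℝ → Fin 3 → ℂ :=
  Classical.epsilon
    (IsJost (D.A z) (D.E z) (D.phase j z) (fun i => D.Y s z i j) s.filter)

/-- The column `ψ̃_{±,j}(x, t, z)` of the Jost eigenfunctions of the adjoint Lax pair, with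
`e^{iδ_j} ψ̃_{±,j} → Ỹ_{±,j}` as `x → ±∞`; its domain is the complex conjugate of the domain of
`ψ_{±,j}`. -/
def adjPsi (s : Side) (j : Fin 3) (z : ℂ) : ℝ → ℝ → Fin 3 → ℂ :=
  Classical.epsilon
    (IsJost (D.adjA z) (D.adjE z) (fun x t => -D.phase j z x t) (fun i => D.adjY s z i j)
      s.filter)

/-- The modified eigenfunctions `ν_{±,j} = e^{-iδ_j} ψ_{±,j}`. -/
def nu (s : Side) (j : Fin 3) (z : ℂ) (x t : ℝ) : Fin 3 → ℂ :=
  Complex.exp (-I * D.phase j z x t) • D.psi s j z x t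

/-- The `j`-th component of `Y_∓⁻¹ ν_{±,j}` in the limit at the end opposite to the one where
`ψ_{±,j}` is normalized. As `ν_- = Y_+ e^{iΩ} S e^{-iΩ} + o(1)` for `x → +∞` and
`ν_+ = Y_- e^{iΩ} H e^{-iΩ} + o(1)` for `x → -∞`, this is a diagonal entry of `S` or
`H = S⁻¹`, which does not depend on the time at which it is computed. -/
def diagScattering (s : Side) (j : Fin 3) (z : ℂ) : ℂ :=
  limUnder s.opp.filter (fun x => ((D.Y s.opp z)⁻¹ *ᵥ D.nu s j z x 0) j)

/-- The scattering coefficient `s₁₁(z)`, for `z ∈ U₁`. -/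
def s₁₁ (z : ℂ) : ℂ := D.diagScattering Side.minus 0 z

/-- The scattering coefficient `h₂₂(z)` of `H = S⁻¹`, for `Im z > 0`. -/
def h₂₂ (z : ℂ) : ℂ := D.diagScattering Side.plus 1 z

/-- `μ₁ = e^{i(δ₁+δ₂+δ₃)} ψ̃_{+,1} × ψ̃_{-,2}`, for `Im z > 0, |z| > q₀`. -/
def mu₁ (z : ℂ) (x t : ℝ) : Fin 3 → ℂ :=
  D.totalExp z x t •
    crossProduct (D.adjPsi Side.plus 0 z x t) (D.adjPsi Side.minus 1 z x t)

/-- `μ₂ = e^{i(δ₁+δ₂+δ₃)} ψ̃_{-,1} × ψ̃_{+,2}`, for `Im z < 0, |z| > q₀`. -/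
def mu₂ (z : ℂ) (x t : ℝ) : Fin 3 → ℂ :=
  D.totalExp z x t •
    crossProduct (D.adjPsi Side.minus 0 z x t) (D.adjPsi Side.plus 1 z x t)

/-- `μ₃ = e^{i(δ₁+δ₂+δ₃)} ψ̃_{+,2} × ψ̃_{-,3}`, for `Im z < 0, |z| < q₀`. -/
def mu₃ (z : ℂ) (x t : ℝ) : Fin 3 → ℂ :=
  D.totalExp z x t •
    crossProduct (D.adjPsi Side.plus 1 z x t) (D.adjPsi Side.minus 2 z x t)

/-- `μ₄ = e^{i(δ₁+δ₂+δ₃)} ψ̃_{-,2} × ψ̃_{+,3}`, for `Im z > 0, |z| < q₀`. -/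
def mu₄ (z : ℂ) (x t : ℝ) : Fin 3 → ℂ :=
  D.totalExp z x t •
    crossProduct (D.adjPsi Side.minus 1 z x t) (D.adjPsi Side.plus 2 z x t)

/-- Eigenvalues of the first type. -/
def FirstType (z : ℂ) : Prop := z ∈ D.U₁ ∧ D.s₁₁ z = 0 ∧ D.h₂₂ z ≠ 0

/-- Eigenvalues of the second type. -/
def SecondType (z : ℂ) : Prop := z ∈ D.U₁ ∧ D.s₁₁ z ≠ 0 ∧ D.h₂₂ z = 0

/-- Eigenvalues of the third type. -/
def ThirdType (z : ℂ) : Prop := z ∈ D.U₁ ∧ D.s₁₁ z = 0 ∧ D.h₂₂ z = 0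

end Data

end

end CoupledLPD

/-! The statement reduces to linear algebra in `ℂ³`. The matrices satisfy `A(z*)† = -A(z)` and
`E(z*)† = -E(z)`, so the entrywise conjugate of a solution at `z*` solves the adjoint pair `u_x =
-Aᵀu`, `u_t = -Eᵀu`. Its bilinear pairing with a solution at `z` is therefore constant in `x`, and
the cross product of two such conjugates, times `e^{i(δ₁+δ₂+δ₃)}`, solves the original pair. Joint
solutions are fixed by their value at `(0,0)`, so proportionality there is proportionality
everywhere, with a constant factor.

For `z ∈ U₁` consider `ψ_{-,1}(z)`, `ψ_{+,2}(z)` and the conjugates of `ψ_{+,1}(z*)`, `ψ_{-,2}(z*)`.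
Solutions normalized at the same end with different indices pair to zero (`pairing_eq_zero`). The
two remaining pairings are `γ s₁₁` and `h₂₂` (`diagScattering_eq`). If `s₁₁ = 0 ≠ h₂₂`, then
`ψ_{-,1}` is orthogonal to two independent vectors and is a multiple of their cross product, hence
of `μ₁`. The conditions on `μ₂` and those of the second type are read off in the same way. In the
third type two cross products vanish, which is proportionality itself. The identities at `-q₀²/z`
and `-q₀²/z*` follow because `z ↦ -q₀²/z` fixes `k`, changes the sign of `λ`, and so only permutes
and rescales the Jost solutions (`psi_inv`).

The analytic work is to show that Jost solutions exist and are unique. At `t = 0` a weighted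
contraction solves a Volterra equation. The zero curvature condition extends the result to a joint
solution (`exists_lax_solution`), and a Grönwall estimate carries the normalization to all `t`
(`exists_isJost`). Uniqueness is a Grönwall estimate started at the end of the line. -/

namespace CoupledLPD

/-! ### Primitives started at `-∞`. -/

section Primitive

variable {F : Type*} [NormedAddCommGroup F] [NormedSpace ℝ F]

theorem integral_Iic_eq {h : ℝ → F} (hi : ∀ a, IntegrableOn h (Set.Iic a)) (x : ℝ) :
    ∫ y in Set.Iic x, h y = (∫ y in Set.Iic 0, h y) + ∫ y in (0 : ℝ)..x, h y := by
  rw [← intervalIntegral.integral_Iic_sub_Iic (hi 0) (hi x)]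
  abel

theorem hasDerivAt_integral_Iic [CompleteSpace F] {h : ℝ → F} (hc : Continuous h)
    (hi : ∀ a, IntegrableOn h (Set.Iic a)) (x : ℝ) :
    HasDerivAt (fun x => ∫ y in Set.Iic x, h y) (h x) x := by
  rw [funext (integral_Iic_eq hi)]
  exact (hc.integral_hasStrictDerivAt 0 x).hasDerivAt.const_add _

/-- With `P` the primitive of `p` from `-∞`, the integrand is the derivative of `e^{2P}/2`, and
`e^{2P} → 1` at `-∞`. The factor 2 in the exponent is what later gives the contraction constant
`1/2`. -/
theorem integral_Iic_mul_exp {p : ℝ → ℝ} (hc : Continuous p) (h0 : ∀ x, 0 ≤ p x)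
    (hi : ∀ a, IntegrableOn p (Set.Iic a)) (x : ℝ) :
    IntegrableOn (fun y => p y * Real.exp (2 * ∫ s in Set.Iic y, p s)) (Set.Iic x) ∧
    ∫ y in Set.Iic x, p y * Real.exp (2 * ∫ s in Set.Iic y, p s) =
      (Real.exp (2 * ∫ s in Set.Iic x, p s) - 1) / 2 := by
  have hd := hasDerivAt_integral_Iic hc hi
  have hW : Continuous fun x => ∫ s in Set.Iic x, p s :=
    continuous_iff_continuousAt.2 fun x => (hd x).continuousAt
  have hm : Monotone fun x => ∫ s in Set.Iic x, p s := fun a b hab =>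
    setIntegral_mono_set (hi b) (Eventually.of_forall h0) (Set.Iic_subset_Iic.2 hab).eventuallyLE
  have hint : IntegrableOn (fun y => p y * Real.exp (2 * ∫ s in Set.Iic y, p s)) (Set.Iic x) := by
    refine ((hi x).mul_const (Real.exp (2 * ∫ s in Set.Iic x, p s))).mono'
      (by fun_prop) ?_
    refine (ae_restrict_iff' measurableSet_Iic).2 (Eventually.of_forall fun y hy => ?_)
    rw [Real.norm_of_nonneg (mul_nonneg (h0 y) (Real.exp_pos _).le)]
    have := hm (Set.mem_Iic.1 hy)
    simp only at this
    gcongr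
    exact h0 y
  refine ⟨hint, ?_⟩
  have key := integral_Iic_of_hasDerivAt_of_tendsto' (a := x) (m := 1 / 2)
    (f := fun y => Real.exp (2 * ∫ s in Set.Iic y, p s) / 2)
    (f' := fun y => p y * Real.exp (2 * ∫ s in Set.Iic y, p s))
    (fun y _ => by
      refine ((((hd y).const_mul 2).exp).div_const 2).congr_deriv ?_
      ring) hint ?_
  · rw [key]; ring
  · have := ((tendsto_integral_Iic_zero (f := p) (μ := volume) tendsto_id).const_mul 2)
    simpa using (this.rexp).div_const 2

end Primitive

/-! ### Volterra equations: solutions prescribed at `-∞`. -/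

section LinearODE

variable {n : Type*} [Fintype n]

/-- The sum of the absolute values of the entries of a matrix. -/
noncomputable def entrySum (M : Matrix n n ℂ) : ℝ := ∑ i, ∑ j, ‖M i j‖

theorem entrySum_nonneg (M : Matrix n n ℂ) : 0 ≤ entrySum M :=
  Finset.sum_nonneg fun _ _ => Finset.sum_nonneg fun _ _ => norm_nonneg _

@[fun_prop]
theorem continuous_entrySum : Continuous (entrySum : Matrix n n ℂ → ℝ) := by
  unfold entrySum
  fun_prop

theorem norm_mulVec_apply_le (M : Matrix n n ℂ) (v : n → ℂ) (i : n) :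
    ‖(M *ᵥ v) i‖ ≤ entrySum M * ‖v‖ := by
  calc ‖(M *ᵥ v) i‖ ≤ ∑ j, ‖M i j * v j‖ := norm_sum_le _ _
    _ ≤ ∑ j, ‖M i j‖ * ‖v‖ := by
        gcongr with j
        rw [norm_mul]
        gcongr
        exact norm_le_pi_norm v j
    _ = (∑ j, ‖M i j‖) * ‖v‖ := by rw [Finset.sum_mul]
    _ ≤ entrySum M * ‖v‖ := by
        gcongr
        exact Finset.single_le_sum (f := fun i => ∑ j, ‖M i j‖)
          (fun _ _ => Finset.sum_nonneg fun _ _ => norm_nonneg _) (Finset.mem_univ i)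

theorem norm_mulVec_le (M : Matrix n n ℂ) (v : n → ℂ) : ‖M *ᵥ v‖ ≤ entrySum M * ‖v‖ :=
  (pi_norm_le_iff_of_nonneg (mul_nonneg (entrySum_nonneg M) (norm_nonneg v))).2
    (norm_mulVec_apply_le M v)

/-- The Volterra operator `h ↦ ∫_{-∞}^x e^{d (x - y)} B(y) h(y) dy` with `d` diagonal. -/
noncomputable def volterra (d : n → ℂ) (B : ℝ → Matrix n n ℂ) (h : ℝ → n → ℂ) (x : ℝ) (i : n) : ℂ :=
  Complex.exp (d i * x) * ∫ y in Set.Iic x, Complex.exp (-(d i * y)) * (B y *ᵥ h y) i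

variable {d : n → ℂ} {B : ℝ → Matrix n n ℂ}

/-- The exponential weight which makes the Volterra operator a contraction. -/
noncomputable def weight (B : ℝ → Matrix n n ℂ) (x : ℝ) : ℝ :=
  Real.exp (2 * ∫ s in Set.Iic x, entrySum (B s))

theorem norm_exp_mul_ofReal (c : ℂ) (x : ℝ) : ‖Complex.exp (c * x)‖ = Real.exp (c.re * x) := by
  rw [Complex.norm_exp]
  simp

/-- Since `Re d_i ≤ 0` and `y ≤ x`, the exponential at `y` is dominated by its value at `x`, which
the prefactor `e^{d_i x}` of the operator then cancels. -/
theorem volterra_integrand_bound (hd : ∀ i, (d i).re ≤ 0) {h : ℝ → n → ℂ} {C : ℝ}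
    (hC : ∀ x, ‖h x‖ ≤ C * weight B x) (i : n) {x y : ℝ} (hy : y ≤ x) :
    ‖Complex.exp (-(d i * y)) * (B y *ᵥ h y) i‖ ≤
      Real.exp (-((d i).re * x)) * C * (entrySum (B y) * weight B y) := by
  rw [norm_mul, ← neg_mul, norm_exp_mul_ofReal, Complex.neg_re]
  have h1 : Real.exp (-(d i).re * y) ≤ Real.exp (-((d i).re * x)) := by
    rw [Real.exp_le_exp]
    nlinarith [hd i]
  have h2 := norm_mulVec_apply_le (B y) (h y) i
  calc _ ≤ Real.exp (-((d i).re * x)) * (entrySum (B y) * (C * weight B y)) := by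
        gcongr
        refine h2.trans ?_
        have := entrySum_nonneg (B y)
        gcongr
        exact hC y
    _ = _ := by ring

variable (hB : Continuous B) (hint : ∀ a, IntegrableOn (fun y => entrySum (B y)) (Set.Iic a))
include hB hint

theorem continuous_weight : Continuous (weight B) := by
  have hc : Continuous fun y => entrySum (B y) := by fun_prop
  have : Continuous fun x => ∫ s in Set.Iic x, entrySum (B s) :=
    continuous_iff_continuousAt.2 fun x => (hasDerivAt_integral_Iic hc hint x).continuousAt
  unfold weight
  fun_prop

theorem volterra_integrable (hd : ∀ i, (d i).re ≤ 0) {h : ℝ → n → ℂ} (hh : Continuous h) {C : ℝ}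
    (hC : ∀ x, ‖h x‖ ≤ C * weight B x) (i : n) (x : ℝ) :
    IntegrableOn (fun y : ℝ => Complex.exp (-(d i * y)) * (B y *ᵥ h y) i) (Set.Iic x) := by
  have hp := (integral_Iic_mul_exp (p := fun y => entrySum (B y)) (by fun_prop)
    (fun _ => entrySum_nonneg _) hint x).1
  refine (Integrable.const_mul hp (Real.exp (-((d i).re * x)) * C)).mono' ?_ ?_
  · have : Continuous fun y => (B y *ᵥ h y) i :=
      (continuous_apply i).comp (hB.matrix_mulVec hh)
    have : Continuous (fun y : ℝ => Complex.exp (-(d i * y)) * (B y *ᵥ h y) i) := by fun_prop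
    exact this.aestronglyMeasurable
  · exact (ae_restrict_iff' measurableSet_Iic).2
      (Eventually.of_forall fun y hy => volterra_integrand_bound hd hC i hy)

theorem hasDerivAt_volterra (hd : ∀ i, (d i).re ≤ 0) {h : ℝ → n → ℂ} (hh : Continuous h) {C : ℝ}
    (hC : ∀ x, ‖h x‖ ≤ C * weight B x) (i : n) (x : ℝ) :
    HasDerivAt (fun x => volterra d B h x i) (d i * volterra d B h x i + (B x *ᵥ h x) i) x := by
  have h1 : HasDerivAt (fun x : ℝ => Complex.exp (d i * x)) (Complex.exp (d i * x) * d i) x := by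
    have : HasDerivAt (fun x : ℝ => d i * (x : ℂ)) (d i) x := by
      simpa using (Complex.ofRealCLM.hasDerivAt (x := x)).const_mul (d i)
    exact this.cexp
  have hc : Continuous (fun y : ℝ => Complex.exp (-(d i * y)) * (B y *ᵥ h y) i) := by
    have : Continuous fun y => (B y *ᵥ h y) i :=
      (continuous_apply i).comp (hB.matrix_mulVec hh)
    fun_prop
  refine (h1.mul (hasDerivAt_integral_Iic hc
    (volterra_integrable hB hint hd hh hC i) x)).congr_deriv ?_
  rw [← mul_assoc (Complex.exp (d i * x)) (Complex.exp _) _, ← Complex.exp_add]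
  simp [volterra]
  ring

theorem continuous_volterra (hd : ∀ i, (d i).re ≤ 0) {h : ℝ → n → ℂ} (hh : Continuous h) {C : ℝ}
    (hC : ∀ x, ‖h x‖ ≤ C * weight B x) : Continuous (volterra d B h) :=
  continuous_pi fun i => continuous_iff_continuousAt.2 fun x =>
    (hasDerivAt_volterra hB hint hd hh hC i x).continuousAt

/-- The gain of `1/2` gives the contraction; the difference `weight B x - 1`, which tends to zero at
`-∞`, gives the asymptotics of the fixed point. -/
theorem norm_volterra_le (hd : ∀ i, (d i).re ≤ 0) {h : ℝ → n → ℂ} {C : ℝ} (hC0 : 0 ≤ C)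
    (hC : ∀ x, ‖h x‖ ≤ C * weight B x) (x : ℝ) :
    ‖volterra d B h x‖ ≤ C * ((weight B x - 1) / 2) := by
  have hp := integral_Iic_mul_exp (p := fun y => entrySum (B y)) (by fun_prop)
    (fun _ => entrySum_nonneg _) hint x
  have hw : 1 ≤ weight B x := by
    rw [weight, Real.one_le_exp_iff]
    exact mul_nonneg zero_le_two (integral_nonneg fun _ => entrySum_nonneg _)
  refine (pi_norm_le_iff_of_nonneg (mul_nonneg hC0 (by linarith))).2 fun i => ?_
  rw [volterra, norm_mul, norm_exp_mul_ofReal]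
  have h1 : ‖∫ y in Set.Iic x, Complex.exp (-(d i * y)) * (B y *ᵥ h y) i‖ ≤
      ∫ y in Set.Iic x, Real.exp (-((d i).re * x)) * C * (entrySum (B y) * weight B y) :=
    norm_integral_le_of_norm_le (Integrable.const_mul hp.1 _)
      ((ae_restrict_iff' measurableSet_Iic).2
        (Eventually.of_forall fun y hy => volterra_integrand_bound hd hC i hy))
  rw [integral_const_mul] at h1
  have h2 : ∫ y in Set.Iic x, entrySum (B y) * weight B y = (weight B x - 1) / 2 := hp.2
  rw [h2] at h1
  calc _ ≤ Real.exp ((d i).re * x) *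
        (Real.exp (-((d i).re * x)) * C * ((weight B x - 1) / 2)) := by gcongr
    _ = (Real.exp ((d i).re * x) * Real.exp (-((d i).re * x))) *
        (C * ((weight B x - 1) / 2)) := by ring
    _ = _ := by rw [← Real.exp_add]; simp

theorem volterra_sub (hd : ∀ i, (d i).re ≤ 0) {h h' : ℝ → n → ℂ} (hh : Continuous h)
    (hh' : Continuous h') {C C' : ℝ} (hC : ∀ x, ‖h x‖ ≤ C * weight B x)
    (hC' : ∀ x, ‖h' x‖ ≤ C' * weight B x) (x : ℝ) :
    volterra d B h x - volterra d B h' x = volterra d B (fun y => h y - h' y) x := by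
  funext i
  simp only [volterra, Pi.sub_apply, Matrix.mulVec_sub, mul_sub]
  rw [integral_sub (volterra_integrable hB hint hd hh hC i x)
    (volterra_integrable hB hint hd hh' hC' i x)]
  ring

/-- The solution of `f' = d f + B f` which tends to a constant solution `v` of the unperturbed
equation at `-∞`. -/
theorem exists_solution_tendsto_atBot (hd : ∀ i, (d i).re ≤ 0) (v : n → ℂ)
    (hv : ∀ i, d i * v i = 0) :
    ∃ f : ℝ → n → ℂ,
      (∀ x, HasDerivAt f (fun i => d i * f x i + (B x *ᵥ f x) i) x) ∧
      Tendsto f atBot (𝓝 v) := by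
  have hwpos : ∀ x, 0 < weight B x := fun x => Real.exp_pos _
  have hw1 : ∀ x, 1 ≤ weight B x := fun x => by
    rw [weight, Real.one_le_exp_iff]
    exact mul_nonneg zero_le_two (integral_nonneg fun _ => entrySum_nonneg _)
  have hwc := continuous_weight hB hint
  have hh : ∀ g : BoundedContinuousFunction ℝ (n → ℂ), Continuous fun y => weight B y • g y :=
    fun g => hwc.smul g.continuous
  have hhb : ∀ g : BoundedContinuousFunction ℝ (n → ℂ),
      ∀ x, ‖weight B x • g x‖ ≤ ‖g‖ * weight B x := fun g x => by
    rw [norm_smul, Real.norm_of_nonneg (hwpos x).le, mul_comm]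
    exact mul_le_mul_of_nonneg_right (g.norm_coe_le_norm x) (hwpos x).le
  have hTb : ∀ g : BoundedContinuousFunction ℝ (n → ℂ), ∀ x,
      ‖(weight B x)⁻¹ • (v + volterra d B (fun y => weight B y • g y) x)‖ ≤ ‖v‖ + ‖g‖ := by
    intro g x
    rw [norm_smul, norm_inv, Real.norm_of_nonneg (hwpos x).le, inv_mul_le_iff₀ (hwpos x)]
    refine (norm_add_le _ _).trans ?_
    have := norm_volterra_le hB hint hd (norm_nonneg g) (hhb g) x
    nlinarith [hw1 x, norm_nonneg v, norm_nonneg g]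
  -- The unknown is `g = f / weight`, so that `f = v + Vf`, with `V` the Volterra operator, becomes
  -- a fixed point equation among bounded continuous functions.
  let T : BoundedContinuousFunction ℝ (n → ℂ) → BoundedContinuousFunction ℝ (n → ℂ) := fun g =>
    BoundedContinuousFunction.ofNormedAddCommGroup
      (fun x => (weight B x)⁻¹ • (v + volterra d B (fun y => weight B y • g y) x))
      ((hwc.inv₀ fun x => (hwpos x).ne').smul
        (continuous_const.add (continuous_volterra hB hint hd (hh g) (hhb g))))
      (‖v‖ + ‖g‖) (hTb g)
  have hT : ContractingWith (1 / 2) T := by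
    refine ⟨by rw [← NNReal.coe_lt_coe]; norm_num, LipschitzWith.of_dist_le_mul fun g g' => ?_⟩
    rw [BoundedContinuousFunction.dist_le (by positivity)]
    intro x
    have h1 : T g x - T g' x =
        (weight B x)⁻¹ • volterra d B (fun y => weight B y • (g - g') y) x := by
      change (weight B x)⁻¹ • (v + volterra d B (fun y => weight B y • g y) x) -
        (weight B x)⁻¹ • (v + volterra d B (fun y => weight B y • g' y) x) = _
      rw [← smul_sub, add_sub_add_left_eq_sub,
        volterra_sub hB hint hd (hh g) (hh g') (hhb g) (hhb g') x]
      simp [smul_sub]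
    rw [dist_eq_norm, h1, norm_smul, norm_inv, Real.norm_of_nonneg (hwpos x).le,
      inv_mul_le_iff₀ (hwpos x), dist_eq_norm]
    have := norm_volterra_le hB hint hd (norm_nonneg (g - g')) (hhb (g - g')) x
    refine this.trans ?_
    push_cast
    nlinarith [hw1 x, norm_nonneg (g - g')]
  set g := ContractingWith.fixedPoint T hT
  have hg : T g = g := ContractingWith.fixedPoint_isFixedPt hT
  have hfix : ∀ x, weight B x • g x = v + volterra d B (fun y => weight B y • g y) x := by
    intro x
    have : g x = (weight B x)⁻¹ • (v + volterra d B (fun y => weight B y • g y) x) := by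
      conv_lhs => rw [← hg]
      rfl
    rw [this, smul_inv_smul₀ (hwpos x).ne']
  refine ⟨fun x => weight B x • g x, fun x => ?_, ?_⟩
  · rw [hasDerivAt_pi]
    intro i
    have h1 := (hasDerivAt_volterra hB hint hd (hh g) (hhb g) i x).const_add (v i)
    have h2 : (fun x => (weight B x • g x) i) =
        fun x => v i + volterra d B (fun y => weight B y • g y) x i := by
      funext x; rw [hfix x]; rfl
    rw [h2]
    refine h1.congr_deriv ?_
    have h3 : (weight B x • g x) i = v i + volterra d B (fun y => weight B y • g y) x i :=
      congrFun h2 x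
    beta_reduce
    rw [h3, mul_add, hv i, zero_add]
  -- `f - v` is the Volterra term, bounded by `‖g‖ (weight - 1)/2`, and the weight tends to 1 at
  -- `-∞`.
  · rw [tendsto_iff_norm_sub_tendsto_zero]
    have h1 : Tendsto (fun x => ‖g‖ * ((weight B x - 1) / 2)) atBot (𝓝 0) := by
      have := ((tendsto_integral_Iic_zero (f := fun s => entrySum (B s)) (μ := volume)
        tendsto_id).const_mul 2).rexp
      simpa [weight] using ((this.sub_const 1).div_const 2).const_mul ‖g‖
    refine squeeze_zero (fun _ => norm_nonneg _) (fun x => ?_) h1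
    rw [hfix x, add_sub_cancel_left]
    exact norm_volterra_le hB hint hd (norm_nonneg g) (hhb g) x

end LinearODE

end CoupledLPD

namespace CoupledLPD

/-! ### Linear differential equations: global solvability, Grönwall estimates, Lax pairs. -/

section LinearODE

variable {n : Type*} [Fintype n]

theorem norm_apply_le_entrySum (M : Matrix n n ℂ) (i j : n) : ‖M i j‖ ≤ entrySum M :=
  (Finset.single_le_sum (f := fun j => ‖M i j‖) (fun _ _ => norm_nonneg _)
    (Finset.mem_univ j)).trans (Finset.single_le_sum (f := fun i => ∑ j, ‖M i j‖)
      (fun _ _ => Finset.sum_nonneg fun _ _ => norm_nonneg _) (Finset.mem_univ i))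

/-- The substitution `t = e^u` moves the initial time to `u = -∞`. The new coefficient `e^u E(e^u)`
is integrable there, so the Volterra result with `d = 0` applies. -/
theorem exists_solution_Ioi {E : ℝ → Matrix n n ℂ} (hE : Continuous E) (v : n → ℂ) :
    ∃ f : ℝ → n → ℂ, (∀ t, 0 < t → HasDerivAt f (E t *ᵥ f t) t) ∧
      Tendsto f (𝓝[>] 0) (𝓝 v) := by
  have hB : Continuous fun u : ℝ => (Real.exp u : ℂ) • E (Real.exp u) := by fun_prop
  have hint : ∀ a, IntegrableOn
      (fun u : ℝ => entrySum ((Real.exp u : ℂ) • E (Real.exp u))) (Set.Iic a) := by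
    intro a
    obtain ⟨K, hK⟩ := (isCompact_Icc (a := (0 : ℝ)) (b := Real.exp a)).exists_bound_of_continuousOn
      (f := fun t => entrySum (E t)) (continuous_entrySum.comp hE).continuousOn
    refine ((integrableOn_exp_Iic a).mul_const K).mono'
      (continuous_entrySum.comp hB).aestronglyMeasurable
      ((ae_restrict_iff' measurableSet_Iic).2 (Eventually.of_forall fun u hu => ?_))
    have h1 : entrySum ((Real.exp u : ℂ) • E (Real.exp u)) =
        Real.exp u * entrySum (E (Real.exp u)) := by
      simp only [entrySum, Matrix.smul_apply, norm_smul, Finset.mul_sum, Complex.norm_real,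
        Real.norm_eq_abs, Real.abs_exp]
    rw [h1, norm_mul, Real.norm_eq_abs, Real.abs_exp]
    gcongr
    exact hK _ ⟨(Real.exp_pos u).le, Real.exp_le_exp.2 hu⟩
  obtain ⟨g, hg, hgv⟩ := exists_solution_tendsto_atBot (d := 0) hB hint (fun _ => by simp) v
    (fun _ => by simp)
  refine ⟨fun t => g (Real.log t), fun t ht => ?_, hgv.comp Real.tendsto_log_nhdsGT_zero⟩
  have h1 := (hg (Real.log t)).scomp t (Real.hasDerivAt_log ht.ne')
  refine h1.congr_deriv ?_
  funext i
  have : (t : ℂ) ≠ 0 := by exact_mod_cast ht.ne'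
  simp [Real.exp_log ht, Matrix.smul_mulVec, this]

theorem continuousAt_mulVec {M : ℝ → Matrix n n ℂ} {f : ℝ → n → ℂ} {x : ℝ}
    (hM : ContinuousAt M x) (hf : ContinuousAt f x) : ContinuousAt (fun t => M t *ᵥ f t) x := by
  have hm : Continuous fun q : Matrix n n ℂ × (n → ℂ) => q.1 *ᵥ q.2 :=
    continuous_fst.matrix_mulVec continuous_snd
  exact hm.continuousAt.comp (hM.prodMk hf)

theorem hasDerivAt_mulVec {M : ℝ → Matrix n n ℂ} {M' : Matrix n n ℂ} {f : ℝ → n → ℂ} {f' : n → ℂ}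
    {x : ℝ} (hM : ∀ i j, HasDerivAt (fun t => M t i j) (M' i j) x) (hf : HasDerivAt f f' x) :
    HasDerivAt (fun t => M t *ᵥ f t) (M' *ᵥ f x + M x *ᵥ f') x := by
  rw [hasDerivAt_pi]
  intro i
  simp only [Matrix.mulVec, dotProduct, Pi.add_apply, ← Finset.sum_add_distrib]
  exact HasDerivAt.fun_sum fun j _ => (hM i j).mul (hasDerivAt_pi.1 hf j)

/-- Global solvability of linear differential equations with continuous coefficients. -/
theorem exists_solution {E : ℝ → Matrix n n ℂ} (hE : Continuous E) (v : n → ℂ) :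
    ∃ f : ℝ → n → ℂ, f 0 = v ∧ ∀ t, HasDerivAt f (E t *ᵥ f t) t := by
  obtain ⟨f, hf, hfv⟩ := exists_solution_Ioi hE v
  obtain ⟨g, hg, hgv⟩ := exists_solution_Ioi (E := fun t => -E (-t)) (hE.comp continuous_neg).neg v
  let F : ℝ → n → ℂ := fun t => if 0 < t then f t else if t < 0 then g (-t) else v
  have hF0 : F 0 = v := by simp [F]
  have hpos : ∀ t, 0 < t → F =ᶠ[𝓝 t] f := fun t ht => by
    filter_upwards [lt_mem_nhds ht] with s hs
    simp [F, hs]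
  have hneg : ∀ t, t < 0 → F =ᶠ[𝓝 t] fun s => g (-s) := fun t ht => by
    filter_upwards [gt_mem_nhds ht] with s hs
    simp [F, hs, hs.le, not_lt.2]
  have hFc : ContinuousAt F 0 := by
    rw [continuousAt_iff_punctured_nhds, hF0, ← Set.Iio_union_Ioi, nhdsWithin_union, tendsto_sup]
    constructor
    · have : Tendsto (fun s : ℝ => g (-s)) (𝓝[<] 0) (𝓝 v) :=
        hgv.comp (by simpa using tendsto_neg_nhdsLT (a := (0 : ℝ)))
      refine this.congr' ?_
      filter_upwards [self_mem_nhdsWithin] with s hs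
      exact ((hneg s hs).self_of_nhds).symm
    · refine hfv.congr' ?_
      filter_upwards [self_mem_nhdsWithin] with s hs
      exact ((hpos s hs).self_of_nhds).symm
  -- The derivative at 0 comes from the continuity at 0 of both `F` and `E t *ᵥ F t`; only the two
  -- open half-lines need the equation.
  refine ⟨F, hF0, hasDerivAt_of_hasDerivAt_of_ne' (x := 0) (fun t ht => ?_) hFc ?_⟩
  · rcases ht.lt_or_gt with ht | ht
    · have h1 : HasDerivAt (fun s => g (-s)) _ t :=
        (hg (-t) (by linarith)).scomp t (hasDerivAt_neg t)
      refine (h1.congr_of_eventuallyEq (hneg t ht)).congr_deriv ?_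
      rw [(hneg t ht).self_of_nhds]
      simp [Matrix.neg_mulVec]
    · refine ((hf t ht).congr_of_eventuallyEq (hpos t ht)).congr_deriv ?_
      rw [(hpos t ht).self_of_nhds]
  · exact continuousAt_mulVec hE.continuousAt hFc

theorem re_conj_mul_mulVec_le (M : Matrix n n ℂ) (v : n → ℂ) :
    ∑ i, ((starRingEnd ℂ) (v i) * (M *ᵥ v) i).re ≤ entrySum M * ∑ i, ‖v i‖ ^ 2 := by
  have h1 : ∀ i, ((starRingEnd ℂ) (v i) * (M *ᵥ v) i).re ≤
      ∑ j, ‖M i j‖ * ∑ k, ‖v k‖ ^ 2 := by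
    intro i
    refine (Complex.re_le_norm _).trans ?_
    rw [norm_mul, RCLike.norm_conj]
    have h2 : ‖(M *ᵥ v) i‖ ≤ ∑ j, ‖M i j‖ * ‖v j‖ := by
      refine (norm_sum_le _ _).trans (le_of_eq ?_)
      simp only [norm_mul]
    calc _ ≤ ‖v i‖ * ∑ j, ‖M i j‖ * ‖v j‖ := by gcongr
      _ = ∑ j, ‖M i j‖ * (‖v i‖ * ‖v j‖) := by
          rw [Finset.mul_sum]
          exact Finset.sum_congr rfl fun _ _ => by ring
      _ ≤ _ := by
          gcongr with j
          have hi := Finset.single_le_sum (f := fun k => ‖v k‖ ^ 2)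
            (fun _ _ => by positivity) (Finset.mem_univ i)
          have hj := Finset.single_le_sum (f := fun k => ‖v k‖ ^ 2)
            (fun _ _ => by positivity) (Finset.mem_univ j)
          nlinarith [sq_nonneg (‖v i‖ - ‖v j‖)]
  refine (Finset.sum_le_sum fun i _ => h1 i).trans (le_of_eq ?_)
  rw [entrySum, Finset.sum_mul]
  simp only [Finset.sum_mul]

/-- A Grönwall estimate for `f' = d f + B f` with `d` diagonal and dissipative. -/
theorem sum_sq_le_of_hasDerivAt {d : n → ℂ} (hd : ∀ i, (d i).re ≤ 0) {B : ℝ → Matrix n n ℂ}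
    (hB : Continuous B) {f : ℝ → n → ℂ}
    (hf : ∀ x, HasDerivAt f (fun i => d i * f x i + (B x *ᵥ f x) i) x) {a b : ℝ} (hab : a ≤ b) :
    ∑ i, ‖f b i‖ ^ 2 ≤
      (∑ i, ‖f a i‖ ^ 2) * Real.exp (2 * ∫ s in a..b, entrySum (B s)) := by
  have hp : Continuous fun s => entrySum (B s) := continuous_entrySum.comp hB
  have hP : ∀ x, HasDerivAt (fun x => ∫ s in a..x, entrySum (B s)) (entrySum (B x)) x := fun x =>
    (hp.integral_hasStrictDerivAt a x).hasDerivAt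
  have hN : ∀ x, HasDerivAt (fun x => ∑ i, ‖f x i‖ ^ 2)
      (∑ i, 2 * ((starRingEnd ℂ) (f x i) * (d i * f x i + (B x *ᵥ f x) i)).re) x := by
    intro x
    refine HasDerivAt.fun_sum fun i _ => ?_
    have h1 := ((hasDerivAt_pi.1 (hf x)) i).norm_sq
    refine h1.congr_deriv ?_
    simp only [Complex.inner]
    simp [mul_comm]
  -- The squared Euclidean norm is used because, unlike the sup norm, it is differentiable. Times
  -- the integrating factor it decreases: the `d` terms contribute with the sign of `Re d_i ≤ 0`.
  let G : ℝ → ℝ := fun x =>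
    (∑ i, ‖f x i‖ ^ 2) * Real.exp (-(2 * ∫ s in a..x, entrySum (B s)))
  have hG : ∀ x, HasDerivAt G (((∑ i, 2 * ((starRingEnd ℂ) (f x i) *
      (d i * f x i + (B x *ᵥ f x) i)).re) - 2 * entrySum (B x) * ∑ i, ‖f x i‖ ^ 2) *
      Real.exp (-(2 * ∫ s in a..x, entrySum (B s)))) x := by
    intro x
    refine ((hN x).mul (((hP x).const_mul 2).fun_neg.exp)).congr_deriv ?_
    ring
  have hanti : Antitone G := by
    refine antitone_of_hasDerivAt_nonpos hG fun x => ?_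
    refine mul_nonpos_of_nonpos_of_nonneg ?_ (Real.exp_pos _).le
    have h1 := re_conj_mul_mulVec_le (B x) (f x)
    have h2 : ∑ i, 2 * ((starRingEnd ℂ) (f x i) * (d i * f x i + (B x *ᵥ f x) i)).re ≤
        ∑ i, 2 * ((starRingEnd ℂ) (f x i) * (B x *ᵥ f x) i).re := by
      refine Finset.sum_le_sum fun i _ => ?_
      have h3 : ((starRingEnd ℂ) (f x i) * (d i * f x i + (B x *ᵥ f x) i)).re =
          (d i).re * Complex.normSq (f x i) +
            ((starRingEnd ℂ) (f x i) * (B x *ᵥ f x) i).re := by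
        simp [Complex.normSq_apply]
        ring
      rw [h3]
      nlinarith [hd i, Complex.normSq_nonneg (f x i)]
    rw [← Finset.mul_sum] at h2
    rw [← Finset.mul_sum] at h2 ⊢
    linarith
  have h := hanti hab
  simp only [G, intervalIntegral.integral_same, mul_zero, neg_zero, Real.exp_zero, mul_one] at h
  rw [Real.exp_neg, ← div_eq_mul_inv, div_le_iff₀ (Real.exp_pos _)] at h
  exact h

theorem eq_zero_of_sum_sq_le_zero {v : n → ℂ} (h : ∑ i, ‖v i‖ ^ 2 ≤ 0) : v = 0 := by
  have h0 := le_antisymm h (Finset.sum_nonneg fun _ _ => by positivity)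
  rw [Finset.sum_eq_zero_iff_of_nonneg fun _ _ => by positivity] at h0
  funext i
  simpa using h0 i (Finset.mem_univ i)

theorem norm_sq_le_sum_sq (v : n → ℂ) (i : n) : ‖v i‖ ^ 2 ≤ ∑ i, ‖v i‖ ^ 2 :=
  Finset.single_le_sum (f := fun k => ‖v k‖ ^ 2) (fun _ _ => by positivity) (Finset.mem_univ i)

theorem tendsto_sum_sq_zero {ι : Type*} {l : Filter ι} {f : ι → n → ℂ} (hf : Tendsto f l (𝓝 0)) :
    Tendsto (fun x => ∑ i, ‖f x i‖ ^ 2) l (𝓝 0) := by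
  have : Continuous fun v : n → ℂ => ∑ i, ‖v i‖ ^ 2 := by fun_prop
  simpa [Function.comp_def] using (this.tendsto 0).comp hf

/-- Let the left endpoint of the Grönwall estimate go to `-∞`: the initial term tends to zero while
the exponential factor converges. -/
theorem eq_zero_of_tendsto_atBot {d : n → ℂ} (hd : ∀ i, (d i).re ≤ 0) {B : ℝ → Matrix n n ℂ}
    (hB : Continuous B) (hint : IntegrableOn (fun y => entrySum (B y)) (Set.Iic 0))
    {f : ℝ → n → ℂ} (hf : ∀ x, HasDerivAt f (fun i => d i * f x i + (B x *ᵥ f x) i) x)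
    (h0 : Tendsto f atBot (𝓝 0)) (x : ℝ) : f x = 0 := by
  have hp : Continuous fun s => entrySum (B s) := continuous_entrySum.comp hB
  have hintx : IntegrableOn (fun y => entrySum (B y)) (Set.Iic x) := by
    refine (hint.union (hp.integrableOn_Icc (a := 0) (b := x))).mono_set fun y hy => ?_
    rcases le_total y 0 with h | h
    · exact Or.inl h
    · exact Or.inr ⟨h, hy⟩
  refine eq_zero_of_sum_sq_le_zero ?_
  have h1 := (tendsto_sum_sq_zero h0).mul
    (((intervalIntegral_tendsto_integral_Iic x hintx tendsto_id).const_mul 2).rexp)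
  rw [zero_mul] at h1
  refine ge_of_tendsto h1 ?_
  filter_upwards [eventually_le_atBot x] with a ha
  exact sum_sq_le_of_hasDerivAt hd hB hf ha

theorem bounded_of_integrable {d : n → ℂ} (hd : ∀ i, (d i).re ≤ 0) {B : ℝ → Matrix n n ℂ}
    (hB : Continuous B) (hint : IntegrableOn (fun y => entrySum (B y)) (Set.Ici 0))
    {f : ℝ → n → ℂ} (hf : ∀ x, HasDerivAt f (fun i => d i * f x i + (B x *ᵥ f x) i) x) :
    ∃ C, ∀ x, 0 ≤ x → ∀ i, ‖f x i‖ ≤ C := by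
  refine ⟨Real.sqrt ((∑ i, ‖f 0 i‖ ^ 2) *
    Real.exp (2 * ∫ s in Set.Ici 0, entrySum (B s))), fun x hx i => ?_⟩
  refine Real.le_sqrt_of_sq_le ((norm_sq_le_sum_sq (f x) i).trans
    ((sum_sq_le_of_hasDerivAt hd hB hf hx).trans ?_))
  have h1 : ∫ s in (0 : ℝ)..x, entrySum (B s) ≤ ∫ s in Set.Ici 0, entrySum (B s) := by
    rw [intervalIntegral.integral_of_le hx]
    exact setIntegral_mono_set hint (Eventually.of_forall fun _ => entrySum_nonneg _)
      (Set.Ioc_subset_Ioi_self.trans Set.Ioi_subset_Ici_self).eventuallyLE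
  gcongr

theorem eq_zero_of_eq_zero {B : ℝ → Matrix n n ℂ} (hB : Continuous B) {f : ℝ → n → ℂ}
    (hf : ∀ x, HasDerivAt f (B x *ᵥ f x) x) (h0 : f 0 = 0) (x : ℝ) : f x = 0 := by
  refine eq_zero_of_sum_sq_le_zero ?_
  rcases le_total 0 x with hx | hx
  · simpa [h0] using sum_sq_le_of_hasDerivAt (d := fun _ => 0) (fun _ => by simp) hB
      (f := f) (fun x => (hf x).congr_deriv (by simp)) hx
  · have hg : ∀ y, HasDerivAt (fun y => f (-y)) ((-B (-y)) *ᵥ f (-y)) y := fun y =>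
      ((hf (-y)).scomp y (hasDerivAt_neg y)).congr_deriv (by simp [Matrix.neg_mulVec])
    simpa [h0] using sum_sq_le_of_hasDerivAt (d := fun _ => 0) (B := fun y => -B (-y))
      (fun _ => by simp) (hB.comp continuous_neg).neg (f := fun y => f (-y))
      (fun x => (hg x).congr_deriv (by simp)) (neg_nonneg.2 hx)

/-- Subtracting the primitive of `f` leaves a function with derivative `M r`, to which the standard
Grönwall bound applies. Thus the forcing enters only through its integral, as dominated convergence
requires later. -/
theorem norm_le_of_hasDerivAt_add {M : ℝ → Matrix n n ℂ} {r f : ℝ → n → ℂ} {K T : ℝ}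
    (hK : 0 < K) (hT : 0 ≤ T) (hM : ∀ t ∈ Set.Icc 0 T, entrySum (M t) ≤ K) (hf : Continuous f)
    (hr : ∀ t, HasDerivAt r (M t *ᵥ r t + f t) t) :
    ‖r T‖ ≤ (‖r 0‖ + ∫ t in (0 : ℝ)..T, ‖f t‖) * Real.exp (K * T) := by
  set S := ∫ t in (0 : ℝ)..T, ‖f t‖ with hS
  have hF : ∀ t, HasDerivAt (fun t => ∫ s in (0 : ℝ)..t, f s) (f t) t := fun t =>
    (hf.integral_hasStrictDerivAt 0 t).hasDerivAt
  have hFS : ∀ t ∈ Set.Icc 0 T, ‖∫ s in (0 : ℝ)..t, f s‖ ≤ S := by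
    intro t ht
    refine (intervalIntegral.norm_integral_le_integral_norm ht.1).trans ?_
    exact intervalIntegral.integral_mono_interval le_rfl ht.1 ht.2
      (Eventually.of_forall fun _ => norm_nonneg _) (hf.norm.intervalIntegrable _ _)
  have hd : ∀ t, HasDerivAt (fun t => r t - ∫ s in (0 : ℝ)..t, f s) (M t *ᵥ r t) t := fun t =>
    ((hr t).sub (hF t)).congr_deriv (by simp)
  have hS0 : 0 ≤ S := (norm_nonneg _).trans (hFS T ⟨hT, le_rfl⟩)
  have h1 := norm_le_gronwallBound_of_norm_deriv_right_le (δ := ‖r 0‖) (K := K) (ε := K * S)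
    (a := 0) (b := T) (fun t _ => (hd t).continuousAt.continuousWithinAt)
    (fun t _ => (hd t).hasDerivWithinAt) (by simp) (fun t ht => ?_) T ⟨hT, le_rfl⟩
  · rw [gronwallBound_of_K_ne_0 hK.ne'] at h1
    have h2 : K * S / K = S := by field_simp
    simp only [sub_zero, h2] at h1
    calc ‖r T‖ ≤ ‖r T - ∫ s in (0 : ℝ)..T, f s‖ + ‖∫ s in (0 : ℝ)..T, f s‖ := by
          simpa using norm_add_le (r T - ∫ s in (0 : ℝ)..T, f s) (∫ s in (0 : ℝ)..T, f s)
      _ ≤ (‖r 0‖ * Real.exp (K * T) + S * (Real.exp (K * T) - 1)) + S :=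
          add_le_add h1 (hFS T ⟨hT, le_rfl⟩)
      _ = _ := by ring
  · have ht' : t ∈ Set.Icc 0 T := ⟨ht.1, ht.2.le⟩
    calc ‖M t *ᵥ r t‖ ≤ K * ‖r t‖ := (norm_mulVec_le _ _).trans (by gcongr; exact hM t ht')
      _ ≤ K * (‖r t - ∫ s in (0 : ℝ)..t, f s‖ + S) := by
          gcongr
          calc ‖r t‖ ≤ ‖r t - ∫ s in (0 : ℝ)..t, f s‖ + ‖∫ s in (0 : ℝ)..t, f s‖ := by
                simpa using norm_add_le (r t - ∫ s in (0 : ℝ)..t, f s) (∫ s in (0 : ℝ)..t, f s)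
            _ ≤ _ := by gcongr; exact hFS t ht'
      _ = _ := by ring

/-- Solutions of inhomogeneous linear equations with uniformly bounded coefficients tend to zero
when their initial values and, boundedly, their forcing terms do. -/
theorem tendsto_zero_of_forcing {ι : Type*} {l : Filter ι} [l.IsCountablyGenerated]
    {M : ι → ℝ → Matrix n n ℂ} {r f : ι → ℝ → n → ℂ} {K C T : ℝ}
    (hM : ∀ᶠ i in l, ∀ t, |t| ≤ |T| → entrySum (M i t) ≤ K)
    (hC : ∀ᶠ i in l, ∀ t, |t| ≤ |T| → ‖f i t‖ ≤ C)
    (hf : ∀ᶠ i in l, Continuous (f i)) (hf0 : ∀ t, Tendsto (fun i => f i t) l (𝓝 0))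
    (hr : ∀ᶠ i in l, ∀ t, HasDerivAt (r i) (M i t *ᵥ r i t + f i t) t)
    (hr0 : Tendsto (fun i => r i 0) l (𝓝 0)) : Tendsto (fun i => r i T) l (𝓝 0) := by
  wlog hT : 0 ≤ T generalizing T M r f
  · have := this (M := fun i t => -M i (-t)) (r := fun i t => r i (-t))
      (f := fun i t => -f i (-t)) (T := -T)
      (by filter_upwards [hM] with i hi t ht
          simpa [entrySum] using hi (-t) (by simpa using ht))
      (by filter_upwards [hC] with i hi t ht
          simpa using hi (-t) (by simpa using ht))
      (by filter_upwards [hf] with i hi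
          exact (hi.comp continuous_neg).neg)
      (fun t => by simpa using (hf0 (-t)).neg)
      (by filter_upwards [hr] with i hi t
          refine ((hi (-t)).scomp t (hasDerivAt_neg t)).congr_deriv ?_
          simp [Matrix.neg_mulVec])
      (by simpa using hr0) (by linarith)
    simpa using this
  have hle : ∀ t ∈ Set.Icc 0 T, |t| ≤ |T| := fun t ht => by
    rw [abs_of_nonneg ht.1, abs_of_nonneg hT]; exact ht.2
  have h1 : Tendsto (fun i => ∫ t in (0 : ℝ)..T, ‖f i t‖) l (𝓝 0) := by
    have h := intervalIntegral.tendsto_integral_filter_of_dominated_convergence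
      (μ := volume) (a := 0) (b := T) (F := fun i t => ‖f i t‖) (f := fun _ => 0) (l := l)
      (fun _ => C) (by filter_upwards [hf] with i hi; exact hi.norm.aestronglyMeasurable)
      (by filter_upwards [hC] with i hi
          refine Eventually.of_forall fun t ht => ?_
          rw [Set.uIoc_of_le hT] at ht
          simpa using hi t (hle t ⟨ht.1.le, ht.2⟩))
      (by simp) (Eventually.of_forall fun t _ => by simpa using (hf0 t).norm)
    simpa using h
  -- The rate `|K| + 1` is strictly positive, as the preceding bound demands; nothing is known about
  -- the sign of `K`.
  refine squeeze_zero_norm' (a := fun i =>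
    (‖r i 0‖ + ∫ t in (0 : ℝ)..T, ‖f i t‖) * Real.exp ((|K| + 1) * T)) ?_ ?_
  · filter_upwards [hM, hf, hr] with i h1 h2 h3
    exact norm_le_of_hasDerivAt_add (by positivity) hT
      (fun t ht => (h1 t (hle t ht)).trans ((le_abs_self K).trans (by linarith))) h2 h3
  · simpa using (hr0.norm.add h1).mul_const (Real.exp ((|K| + 1) * T))

theorem norm_sub_le_of_entry_hasDerivAt {f f' : ℝ → ℂ} {x h C : ℝ}
    (hf : ∀ y, HasDerivAt f (f' y) y) (hC : ∀ y, |y - x| ≤ 1 → ‖f' y‖ ≤ C) (hh : |h| ≤ 1) :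
    ‖f (x + h) - f x‖ ≤ C * |h| := by
  have := Convex.norm_image_sub_le_of_norm_hasDerivWithin_le (f := f) (f' := f')
    (s := Metric.closedBall x 1) (C := C) (x := x) (y := x + h)
    (fun y _ => (hf y).hasDerivWithinAt)
    (fun y hy => hC y (by simpa [Real.dist_eq] using hy)) (convex_closedBall x 1)
    (by simp) (by simpa [Real.dist_eq] using hh)
  simpa using this

/-- A solution of the spatial equation at time `0` extends to a simultaneous solution of both
equations of a Lax pair satisfying the zero curvature condition. -/
theorem exists_lax_solution {A E Ex At : ℝ → ℝ → Matrix n n ℂ}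
    (hE : Continuous fun p : ℝ × ℝ => E p.1 p.2) (hExc : Continuous fun p : ℝ × ℝ => Ex p.1 p.2)
    (hEx : ∀ x t i j, HasDerivAt (fun y => E y t i j) (Ex x t i j) x)
    (hAt : ∀ x t i j, HasDerivAt (fun τ => A x τ i j) (At x t i j) t)
    (hzc : ∀ x t, Ex x t = At x t + A x t * E x t - E x t * A x t)
    {ψ₀ : ℝ → n → ℂ} (hψ₀ : ∀ x, HasDerivAt ψ₀ (A x 0 *ᵥ ψ₀ x) x) :
    ∃ ψ : ℝ → ℝ → n → ℂ, (∀ x, ψ x 0 = ψ₀ x) ∧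
      (∀ x t, HasDerivAt (fun y => ψ y t) (A x t *ᵥ ψ x t) x) ∧
      (∀ x t, HasDerivAt (fun τ => ψ x τ) (E x t *ᵥ ψ x t) t) := by
  have hEt : ∀ x, Continuous (E x) := fun x =>
    hE.comp (continuous_const.prodMk continuous_id)
  have hExt : ∀ x, Continuous (Ex x) := fun x =>
    hExc.comp (continuous_const.prodMk continuous_id)
  -- The time equation is solved separately for each `x`, from the given value at `t = 0`. What
  -- remains is to recover the spatial equation.
  choose ψ hψ0 hψt using fun x => exists_solution (hEt x) (ψ₀ x)
  refine ⟨ψ, hψ0, fun x T => ?_, hψt⟩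
  have hψc : ∀ x, Continuous (ψ x) := fun x =>
    continuous_iff_continuousAt.2 fun t => (hψt x t).continuousAt
  have hχ : ∀ t, HasDerivAt (fun t => A x t *ᵥ ψ x t)
      (At x t *ᵥ ψ x t + A x t *ᵥ (E x t *ᵥ ψ x t)) t := fun t =>
    hasDerivAt_mulVec (hAt x t) (hψt x t)
  have hχc : Continuous fun t => A x t *ᵥ ψ x t :=
    continuous_iff_continuousAt.2 fun t => (hχ t).continuousAt
  have hcpt : IsCompact (Metric.closedBall x 1 ×ˢ Set.Icc (-|T|) |T|) :=
    (isCompact_closedBall x 1).prod isCompact_Icc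
  obtain ⟨K, hK⟩ := hcpt.exists_bound_of_continuousOn
    (f := fun p : ℝ × ℝ => entrySum (E p.1 p.2)) (continuous_entrySum.comp hE).continuousOn
  obtain ⟨C, hC⟩ := hcpt.exists_bound_of_continuousOn
    (f := fun p : ℝ × ℝ => entrySum (Ex p.1 p.2)) (continuous_entrySum.comp hExc).continuousOn
  obtain ⟨P, hP⟩ := (isCompact_Icc (a := -|T|) (b := |T|)).exists_bound_of_continuousOn
    (f := ψ x) (hψc x).continuousOn
  obtain ⟨X, hX⟩ := (isCompact_Icc (a := -|T|) (b := |T|)).exists_bound_of_continuousOn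
    (f := fun t => A x t *ᵥ ψ x t) hχc.continuousOn
  have hK' : ∀ y, |y - x| ≤ 1 → ∀ t, |t| ≤ |T| → entrySum (E y t) ≤ K := fun y hy t ht =>
    (le_abs_self _).trans (hK (y, t) ⟨by simpa [Real.dist_eq] using hy, abs_le.1 ht⟩)
  have hC' : ∀ y, |y - x| ≤ 1 → ∀ t, |t| ≤ |T| → ∀ i j, ‖Ex y t i j‖ ≤ C := fun y hy t ht i j => by
    have h1 := (le_abs_self _).trans
      (hC (y, t) ⟨by simpa [Real.dist_eq] using hy, abs_le.1 ht⟩)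
    exact (norm_apply_le_entrySum _ i j).trans h1
  have hsmall : ∀ᶠ h : ℝ in 𝓝[≠] 0, |h| ≤ 1 ∧ h ≠ 0 := by
    have h1 : ∀ᶠ h : ℝ in 𝓝 0, |h| ≤ 1 :=
      (continuous_abs.tendsto' (0 : ℝ) 0 abs_zero).eventually_le_const one_pos
    filter_upwards [nhdsWithin_le_nhds h1, self_mem_nhdsWithin] with h hh hh0
    exact ⟨hh, hh0⟩
  have hslope : ∀ t i j, Tendsto (fun h : ℝ => h⁻¹ • (E (x + h) t i j - E x t i j)) (𝓝[≠] 0)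
      (𝓝 (Ex x t i j)) := fun t i j => (hEx x t i j).tendsto_slope_zero
  have hmul : Continuous fun q : Matrix n n ℂ × (n → ℂ) => q.1 *ᵥ q.2 :=
    continuous_fst.matrix_mulVec continuous_snd
  -- The difference quotient minus `Aψ` solves a forced linear equation in `t` whose forcing and
  -- initial value tend to zero with `h`. No regularity of mixed derivatives of `ψ` is needed.
  rw [hasDerivAt_iff_tendsto_slope_zero, ← tendsto_sub_nhds_zero_iff]
  refine tendsto_zero_of_forcing (M := fun h t => E (x + h) t)
    (r := fun h t => h⁻¹ • (ψ (x + h) t - ψ x t) - A x t *ᵥ ψ x t)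
    (f := fun h t => (E (x + h) t - E x t) *ᵥ (A x t *ᵥ ψ x t) +
      (h⁻¹ • (E (x + h) t - E x t) - Ex x t) *ᵥ ψ x t)
    (K := K) (C := (∑ _i : n, ∑ _j : n, (2 * C)) * X + (∑ _i : n, ∑ _j : n, (2 * C)) * P) (T := T)
    ?_ ?_ ?_ ?_ ?_ ?_
  · filter_upwards [hsmall] with h hh t ht
    exact hK' _ (by simpa using hh.1) t ht
  · filter_upwards [hsmall] with h hh t ht
    have hC0 : ∀ _ : n, 0 ≤ C := fun i =>
      (norm_nonneg _).trans (hC' x (by simp) t ht i i)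
    have hd : ∀ i j, ‖E (x + h) t i j - E x t i j‖ ≤ C * |h| := fun i j =>
      norm_sub_le_of_entry_hasDerivAt (f := fun y => E y t i j) (fun y => hEx y t i j)
        (fun y hy => hC' y hy t ht i j) hh.1
    have ht' : t ∈ Set.Icc (-|T|) |T| := abs_le.1 ht
    have h1 : entrySum (E (x + h) t - E x t) ≤ ∑ _i : n, ∑ _j : n, (2 * C) := by
      refine Finset.sum_le_sum fun i _ => Finset.sum_le_sum fun j _ => ?_
      refine (hd i j).trans ?_
      nlinarith [hC0 i, hh.1]
    have h2 : entrySum (h⁻¹ • (E (x + h) t - E x t) - Ex x t) ≤ ∑ _i : n, ∑ _j : n, (2 * C) := by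
      refine Finset.sum_le_sum fun i _ => Finset.sum_le_sum fun j _ => ?_
      refine (norm_sub_le _ _).trans ?_
      have h3 : ‖(h⁻¹ • (E (x + h) t - E x t)) i j‖ ≤ C := by
        rw [Matrix.smul_apply, Matrix.sub_apply, norm_smul, norm_inv, Real.norm_eq_abs,
          inv_mul_le_iff₀ (abs_pos.2 hh.2), mul_comm]
        exact hd i j
      linarith [hC' x (by simp) t ht i j]
    refine (norm_add_le _ _).trans (add_le_add ?_ ?_)
    · exact (norm_mulVec_le _ _).trans (mul_le_mul h1 (hX t ht') (norm_nonneg _)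
        ((entrySum_nonneg _).trans h1))
    · exact (norm_mulVec_le _ _).trans (mul_le_mul h2 (hP t ht') (norm_nonneg _)
        ((entrySum_nonneg _).trans h2))
  · refine Eventually.of_forall fun h => ?_
    have h1 := hEt (x + h)
    have h2 := hEt x
    have h3 := hExt x
    have h4 := hψc x
    have h5 : Continuous fun t => E (x + h) t - E x t := h1.sub h2
    have h6 : Continuous fun t => h⁻¹ • (E (x + h) t - E x t) - Ex x t :=
      (h5.const_smul h⁻¹).sub h3
    exact (h5.matrix_mulVec hχc).add (h6.matrix_mulVec h4)
  · intro t
    have hx : Tendsto (fun h : ℝ => x + h) (𝓝[≠] 0) (𝓝 x) := by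
      have : Tendsto (fun h : ℝ => x + h) (𝓝 0) (𝓝 (x + 0)) :=
        (continuous_const.add continuous_id).tendsto 0
      rw [add_zero] at this
      exact this.mono_left nhdsWithin_le_nhds
    have h1 : Tendsto (fun h : ℝ => E (x + h) t - E x t) (𝓝[≠] 0) (𝓝 0) := by
      have hc : Continuous fun y => E y t := hE.comp (continuous_id.prodMk continuous_const)
      simpa using ((hc.tendsto x).comp hx).sub_const (E x t)
    have h2 : Tendsto (fun h : ℝ => h⁻¹ • (E (x + h) t - E x t) - Ex x t) (𝓝[≠] 0) (𝓝 0) := by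
      rw [tendsto_sub_nhds_zero_iff]
      exact tendsto_pi_nhds.2 fun i => tendsto_pi_nhds.2 fun j => hslope t i j
    have h3 := (hmul.tendsto (0, A x t *ᵥ ψ x t)).comp (h1.prodMk_nhds tendsto_const_nhds)
    have h4 := (hmul.tendsto (0, ψ x t)).comp (h2.prodMk_nhds tendsto_const_nhds)
    simpa using h3.add h4
  · refine Eventually.of_forall fun h t => ?_
    refine ((((hψt (x + h) t).fun_sub (hψt x t)).fun_const_smul h⁻¹).fun_sub (hχ t)).congr_deriv ?_
    -- Zero curvature enters here: it rewrites the time derivative of `Aψ` as `E_x ψ + E A ψ`, which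
    -- cancels the leading part of the differentiated quotient.
    have h1 : At x t *ᵥ ψ x t + A x t *ᵥ E x t *ᵥ ψ x t =
        Ex x t *ᵥ ψ x t + E x t *ᵥ A x t *ᵥ ψ x t := by
      rw [hzc x t, Matrix.sub_mulVec, Matrix.add_mulVec, Matrix.mulVec_mulVec,
        Matrix.mulVec_mulVec]
      abel
    rw [h1]
    simp only [Matrix.mulVec_sub, Matrix.sub_mulVec, Matrix.smul_mulVec, Matrix.mulVec_smul,
      smul_sub]
    abel
  · have h1 := hasDerivAt_iff_tendsto_slope_zero.1 (hψ₀ x)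
    rw [← tendsto_sub_nhds_zero_iff] at h1
    simpa [hψ0] using h1

end LinearODE

end CoupledLPD

namespace CoupledLPD

instance Side.filter_isCountablyGenerated (s : Side) : s.filter.IsCountablyGenerated := by
  cases s <;> unfold Side.filter <;> infer_instance

instance Side.filter_neBot (s : Side) : s.filter.NeBot := by
  cases s <;> unfold Side.filter <;> infer_instance

/-- The half-lines with endpoint `a` which reach to an end of the line. -/
def Side.halfLine : Side → ℝ → Set ℝ
  | Side.minus => Set.Iic
  | Side.plus => Set.Ici

/-- The sign of an end of the line. -/
def Side.sgn : Side → ℝ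
  | Side.minus => -1
  | Side.plus => 1

/-! ### Integrable perturbations of a diagonalizable constant matrix. -/

section Perturbation

variable {n : Type*} [Fintype n] [DecidableEq n]

omit [DecidableEq n] in
theorem entrySum_mul_le (M N : Matrix n n ℂ) : entrySum (M * N) ≤ entrySum M * entrySum N := by
  calc entrySum (M * N) ≤ ∑ i, ∑ k, ∑ j, ‖M i j‖ * ‖N j k‖ := by
        refine Finset.sum_le_sum fun i _ => Finset.sum_le_sum fun k _ => ?_
        refine (norm_sum_le _ _).trans (le_of_eq ?_)
        simp only [norm_mul]
    _ = ∑ i, ∑ j, ‖M i j‖ * ∑ k, ‖N j k‖ := by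
        refine Finset.sum_congr rfl fun i _ => ?_
        rw [Finset.sum_comm]
        simp only [Finset.mul_sum]
    _ ≤ ∑ i, ∑ j, ‖M i j‖ * entrySum N := by
        gcongr with i _ j _
        exact Finset.single_le_sum (f := fun j => ∑ k, ‖N j k‖)
          (fun _ _ => Finset.sum_nonneg fun _ _ => norm_nonneg _) (Finset.mem_univ j)
    _ = _ := by simp only [entrySum, Finset.sum_mul]

omit [DecidableEq n] in
theorem entrySum_sub_le (M N : Matrix n n ℂ) : entrySum (M - N) ≤ entrySum M + entrySum N := by
  simp only [entrySum, ← Finset.sum_add_distrib]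
  exact Finset.sum_le_sum fun i _ => Finset.sum_le_sum fun j _ => norm_sub_le _ _

/-- `A` is continuous, and near the end `s` it is an integrable perturbation of the matrix
`Y diag(d) Y⁻¹`. -/
structure IsPerturbation (s : Side) (A : ℝ → Matrix n n ℂ) (A' Y Y' : Matrix n n ℂ)
    (d : n → ℂ) : Prop where
  continuous : Continuous A
  integrable : ∀ a, IntegrableOn (fun x => entrySum (A x - A')) (s.halfLine a)
  mul_inv : Y * Y' = 1
  inv_mul : Y' * Y = 1
  eigen : A' * Y = Y * diagonal d

namespace IsPerturbation

variable {s : Side} {A : ℝ → Matrix n n ℂ} {A' Y Y' : Matrix n n ℂ} {d : n → ℂ}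

/-- The substitution `x ↦ -x` exchanges the ends and negates matrix and growth rates, so each
estimate has to be proved at one end only. -/
theorem reflect (h : IsPerturbation Side.plus A A' Y Y' d) :
    IsPerturbation Side.minus (fun x => -A (-x)) (-A') Y Y' (-d) where
  continuous := (h.continuous.comp continuous_neg).neg
  integrable a := by
    have h1 : IntegrableOn (fun x => entrySum (A x - A')) (Set.Ici (-a)) := h.integrable (-a)
    have h2 := h1.comp_neg_Iic
    refine h2.congr_fun (fun x _ => ?_) measurableSet_Iic
    simp only [entrySum, Matrix.sub_apply, Matrix.neg_apply, neg_sub_neg]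
    exact Finset.sum_congr rfl fun i _ => Finset.sum_congr rfl fun j _ => norm_sub_rev _ _
  mul_inv := h.mul_inv
  inv_mul := h.inv_mul
  eigen := by
    rw [Matrix.neg_mul, h.eigen, ← Matrix.mul_neg, Matrix.diagonal_neg]
    rfl

theorem reflect' (h : IsPerturbation Side.minus A A' Y Y' d) :
    IsPerturbation Side.plus (fun x => -A (-x)) (-A') Y Y' (-d) where
  continuous := (h.continuous.comp continuous_neg).neg
  integrable a := by
    have h1 : IntegrableOn (fun x => entrySum (A x - A')) (Set.Iic (-a)) := h.integrable (-a)
    have h2 := h1.comp_neg_Ici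
    refine h2.congr_fun (fun x _ => ?_) measurableSet_Ici
    simp only [entrySum, Matrix.sub_apply, Matrix.neg_apply, neg_sub_neg]
    exact Finset.sum_congr rfl fun i _ => Finset.sum_congr rfl fun j _ => norm_sub_rev _ _
  mul_inv := h.mul_inv
  inv_mul := h.inv_mul
  eigen := by
    rw [Matrix.neg_mul, h.eigen, ← Matrix.mul_neg, Matrix.diagonal_neg]
    rfl

omit [DecidableEq n] in
theorem hasDerivAt_reflect {ψ : ℝ → n → ℂ} (hψ : ∀ x, HasDerivAt ψ (A x *ᵥ ψ x) x) (x : ℝ) :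
    HasDerivAt (fun x => ψ (-x)) ((-A (-x)) *ᵥ ψ (-x)) x :=
  ((hψ (-x)).scomp x (hasDerivAt_neg x)).congr_deriv (by simp [Matrix.neg_mulVec])

omit [DecidableEq n] in
theorem hasDerivAt_exp_smul {ψ : ℝ → n → ℂ} {v : n → ℂ} {x : ℝ} (hψ : HasDerivAt ψ v x) (c : ℂ) :
    HasDerivAt (fun x : ℝ => Complex.exp (c * x) • ψ x)
      (Complex.exp (c * x) • (v + c • ψ x)) x := by
  have h1 : HasDerivAt (fun x : ℝ => Complex.exp (c * x)) (Complex.exp (c * x) * c) x := by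
    have : HasDerivAt (fun x : ℝ => c * (x : ℂ)) c x := by
      simpa using (Complex.ofRealCLM.hasDerivAt (x := x)).const_mul c
    exact this.cexp
  refine (h1.smul hψ).congr_deriv ?_
  rw [smul_add, smul_smul]

omit [DecidableEq n] in
theorem hasDerivAt_const_mulVec {ψ : ℝ → n → ℂ} {v : n → ℂ} {x : ℝ} (hψ : HasDerivAt ψ v x)
    (M : Matrix n n ℂ) : HasDerivAt (fun x => M *ᵥ ψ x) (M *ᵥ v) x :=
  (hasDerivAt_mulVec (M := fun _ => M) (M' := 0) (fun _ _ => hasDerivAt_const _ _) hψ).congr_deriv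
    (by simp)

theorem continuous_conj (h : IsPerturbation s A A' Y Y' d) :
    Continuous fun x => Y' * (A x - A') * Y :=
  (continuous_const.matrix_mul (h.continuous.sub continuous_const)).matrix_mul continuous_const

theorem integrable_conj (h : IsPerturbation s A A' Y Y' d) (a : ℝ) :
    IntegrableOn (fun x => entrySum (Y' * (A x - A') * Y)) (s.halfLine a) := by
  refine (((h.integrable a).const_mul (entrySum Y')).mul_const (entrySum Y)).mono'
    (continuous_entrySum.comp h.continuous_conj).aestronglyMeasurable
    (Eventually.of_forall fun x => ?_)
  rw [Real.norm_of_nonneg (entrySum_nonneg _)]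
  refine (entrySum_mul_le _ _).trans ?_
  have := entrySum_nonneg Y
  gcongr
  exact entrySum_mul_le _ _

/-- Solutions in the coordinates in which the unperturbed equation is diagonal. -/
theorem hasDerivAt_coord (h : IsPerturbation s A A' Y Y' d) {ψ : ℝ → n → ℂ}
    (hψ : ∀ x, HasDerivAt ψ (A x *ᵥ ψ x) x) (c : ℂ) (x : ℝ) :
    HasDerivAt (fun x : ℝ => Y' *ᵥ (Complex.exp (-c * x) • ψ x))
      (fun i => (d i - c) * (Y' *ᵥ (Complex.exp (-c * x) • ψ x)) i +
        ((Y' * (A x - A') * Y) *ᵥ (Y' *ᵥ (Complex.exp (-c * x) • ψ x))) i) x := by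
  refine (hasDerivAt_const_mulVec (hasDerivAt_exp_smul (hψ x) (-c)) Y').congr_deriv ?_
  set w := Complex.exp (-c * x) • ψ x with hw
  have h1 : Complex.exp (-c * x) • (A x *ᵥ ψ x + -c • ψ x) = A x *ᵥ w - c • w := by
    rw [hw, Matrix.mulVec_smul, smul_add, smul_comm, neg_smul, sub_eq_add_neg]
  clear_value w
  have h2 : Y' * A' = diagonal d * Y' := by
    calc Y' * A' = Y' * (A' * Y) * Y' := by
          rw [Matrix.mul_assoc, Matrix.mul_assoc, h.mul_inv, Matrix.mul_one]
      _ = diagonal d * Y' := by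
          rw [h.eigen, ← Matrix.mul_assoc, h.inv_mul, Matrix.one_mul]
  have h3 : (Y' * (A x - A') * Y) *ᵥ (Y' *ᵥ w) =
      Y' *ᵥ (A x *ᵥ w) - diagonal d *ᵥ (Y' *ᵥ w) := by
    rw [Matrix.mulVec_mulVec, Matrix.mul_assoc, h.mul_inv, Matrix.mul_one, Matrix.mul_sub,
      Matrix.sub_mulVec, h2, ← Matrix.mulVec_mulVec, ← Matrix.mulVec_mulVec]
  rw [h1, h3, Matrix.mulVec_sub, Matrix.mulVec_smul]
  funext i
  simp only [Pi.sub_apply, Pi.smul_apply, smul_eq_mul, Matrix.mulVec_diagonal]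
  ring

/-- In the eigenvector coordinates, after removing `e^{d_j x}`, the rates are `d_i - d_j`. Their
real parts are nonpositive because `d_j` has maximal real part, and the `j`-th basis vector is a
constant solution of the unperturbed equation. -/
theorem exists_jost_minus (h : IsPerturbation Side.minus A A' Y Y' d) {j : n}
    (hd : ∀ i, (d i).re ≤ (d j).re) :
    ∃ ψ : ℝ → n → ℂ, (∀ x, HasDerivAt ψ (A x *ᵥ ψ x) x) ∧
      Tendsto (fun x : ℝ => Complex.exp (-d j * x) • ψ x) atBot (𝓝 (Y.col j)) := by
  obtain ⟨f, hf, hfv⟩ := exists_solution_tendsto_atBot (d := fun i => d i - d j)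
    h.continuous_conj h.integrable_conj
    (fun i => by simpa using hd i) (Pi.single j 1)
    (fun i => by by_cases hij : i = j <;> simp [hij])
  refine ⟨fun x => Complex.exp (d j * x) • (Y *ᵥ f x), fun x => ?_, ?_⟩
  · refine (hasDerivAt_exp_smul (hasDerivAt_const_mulVec (hf x) Y) (d j)).congr_deriv ?_
    rw [Matrix.mulVec_smul]
    congr 1
    have h1 : (fun i => (d i - d j) * f x i + ((Y' * (A x - A') * Y) *ᵥ f x) i) =
        diagonal d *ᵥ f x - d j • f x + (Y' * (A x - A') * Y) *ᵥ f x := by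
      funext i
      simp only [Pi.add_apply, Pi.sub_apply, Pi.smul_apply, smul_eq_mul, Matrix.mulVec_diagonal]
      ring
    rw [h1, Matrix.mulVec_add, Matrix.mulVec_sub, Matrix.mulVec_smul, Matrix.mulVec_mulVec,
      Matrix.mulVec_mulVec, ← h.eigen, Matrix.mul_assoc, ← Matrix.mul_assoc Y, h.mul_inv,
      Matrix.one_mul, Matrix.sub_mul, Matrix.sub_mulVec, Matrix.mulVec_mulVec]
    abel
  · have hc : Continuous fun v : n → ℂ => Y *ᵥ v := continuous_const.matrix_mulVec continuous_id
    have h2 := (hc.tendsto _).comp hfv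
    rw [Matrix.mulVec_single_one] at h2
    refine h2.congr fun x => ?_
    rw [smul_smul, ← Complex.exp_add]
    simp

theorem exists_jost (h : IsPerturbation s A A' Y Y' d) {j : n}
    (hd : ∀ i, s.sgn * (d j).re ≤ s.sgn * (d i).re) :
    ∃ ψ : ℝ → n → ℂ, (∀ x, HasDerivAt ψ (A x *ᵥ ψ x) x) ∧
      Tendsto (fun x : ℝ => Complex.exp (-d j * x) • ψ x) s.filter (𝓝 (Y.col j)) := by
  cases s with
  | minus => exact h.exists_jost_minus fun i => by simpa [Side.sgn] using hd i
  | plus =>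
    obtain ⟨ψ, h1, h2⟩ := h.reflect.exists_jost_minus (j := j)
      fun i => by simpa [Side.sgn] using hd i
    refine ⟨fun x => ψ (-x), fun x => ?_, ?_⟩
    · simpa using hasDerivAt_reflect h1 x
    · refine (h2.comp tendsto_neg_atTop_atBot).congr fun x => ?_
      simp

/-- The same dominance of `d_j` that gives existence gives uniqueness: the rescaled solution has
only nonpositive rates, so smallness at `-∞` propagates. -/
theorem eq_zero_minus (h : IsPerturbation Side.minus A A' Y Y' d) {j : n}
    (hd : ∀ i, (d i).re ≤ (d j).re) {ψ : ℝ → n → ℂ} (hψ : ∀ x, HasDerivAt ψ (A x *ᵥ ψ x) x)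
    (h0 : Tendsto (fun x : ℝ => Complex.exp (-d j * x) • ψ x) atBot (𝓝 0)) (x : ℝ) :
    ψ x = 0 := by
  have hc : Continuous fun v : n → ℂ => Y' *ᵥ v := continuous_const.matrix_mulVec continuous_id
  have h2 := (hc.tendsto _).comp h0
  rw [Matrix.mulVec_zero] at h2
  have h1 := eq_zero_of_tendsto_atBot (d := fun i => d i - d j) (fun i => by simpa using hd i)
    h.continuous_conj (h.integrable_conj 0) (h.hasDerivAt_coord hψ (d j)) h2 x
  have h3 : Y *ᵥ (Y' *ᵥ (Complex.exp (-d j * x) • ψ x)) = 0 := by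
    rw [h1, Matrix.mulVec_zero]
  rw [Matrix.mulVec_mulVec, h.mul_inv, Matrix.one_mulVec] at h3
  exact (smul_eq_zero.1 h3).resolve_left (Complex.exp_ne_zero _)

theorem eq_zero (h : IsPerturbation s A A' Y Y' d) {j : n}
    (hd : ∀ i, s.sgn * (d j).re ≤ s.sgn * (d i).re) {ψ : ℝ → n → ℂ}
    (hψ : ∀ x, HasDerivAt ψ (A x *ᵥ ψ x) x)
    (h0 : Tendsto (fun x : ℝ => Complex.exp (-d j * x) • ψ x) s.filter (𝓝 0)) (x : ℝ) :
    ψ x = 0 := by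
  cases s with
  | minus => exact h.eq_zero_minus (fun i => by simpa [Side.sgn] using hd i) hψ h0 x
  | plus =>
    have := h.reflect.eq_zero_minus (j := j) (fun i => by simpa [Side.sgn] using hd i)
      (hasDerivAt_reflect hψ) ((h0.comp tendsto_neg_atBot_atTop).congr fun x => by simp) (-x)
    simpa using this

/-- At the end opposite to its normalization a Jost solution need not have a known limit;
boundedness of the rescaled solution is all that the scattering coefficients require. -/
theorem bounded_plus (h : IsPerturbation Side.plus A A' Y Y' d) {j : n}
    (hd : ∀ i, (d i).re ≤ (d j).re) {ψ : ℝ → n → ℂ} (hψ : ∀ x, HasDerivAt ψ (A x *ᵥ ψ x) x) :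
    ∃ C, ∀ x : ℝ, 0 ≤ x → ‖Complex.exp (-d j * x) • ψ x‖ ≤ C := by
  obtain ⟨C, hC⟩ := bounded_of_integrable (d := fun i => d i - d j) (fun i => by simpa using hd i)
    h.continuous_conj (h.integrable_conj 0) (h.hasDerivAt_coord hψ (d j))
  refine ⟨entrySum Y * |C|, fun x hx => ?_⟩
  have h1 : Complex.exp (-d j * x) • ψ x = Y *ᵥ (Y' *ᵥ (Complex.exp (-d j * x) • ψ x)) := by
    rw [Matrix.mulVec_mulVec, h.mul_inv, Matrix.one_mulVec]
  rw [h1]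
  refine (norm_mulVec_le _ _).trans ?_
  have := entrySum_nonneg Y
  gcongr
  exact (pi_norm_le_iff_of_nonneg (abs_nonneg C)).2 fun i => (hC x hx i).trans (le_abs_self C)

/-- A solution is bounded at an end of the line by the exponential of the maximal growth rate. -/
theorem bounded (h : IsPerturbation s A A' Y Y' d) {j : n}
    (hd : ∀ i, s.sgn * (d i).re ≤ s.sgn * (d j).re) {ψ : ℝ → n → ℂ}
    (hψ : ∀ x, HasDerivAt ψ (A x *ᵥ ψ x) x) :
    ∃ C, ∀ᶠ x : ℝ in s.filter, ‖Complex.exp (-d j * x) • ψ x‖ ≤ C := by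
  cases s with
  | plus =>
    obtain ⟨C, hC⟩ := h.bounded_plus (fun i => by simpa [Side.sgn] using hd i) hψ
    exact ⟨C, (eventually_ge_atTop 0).mono hC⟩
  | minus =>
    obtain ⟨C, hC⟩ := h.reflect'.bounded_plus (j := j) (fun i => by simpa [Side.sgn] using hd i)
      (hasDerivAt_reflect hψ)
    refine ⟨C, (eventually_le_atBot 0).mono fun x hx => ?_⟩
    simpa using hC (-x) (by linarith)

end IsPerturbation

/-- Jost solutions of a Lax pair. -/
theorem exists_isJost {A E Ex At : ℝ → ℝ → Matrix (Fin 3) (Fin 3) ℂ}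
    (hE : Continuous fun p : ℝ × ℝ => E p.1 p.2) (hExc : Continuous fun p : ℝ × ℝ => Ex p.1 p.2)
    (hEx : ∀ x t i j, HasDerivAt (fun y => E y t i j) (Ex x t i j) x)
    (hAt : ∀ x t i j, HasDerivAt (fun τ => A x τ i j) (At x t i j) t)
    (hzc : ∀ x t, Ex x t = At x t + A x t * E x t - E x t * A x t)
    {s : Side} {A' E' Y Y' : Matrix (Fin 3) (Fin 3) ℂ} {d : Fin 3 → ℂ} {b : ℂ} {j : Fin 3}
    (hA : IsPerturbation s (fun x => A x 0) A' Y Y' d)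
    (hd : ∀ i, s.sgn * (d j).re ≤ s.sgn * (d i).re)
    (hEY : E' *ᵥ Y.col j = b • Y.col j)
    (hElim : ∀ t, Tendsto (fun x => E x t) s.filter (𝓝 E'))
    (hEb : ∀ T, ∃ K, ∀ x t, |t| ≤ T → entrySum (E x t) ≤ K)
    {φ : ℝ → ℝ → ℂ} (hφ : ∀ x t, I * φ x t = d j * x + b * t) :
    ∃ ψ, IsJost A E φ (Y.col j) s.filter ψ := by
  obtain ⟨ψ₀, hψ₀, hlim⟩ := hA.exists_jost hd
  obtain ⟨ψ, hψ0, hψx, hψt⟩ := exists_lax_solution hE hExc hEx hAt hzc hψ₀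
  refine ⟨ψ, hψx, hψt, fun T => ?_⟩
  have hEt : ∀ x, Continuous (E x) := fun x =>
    hE.comp (continuous_const.prodMk continuous_id)
  obtain ⟨K, hK⟩ := hEb |T|
  have hmul : ∀ v : Fin 3 → ℂ, Continuous fun M : Matrix (Fin 3) (Fin 3) ℂ => M *ᵥ v := fun v =>
    continuous_id.matrix_mulVec continuous_const
  have hconv : ∀ t, Tendsto (fun x => (E x t - E') *ᵥ Y.col j) s.filter (𝓝 0) := fun t => by
    simpa [Function.comp_def] using ((hmul (Y.col j)).tendsto _).comp ((hElim t).sub_const E')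
  have hφ' : ∀ x t, Complex.exp (-I * φ x t) = Complex.exp (-d j * x) * Complex.exp (-b * t) := by
    intro x t
    rw [← Complex.exp_add, neg_mul, hφ]
    ring_nf
  rw [← tendsto_sub_nhds_zero_iff]
  -- The remainder `r = e^{-iφ}ψ - Y_j` satisfies `r_t = (E - b) r + (E - E') Y_j`, because `E' Y_j
  -- = b Y_j`. The forcing tends to zero for each `t` and is bounded for bounded `t`.
  refine tendsto_zero_of_forcing (M := fun x t => E x t - b • (1 : Matrix (Fin 3) (Fin 3) ℂ))
    (r := fun x t => Complex.exp (-I * φ x t) • ψ x t - Y.col j)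
    (f := fun x t => (E x t - E') *ᵥ Y.col j)
    (K := K + entrySum (b • (1 : Matrix (Fin 3) (Fin 3) ℂ)))
    (C := (K + entrySum E') * ‖Y.col j‖) (T := T) ?_ ?_ ?_ hconv ?_ ?_
  · exact Eventually.of_forall fun x t ht =>
      (entrySum_sub_le _ _).trans (add_le_add_left (hK x t ht) _)
  · exact Eventually.of_forall fun x t ht => (norm_mulVec_le _ _).trans
      (mul_le_mul_of_nonneg_right ((entrySum_sub_le _ _).trans (add_le_add_left (hK x t ht) _))
        (norm_nonneg _))
  · exact Eventually.of_forall fun x => ((hEt x).sub continuous_const).matrix_mulVec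
      continuous_const
  · refine Eventually.of_forall fun x t => ?_
    have h1 := (IsPerturbation.hasDerivAt_exp_smul (hψt x t) (-b)).const_smul
      (Complex.exp (-d j * x))
    have h2 : (fun t => Complex.exp (-I * φ x t) • ψ x t - Y.col j) =
        fun t : ℝ => Complex.exp (-d j * x) • Complex.exp (-b * t) • ψ x t - Y.col j := by
      funext t
      rw [hφ', mul_smul]
    rw [h2]
    refine (h1.sub_const (Y.col j)).congr_deriv ?_
    rw [hφ', mul_smul]
    simp only [Matrix.sub_mulVec, Matrix.mulVec_sub, Matrix.smul_mulVec, Matrix.mulVec_smul,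
      Matrix.one_mulVec, hEY, smul_add, smul_sub, neg_smul, smul_neg]
    abel
  · have : ∀ x : ℝ, Complex.exp (-I * φ x 0) • ψ x 0 = Complex.exp (-d j * x) • ψ₀ x := by
      intro x
      rw [hφ', hψ0]
      simp
    simp only [this]
    rw [tendsto_sub_nhds_zero_iff]
    exact hlim

end Perturbation

end CoupledLPD

/-! ### The temporal matrix as a polynomial in the jet, and zero curvature. -/

namespace CoupledLPD

/-- `F` has the entrywise derivative `F'` at `x`. -/
def HasEntryDerivAt (F : ℝ → Matrix (Fin 3) (Fin 3) ℂ) (F' : Matrix (Fin 3) (Fin 3) ℂ)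
    (x : ℝ) : Prop :=
  ∀ i j, HasDerivAt (fun y => F y i j) (F' i j) x

namespace HasEntryDerivAt

variable {F G : ℝ → Matrix (Fin 3) (Fin 3) ℂ} {F' G' : Matrix (Fin 3) (Fin 3) ℂ} {x : ℝ}

theorem const (M : Matrix (Fin 3) (Fin 3) ℂ) : HasEntryDerivAt (fun _ => M) 0 x :=
  fun _ _ => hasDerivAt_const _ _

theorem add (hF : HasEntryDerivAt F F' x) (hG : HasEntryDerivAt G G' x) :
    HasEntryDerivAt (fun y => F y + G y) (F' + G') x := fun i j => (hF i j).add (hG i j)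

theorem sub (hF : HasEntryDerivAt F F' x) (hG : HasEntryDerivAt G G' x) :
    HasEntryDerivAt (fun y => F y - G y) (F' - G') x := fun i j => (hF i j).sub (hG i j)

theorem smul {f : ℝ → ℂ} {f' : ℂ} (hf : HasDerivAt f f' x) (hG : HasEntryDerivAt G G' x) :
    HasEntryDerivAt (fun y => f y • G y) (f' • G x + f x • G') x :=
  fun i j => hf.mul (hG i j)

theorem const_smul (c : ℂ) (hG : HasEntryDerivAt G G' x) :
    HasEntryDerivAt (fun y => c • G y) (c • G') x :=
  fun i j => (hG i j).const_mul c

theorem mul (hF : HasEntryDerivAt F F' x) (hG : HasEntryDerivAt G G' x) :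
    HasEntryDerivAt (fun y => F y * G y) (F' * G x + F x * G') x := by
  intro i j
  simp only [Matrix.mul_apply, Matrix.add_apply, ← Finset.sum_add_distrib]
  exact HasDerivAt.fun_sum fun k _ => (hF i k).mul (hG k j)

end HasEntryDerivAt

namespace Data

variable (D : Data)

theorem continuous_blockQ : Continuous blockQ := by
  refine continuous_pi fun i => continuous_pi fun j => ?_
  fin_cases i <;> fin_cases j <;> simp [blockQ] <;> fun_prop

theorem hasEntryDerivAt_blockQ {f : ℝ → Vec2} {f' : Vec2} {x : ℝ} (hf : HasDerivAt f f' x) :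
    HasEntryDerivAt (fun y => blockQ (f y)) (blockQ f') x := by
  have h1 : ∀ i : Fin 2, HasDerivAt (fun y => f y i) (f' i) x := fun i =>
    ((EuclideanSpace.proj (𝕜 := ℂ) i).restrictScalars ℝ).hasFDerivAt.comp_hasDerivAt x hf
  have h2 : ∀ i : Fin 2, HasDerivAt (fun y => (starRingEnd ℂ) (f y i))
      ((starRingEnd ℂ) (f' i)) x := fun i => (h1 i).star
  intro i j
  fin_cases i <;> fin_cases j <;> simp [blockQ] <;>
    first
    | exact hasDerivAt_const _ _
    | exact h2 _
    | exact (h1 _).fun_neg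

/-- The Hermitian form `v† w` on `ℂ²`. -/
noncomputable def herm (v w : Vec2) : ℂ :=
  (starRingEnd ℂ) (v 0) * w 0 + (starRingEnd ℂ) (v 1) * w 1

theorem inner_eq_herm (v w : Vec2) : inner ℂ v w = herm v w := by
  simp [PiLp.inner_apply, herm, Fin.sum_univ_two, mul_comm]

theorem ofReal_norm_sq (v : Vec2) : ((‖v‖ : ℝ) : ℂ) ^ 2 = herm v v := by
  rw [← inner_eq_herm, inner_self_eq_norm_sq_to_K]
  rfl

@[fun_prop]
theorem continuous_herm : Continuous fun p : Vec2 × Vec2 => herm p.1 p.2 := by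
  unfold herm
  fun_prop

theorem hasDerivAt_herm {f g : ℝ → Vec2} {f' g' : Vec2} {x : ℝ} (hf : HasDerivAt f f' x)
    (hg : HasDerivAt g g' x) :
    HasDerivAt (fun y => herm (f y) (g y)) (herm f' (g x) + herm (f x) g') x := by
  simp only [← inner_eq_herm]
  refine (hf.inner ℂ hg).congr_deriv ?_
  rw [add_comm]

/-- The temporal matrix as a function of the jet of `q`. -/
noncomputable def timeMatrix (z : ℂ) (q q1 q2 q3 : Vec2) : Matrix (Fin 3) (Fin 3) ℂ :=
  let κ := D.k z
  let s : ℂ := (D.sigma : ℂ)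
  let a : ℂ := (D.amp : ℂ)
  let n : ℂ := herm q q
  let Q := blockQ q
  let Qx := blockQ q1
  let Qxx := blockQ q2
  let Qxxx := blockQ q3
  (2 * κ) • (s • (Qx * Q - Q * Qx) - (2 * s * n) • Q - s • Qxx - Q)
    + (I * a ^ 2) • J + (3 * I * s * a ^ 4) • J
    + (4 * I * κ ^ 2) • (J₁ + s • (J * (Qx - Q * Q)))
    + (8 * s * κ ^ 3) • Q - (8 * I * s * κ ^ 4) • J
    + (3 * I * s) • (J * (Qx * (Q * Q) + Q * Q * Qx))
    + (I * s) • (J * (Qxx * Q + Q * Qxx - Qxxx - Qx * Qx))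
    + (I * (1 + 3 * s * n)) • (J * (Q * Q))
    - I • (J * Qx)

/-- The spatial derivative of the temporal matrix. -/
noncomputable def timeMatrixDeriv (z : ℂ) (q q1 q2 q3 q4 : Vec2) : Matrix (Fin 3) (Fin 3) ℂ :=
  let κ := D.k z
  let s : ℂ := (D.sigma : ℂ)
  let n : ℂ := herm q q
  let n1 : ℂ := herm q1 q + herm q q1
  let Q := blockQ q
  let Qx := blockQ q1
  let Qxx := blockQ q2
  let Qxxx := blockQ q3
  let Qxxxx := blockQ q4
  (2 * κ) • (s • (Qxx * Q - Q * Qxx) - ((2 * s * n1) • Q + (2 * s * n) • Qx) - s • Qxxx - Qx)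
    + (4 * I * κ ^ 2) • (s • (J * (Qxx - (Qx * Q + Q * Qx))))
    + (8 * s * κ ^ 3) • Qx
    + (3 * I * s) • (J * ((Qxx * (Q * Q) + Qx * (Qx * Q + Q * Qx)) +
        ((Qx * Q + Q * Qx) * Qx + Q * Q * Qxx)))
    + (I * s) • (J * ((Qxxx * Q + Qxx * Qx) + (Qx * Qxx + Q * Qxxx) - Qxxxx -
        (Qxx * Qx + Qx * Qxx)))
    + ((I * (3 * s * n1)) • (J * (Q * Q)) + (I * (1 + 3 * s * n)) • (J * (Qx * Q + Q * Qx)))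
    - I • (J * Qxx)

theorem E_eq_timeMatrix (z : ℂ) (x t : ℝ) :
    D.E z x t = D.timeMatrix z (D.jet 0 x t) (D.jet 1 x t) (D.jet 2 x t) (D.jet 3 x t) := by
  have h0 : D.jet 0 x t = D.q x t := rfl
  simp only [E, timeMatrix, h0, Complex.ofReal_pow, ofReal_norm_sq]

theorem hasEntryDerivAt_timeMatrix (z : ℂ) {q q1 q2 q3 : ℝ → Vec2} {q4 : Vec2} {x : ℝ}
    (h0 : HasDerivAt q (q1 x) x) (h1 : HasDerivAt q1 (q2 x) x) (h2 : HasDerivAt q2 (q3 x) x)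
    (h3 : HasDerivAt q3 q4 x) :
    HasEntryDerivAt (fun y => D.timeMatrix z (q y) (q1 y) (q2 y) (q3 y))
      (D.timeMatrixDeriv z (q x) (q1 x) (q2 x) (q3 x) q4) x := by
  have hn := hasDerivAt_herm h0 h0
  have H0 := hasEntryDerivAt_blockQ h0
  have H1 := hasEntryDerivAt_blockQ h1
  have H2 := hasEntryDerivAt_blockQ h2
  have H3 := hasEntryDerivAt_blockQ h3
  have HJ : ∀ {F : ℝ → Matrix (Fin 3) (Fin 3) ℂ} {F' : Matrix (Fin 3) (Fin 3) ℂ},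
      HasEntryDerivAt F F' x → HasEntryDerivAt (fun y => J * F y) (J * F') x := fun hF => by
    simpa using (HasEntryDerivAt.const J).mul hF
  have key := (((((((((((H1.mul H0).sub (H0.mul H1)).const_smul (D.sigma : ℂ)).sub
    (HasEntryDerivAt.smul (hn.const_mul (2 * (D.sigma : ℂ))) H0)).sub
    (H2.const_smul (D.sigma : ℂ))).sub H0).const_smul (2 * D.k z)).add
    (.const ((I * (D.amp : ℂ) ^ 2) • J))).add
    (.const ((3 * I * D.sigma * (D.amp : ℂ) ^ 4) • J))).add
    (((HasEntryDerivAt.const J₁).add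
      ((HJ (H1.sub (H0.mul H0))).const_smul (D.sigma : ℂ))).const_smul (4 * I * D.k z ^ 2))).add
    (H0.const_smul (8 * D.sigma * D.k z ^ 3))).sub (.const ((8 * I * D.sigma * D.k z ^ 4) • J))
  have key2 := (((key.add
    ((HJ ((H1.mul (H0.mul H0)).add ((H0.mul H0).mul H1))).const_smul (3 * I * D.sigma))).add
    ((HJ ((((H2.mul H0).add (H0.mul H2)).sub H3).sub (H1.mul H1))).const_smul (I * D.sigma))).add
    (HasEntryDerivAt.smul (((hn.const_mul (3 * (D.sigma : ℂ))).const_add 1).const_mul I)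
      (HJ (H0.mul H0)))).sub ((HJ H1).const_smul I)
  intro i j
  refine (key2 i j).congr_deriv (congrFun (congrFun (?_ : _ = D.timeMatrixDeriv z _ _ _ _ _) i) j)
  simp only [timeMatrixDeriv, add_zero, zero_add, sub_zero]
  -- The product rule reproduces the stated form except in the commutator term, where two copies of
  -- `Qx * Qx` cancel.
  congr 6
  congr 5
  abel

theorem continuous_timeMatrix (z : ℂ) : Continuous fun p : Vec2 × Vec2 × Vec2 × Vec2 =>
    D.timeMatrix z p.1 p.2.1 p.2.2.1 p.2.2.2 := by
  have h0 : Continuous fun p : Vec2 × Vec2 × Vec2 × Vec2 => blockQ p.1 :=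
    continuous_blockQ.comp continuous_fst
  have h1 : Continuous fun p : Vec2 × Vec2 × Vec2 × Vec2 => blockQ p.2.1 :=
    continuous_blockQ.comp (by fun_prop)
  have h2 : Continuous fun p : Vec2 × Vec2 × Vec2 × Vec2 => blockQ p.2.2.1 :=
    continuous_blockQ.comp (by fun_prop)
  have h3 : Continuous fun p : Vec2 × Vec2 × Vec2 × Vec2 => blockQ p.2.2.2 :=
    continuous_blockQ.comp (by fun_prop)
  have hn : Continuous fun p : Vec2 × Vec2 × Vec2 × Vec2 => herm p.1 p.1 :=
    continuous_herm.comp (continuous_fst.prodMk continuous_fst)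
  simp only [timeMatrix]
  fun_prop

theorem continuous_timeMatrixDeriv (z : ℂ) :
    Continuous fun p : Vec2 × Vec2 × Vec2 × Vec2 × Vec2 =>
      D.timeMatrixDeriv z p.1 p.2.1 p.2.2.1 p.2.2.2.1 p.2.2.2.2 := by
  have h0 : Continuous fun p : Vec2 × Vec2 × Vec2 × Vec2 × Vec2 => blockQ p.1 :=
    continuous_blockQ.comp continuous_fst
  have h1 : Continuous fun p : Vec2 × Vec2 × Vec2 × Vec2 × Vec2 => blockQ p.2.1 :=
    continuous_blockQ.comp (by fun_prop)
  have h2 : Continuous fun p : Vec2 × Vec2 × Vec2 × Vec2 × Vec2 => blockQ p.2.2.1 :=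
    continuous_blockQ.comp (by fun_prop)
  have h3 : Continuous fun p : Vec2 × Vec2 × Vec2 × Vec2 × Vec2 => blockQ p.2.2.2.1 :=
    continuous_blockQ.comp (by fun_prop)
  have h4 : Continuous fun p : Vec2 × Vec2 × Vec2 × Vec2 × Vec2 => blockQ p.2.2.2.2 :=
    continuous_blockQ.comp (by fun_prop)
  have hn : Continuous fun p : Vec2 × Vec2 × Vec2 × Vec2 × Vec2 => herm p.1 p.1 :=
    continuous_herm.comp (continuous_fst.prodMk continuous_fst)
  have hn1 : Continuous fun p : Vec2 × Vec2 × Vec2 × Vec2 × Vec2 =>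
      herm p.2.1 p.1 + herm p.1 p.2.1 :=
    (continuous_herm.comp ((continuous_fst.comp continuous_snd).prodMk continuous_fst)).add
      (continuous_herm.comp (continuous_fst.prodMk (continuous_fst.comp continuous_snd)))
  simp only [timeMatrixDeriv]
  fun_prop

/-- The right-hand side of the evolution equation solved for `i q_t`. -/
noncomputable def flow (q q1 q2 q4 : Vec2) (i : Fin 2) : ℂ :=
  q2 i + 2 * (herm q q - (D.amp : ℂ) ^ 2) * q i + D.sigma * (q4 i + 2 * herm q1 q1 * q i
    + 2 * herm q1 q * q1 i + 6 * herm q q1 * q1 i + 4 * herm q q * q2 i + 4 * herm q q2 * q i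
    + 2 * herm q2 q * q i + 6 * (herm q q ^ 2 - (D.amp : ℂ) ^ 4) * q i)

theorem J_eq : J = !![1, 0, 0; 0, -1, 0; 0, 0, -1] := by
  ext i j
  fin_cases i <;> fin_cases j <;> simp [J]

theorem J₁_eq : J₁ = !![1, 0, 0; 0, 0, 0; 0, 0, 0] := by
  ext i j
  fin_cases i <;> fin_cases j <;> simp [J₁]

set_option maxHeartbeats 2000000 in
/-- The zero curvature condition of the Lax pair. -/
theorem zero_curvature (z : ℂ) (q q1 q2 q3 q4 qt : Vec2)
    (h : ∀ i, qt i = I * D.flow q q1 q2 q4 i) :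
    D.timeMatrixDeriv z q q1 q2 q3 q4 = blockQ qt +
      ((-I * D.k z) • J + blockQ q) * D.timeMatrix z q q1 q2 q3 -
      D.timeMatrix z q q1 q2 q3 * ((-I * D.k z) • J + blockQ q) := by
  have h' : ∀ i, (starRingEnd ℂ) (qt i) = -I * (starRingEnd ℂ) (D.flow q q1 q2 q4 i) := by
    intro i
    rw [h, map_mul, Complex.conj_I]
  simp only [flow, herm, map_add, map_sub, map_mul, map_pow, map_ofNat, Complex.conj_conj,
    Complex.conj_ofReal] at h h'
  have c2 : (starRingEnd ℂ) (2 : ℂ) = 2 := map_ofNat (starRingEnd ℂ) 2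
  have c4 : (starRingEnd ℂ) (4 : ℂ) = 4 := map_ofNat (starRingEnd ℂ) 4
  have c6 : (starRingEnd ℂ) (6 : ℂ) = 6 := map_ofNat (starRingEnd ℂ) 6
  simp only [timeMatrix, timeMatrixDeriv, herm, blockQ, h, J_eq, J₁_eq, Matrix.mul_fin_three]
  simp
  -- Once `q_t` is eliminated by the evolution equation, the nine entries are polynomial identities
  -- in `k`, `σ`, `q₀`, the jet components and their conjugates.
  refine ⟨⟨?_, ?_, ?_⟩, ⟨?_, ?_, ?_⟩, ⟨?_, ?_, ?_⟩⟩ <;> ring_nf <;>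
    simp only [I_sq, c2, c4, c6] <;> ring_nf

end Data

end CoupledLPD

/-! ### Asymptotic matrices, their common eigenvectors and the phases. -/

namespace CoupledLPD

namespace Data

variable (D : Data)

theorem norm_qInf (s : Side) : ‖D.qInf s‖ = D.amp := by
  rw [qInf, norm_smul, mul_comm I, Complex.norm_exp_ofReal_mul_I, one_mul, amp]

theorem herm_qInf (s : Side) : herm (D.qInf s) (D.qInf s) = (D.amp : ℂ) ^ 2 := by
  rw [← ofReal_norm_sq, norm_qInf]

/-- The coefficients of `x` in the phases. -/
noncomputable def phaseX (z : ℂ) : Fin 3 → ℂ := ![-D.lam z, D.k z, D.lam z]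

/-- The coefficients of `t` in the phases. -/
noncomputable def phaseT (z : ℂ) : Fin 3 → ℂ :=
  ![2 * (D.k z ^ 2 + D.k z * D.lam z - 4 * D.k z ^ 3 * D.lam z * D.sigma
      + 2 * D.k z * D.lam z * D.sigma * (D.amp : ℂ) ^ 2),
    8 * D.k z ^ 4 * D.sigma - 3 * D.sigma * (D.amp : ℂ) ^ 4 - (D.amp : ℂ) ^ 2,
    2 * (D.k z ^ 2 - D.k z * D.lam z + 4 * D.k z ^ 3 * D.lam z * D.sigma
      - 2 * D.k z * D.lam z * D.sigma * (D.amp : ℂ) ^ 2)]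

theorem phase_eq (j : Fin 3) (z : ℂ) (x t : ℝ) :
    D.phase j z x t = D.phaseX z j * x + D.phaseT z j * t := by
  fin_cases j <;> simp [phase, phaseX, phaseT]

/-- The limit of `A` at an end of the line. -/
noncomputable def limA (s : Side) (z : ℂ) : Matrix (Fin 3) (Fin 3) ℂ :=
  (-I * D.k z) • J + blockQ (D.qInf s)

/-- The limit of `E` at an end of the line. -/
noncomputable def limE (s : Side) (z : ℂ) : Matrix (Fin 3) (Fin 3) ℂ :=
  D.timeMatrix z (D.qInf s) 0 0 0

/-- The vector `(α, β v)`. -/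
def blockVec (v : Vec2) (α β : ℂ) : Fin 3 → ℂ := ![α, β * v 0, β * v 1]

/-- The vector `(0, β v^⊥)`. -/
def blockPerp (v : Vec2) (β : ℂ) : Fin 3 → ℂ :=
  ![0, β * (starRingEnd ℂ) (v 1), -(β * (starRingEnd ℂ) (v 0))]

/-! ### Action of `Q`, `J`, `J₁` on the invariant subspaces of vectors `(α, βv)` and `(0, βv^⊥)`. -/

section Blocks

variable (v : Vec2) (α β α' β' c : ℂ)

theorem blockVec_add : blockVec v α β + blockVec v α' β' = blockVec v (α + α') (β + β') := by
  ext i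
  fin_cases i <;> simp [blockVec, add_mul]

theorem smul_blockVec : c • blockVec v α β = blockVec v (c * α) (c * β) := by
  ext i
  fin_cases i <;> simp [blockVec, mul_assoc]

theorem blockPerp_add : blockPerp v β + blockPerp v β' = blockPerp v (β + β') := by
  ext i
  fin_cases i <;> simp [blockPerp, add_mul, add_comm]

theorem smul_blockPerp : c • blockPerp v β = blockPerp v (c * β) := by
  ext i
  fin_cases i <;> simp [blockPerp, mul_assoc]

theorem blockQ_mulVec_blockVec :
    blockQ v *ᵥ blockVec v α β = blockVec v (β * herm v v) (-α) := by
  ext i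
  fin_cases i <;> simp [blockVec, blockQ, herm, Matrix.mulVec, dotProduct, Fin.sum_univ_three]
    <;> ring

theorem J_mulVec_blockVec : J *ᵥ blockVec v α β = blockVec v α (-β) := by
  ext i
  fin_cases i <;> simp [blockVec, J_eq, Matrix.mulVec, dotProduct, Fin.sum_univ_three]

theorem J₁_mulVec_blockVec : J₁ *ᵥ blockVec v α β = blockVec v α 0 := by
  ext i
  fin_cases i <;> simp [blockVec, J₁_eq, Matrix.mulVec, dotProduct, Fin.sum_univ_three]

theorem blockQ_mulVec_blockPerp : blockQ v *ᵥ blockPerp v β = blockPerp v 0 := by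
  ext i
  fin_cases i <;> simp [blockPerp, blockQ, Matrix.mulVec, dotProduct, Fin.sum_univ_three]
  ring

theorem J_mulVec_blockPerp : J *ᵥ blockPerp v β = blockPerp v (-β) := by
  ext i
  fin_cases i <;> simp [blockPerp, J_eq, Matrix.mulVec, dotProduct, Fin.sum_univ_three]

theorem J₁_mulVec_blockPerp : J₁ *ᵥ blockPerp v β = blockPerp v 0 := by
  ext i
  fin_cases i <;> simp [blockPerp, J₁_eq, Matrix.mulVec, dotProduct, Fin.sum_univ_three]

end Blocks

theorem Y_col_zero (s : Side) (z : ℂ) : (D.Y s z).col 0 = blockVec (D.qInf s) 1 (-I / z) := by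
  ext i
  fin_cases i <;> simp [Y, blockVec]

theorem Y_col_one (s : Side) (z : ℂ) :
    (D.Y s z).col 1 = blockPerp (D.qInf s) (1 / (D.amp : ℂ)) := by
  ext i
  fin_cases i <;> simp [Y, blockPerp] <;> ring

theorem Y_col_two (s : Side) (z : ℂ) :
    (D.Y s z).col 2 = blockVec (D.qInf s) (-I * D.amp / z) (1 / (D.amp : ℂ)) := by
  ext i
  fin_cases i <;> simp [Y, blockVec] <;> ring

theorem limA_mulVec_col (s : Side) {z : ℂ} (hz : z ≠ 0) (ha : (D.amp : ℂ) ≠ 0) (j : Fin 3) :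
    D.limA s z *ᵥ (D.Y s z).col j = (I * D.phaseX z j) • (D.Y s z).col j := by
  have hI := Complex.I_sq
  fin_cases j
  · simp only [Fin.zero_eta, Y_col_zero, limA, Matrix.add_mulVec, Matrix.smul_mulVec,
      J_mulVec_blockVec, blockQ_mulVec_blockVec, herm_qInf, smul_blockVec, blockVec_add]
    congr 1 <;> simp [phaseX, k, lam] <;> field_simp <;> ring_nf <;> simp only [hI] <;> ring
  · simp only [Fin.mk_one, Y_col_one, limA, Matrix.add_mulVec, Matrix.smul_mulVec,
      J_mulVec_blockPerp, blockQ_mulVec_blockPerp, smul_blockPerp, blockPerp_add]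
    congr 1
    simp [phaseX]
  · simp only [Fin.reduceFinMk, Y_col_two, limA, Matrix.add_mulVec, Matrix.smul_mulVec,
      J_mulVec_blockVec, blockQ_mulVec_blockVec, herm_qInf, smul_blockVec, blockVec_add]
    congr 1 <;> simp [phaseX, k, lam] <;> field_simp <;> ring_nf <;> simp only [hI] <;> ring

theorem limA_mul_Y (s : Side) {z : ℂ} (hz : z ≠ 0) (ha : (D.amp : ℂ) ≠ 0) :
    D.limA s z * D.Y s z = D.Y s z * diagonal fun j => I * D.phaseX z j := by
  ext i j
  have := congrFun (D.limA_mulVec_col s hz ha j) i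
  rw [Matrix.mul_diagonal, mul_comm]
  exact this

/-- The limits of `A` and `E` share the eigenvectors `Y_j`; this is what allows a single phase
`δ_j`, linear in both variables, to normalize a joint solution. -/
theorem limE_mulVec_col (s : Side) {z : ℂ} (hz : z ≠ 0) (ha : (D.amp : ℂ) ≠ 0) (j : Fin 3) :
    D.limE s z *ᵥ (D.Y s z).col j = (I * D.phaseT z j) • (D.Y s z).col j := by
  have hI := Complex.I_sq
  have h0 : blockQ 0 = 0 := by
    ext i j
    fin_cases i <;> fin_cases j <;> simp [blockQ]
  -- All derivatives of `q` vanish at infinity, leaving a combination of `Q`, `J`, `J₁` and `JQ²`,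
  -- each of which acts within the blocks.
  have hE : D.limE s z = (2 * D.k z * (-2 * D.sigma * (D.amp : ℂ) ^ 2 - 1)
        + 8 * D.sigma * D.k z ^ 3) • blockQ (D.qInf s)
      + (I * (D.amp : ℂ) ^ 2 + 3 * I * D.sigma * (D.amp : ℂ) ^ 4
        - 8 * I * D.sigma * D.k z ^ 4) • J
      + (4 * I * D.k z ^ 2) • J₁
      + (I * (1 + 3 * D.sigma * (D.amp : ℂ) ^ 2) - 4 * I * D.k z ^ 2 * D.sigma) •
        (J * (blockQ (D.qInf s) * blockQ (D.qInf s))) := by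
    simp only [limE, timeMatrix, h0, herm_qInf, zero_mul, mul_zero, sub_zero, zero_sub, add_zero,
      smul_zero, Matrix.mul_neg]
    module
  fin_cases j
  · simp only [Fin.zero_eta, Y_col_zero, hE, Matrix.add_mulVec, Matrix.smul_mulVec,
      ← Matrix.mulVec_mulVec, J_mulVec_blockVec, J₁_mulVec_blockVec, blockQ_mulVec_blockVec,
      herm_qInf, smul_blockVec, blockVec_add]
    congr 1 <;> simp [phaseT, k, lam] <;> field_simp <;> ring_nf <;> simp only [hI] <;> ring
  · simp only [Fin.mk_one, Y_col_one, hE, Matrix.add_mulVec, Matrix.smul_mulVec,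
      ← Matrix.mulVec_mulVec, J_mulVec_blockPerp, J₁_mulVec_blockPerp, blockQ_mulVec_blockPerp,
      smul_blockPerp, blockPerp_add]
    congr 1
    simp [phaseT]
    ring
  · simp only [Fin.reduceFinMk, Y_col_two, hE, Matrix.add_mulVec, Matrix.smul_mulVec,
      ← Matrix.mulVec_mulVec, J_mulVec_blockVec, J₁_mulVec_blockVec, blockQ_mulVec_blockVec,
      herm_qInf, smul_blockVec, blockVec_add]
    congr 1 <;> simp [phaseT, k, lam] <;> field_simp <;> ring_nf <;> simp only [hI] <;> ring

/-- `γ = 1 + q₀² / z²`. -/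
noncomputable def gam (z : ℂ) : ℂ := 1 + (D.amp : ℂ) ^ 2 / z ^ 2

/-- This biorthogonality identifies the rows of `Y⁻¹` with rescaled columns of `Ỹ`. It yields both
the orthogonality relations and the pairing formula for the scattering coefficients. -/
theorem adjY_transpose_mul (s : Side) {z : ℂ} (hz : z ≠ 0) (ha : (D.amp : ℂ) ≠ 0) :
    (D.adjY s z)ᵀ * D.Y s z = diagonal ![D.gam z, 1, D.gam z] := by
  have hv := D.herm_qInf s
  have hI := Complex.I_sq
  rw [herm] at hv
  ext i j
  fin_cases i <;> fin_cases j <;>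
    simp [adjY, Y, gam, Matrix.mul_apply, Fin.sum_univ_three, -mul_eq_zero] <;> field_simp
  · linear_combination hv - ((starRingEnd ℂ) (D.qInf s 0) * D.qInf s 0 +
      (starRingEnd ℂ) (D.qInf s 1) * D.qInf s 1) * hI
  · ring
  · linear_combination I * hv
  · ring
  · linear_combination hv
  · ring
  · linear_combination -I * hv
  · ring
  · linear_combination z ^ 2 * hv - (D.amp : ℂ) ^ 4 * hI

/-- The inverse of `Y`. -/
noncomputable def YInv (s : Side) (z : ℂ) : Matrix (Fin 3) (Fin 3) ℂ :=
  diagonal ![(D.gam z)⁻¹, 1, (D.gam z)⁻¹] * (D.adjY s z)ᵀ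

theorem YInv_mul_Y (s : Side) {z : ℂ} (hz : z ≠ 0) (ha : (D.amp : ℂ) ≠ 0) (hg : D.gam z ≠ 0) :
    D.YInv s z * D.Y s z = 1 := by
  rw [YInv, Matrix.mul_assoc, D.adjY_transpose_mul s hz ha, Matrix.diagonal_mul_diagonal,
    ← Matrix.diagonal_one]
  congr 1
  ext i
  fin_cases i <;> simp [hg]

end Data

end CoupledLPD

/-! ### Jost solutions of the Lax pair and their symmetries. -/

namespace CoupledLPD

theorem IsJost.smul {A E : ℝ → ℝ → Matrix (Fin 3) (Fin 3) ℂ} {φ : ℝ → ℝ → ℂ} {y : Fin 3 → ℂ}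
    {l : Filter ℝ} {ψ : ℝ → ℝ → Fin 3 → ℂ} (h : IsJost A E φ y l ψ) (c : ℂ) :
    IsJost A E φ (c • y) l (fun x t => c • ψ x t) := by
  refine ⟨fun x t => ?_, fun x t => ?_, fun t => ?_⟩
  · exact ((h.1 x t).fun_const_smul c).congr_deriv (by rw [Matrix.mulVec_smul])
  · exact ((h.2.1 x t).fun_const_smul c).congr_deriv (by rw [Matrix.mulVec_smul])
  · exact ((h.2.2 t).const_smul c).congr fun x => smul_comm _ _ _

theorem map_conj_mulVec (M : Matrix (Fin 3) (Fin 3) ℂ) (v : Fin 3 → ℂ) :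
    M.map (starRingEnd ℂ) *ᵥ star v = star (M *ᵥ v) := by
  ext i
  simp [Matrix.mulVec, dotProduct]

theorem IsJost.conj {A E : ℝ → ℝ → Matrix (Fin 3) (Fin 3) ℂ} {φ : ℝ → ℝ → ℂ} {y : Fin 3 → ℂ}
    {l : Filter ℝ} {ψ : ℝ → ℝ → Fin 3 → ℂ} (h : IsJost A E φ y l ψ) :
    IsJost (fun x t => (A x t).map (starRingEnd ℂ)) (fun x t => (E x t).map (starRingEnd ℂ))
      (fun x t => -(starRingEnd ℂ) (φ x t)) (star y) l (fun x t => star (ψ x t)) := by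
  refine ⟨fun x t => ?_, fun x t => ?_, fun t => ?_⟩
  · rw [map_conj_mulVec]
    exact (h.1 x t).star
  · rw [map_conj_mulVec]
    exact (h.2.1 x t).star
  · refine ((continuous_star.tendsto _).comp (h.2.2 t)).congr fun x => ?_
    simp only [Function.comp_apply, star_smul]
    congr 1
    rw [Complex.star_def, ← Complex.exp_conj]
    simp

namespace Data

variable {D : Data}

theorem IsSolution.amp_ne_zero (hD : D.IsSolution) : (D.amp : ℂ) ≠ 0 := by
  rw [Complex.ofReal_ne_zero, amp]
  exact norm_ne_zero_iff.2 hD.q₀_ne_zero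

theorem IsSolution.hasDerivAt_jet (hD : D.IsSolution) {j : ℕ} (hj : j < 4) (x t : ℝ) :
    HasDerivAt (fun y => D.jet j y t) (D.jet (j + 1) x t) x := by
  have h1 : DifferentiableAt ℝ (iteratedDeriv j fun y => D.q y t) x :=
    (hD.contDiff_x t).differentiable_iteratedDeriv j (by exact_mod_cast hj) x
  have h2 := h1.hasDerivAt
  rwa [← iteratedDeriv_succ] at h2

theorem IsSolution.deriv_t_apply (hD : D.IsSolution) (x t : ℝ) (i : Fin 2) :
    (deriv (fun τ => D.q x τ) t) i =
      I * D.flow (D.jet 0 x t) (D.jet 1 x t) (D.jet 2 x t) (D.jet 4 x t) i := by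
  have h0 : D.jet 0 x t = D.q x t := rfl
  have h := congrArg (fun v : Vec2 => v i) (hD.equation x t)
  simp only [lpd, inner_eq_herm, Complex.ofReal_mul, Complex.ofReal_sub, Complex.ofReal_pow,
    Complex.ofReal_ofNat, PiLp.add_apply, PiLp.smul_apply, PiLp.zero_apply, smul_eq_mul] at h
  have h4 : ((‖D.q x t‖ : ℝ) : ℂ) ^ 4 = (((‖D.q x t‖ : ℝ) : ℂ) ^ 2) ^ 2 := by ring
  rw [h4] at h
  simp only [ofReal_norm_sq] at h
  rw [h0, flow]
  linear_combination -I * h + (deriv (fun τ => D.q x τ) t) i * Complex.I_sq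

theorem IsSolution.hasEntryDerivAt_A (hD : D.IsSolution) (z : ℂ) (x t : ℝ) :
    HasEntryDerivAt (fun τ => D.A z x τ) (blockQ (deriv (fun τ => D.q x τ) t)) t := by
  have := (HasEntryDerivAt.const (x := t) ((-I * D.k z) • J)).add
    (hasEntryDerivAt_blockQ (hD.differentiable_t x t).hasDerivAt)
  rwa [zero_add] at this

theorem IsSolution.continuous_A (hD : D.IsSolution) (z : ℂ) (t : ℝ) :
    Continuous fun x => D.A z x t :=
  continuous_const.add (continuous_blockQ.comp (hD.contDiff_x t).continuous)

theorem IsSolution.continuous_E (hD : D.IsSolution) (z : ℂ) :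
    Continuous fun p : ℝ × ℝ => D.E z p.1 p.2 := by
  simp only [E_eq_timeMatrix]
  have h : Continuous fun p : ℝ × ℝ =>
      (D.jet 0 p.1 p.2, D.jet 1 p.1 p.2, D.jet 2 p.1 p.2, D.jet 3 p.1 p.2) :=
    (hD.continuous_jet 0 (by norm_num)).prodMk
      ((hD.continuous_jet 1 (by norm_num)).prodMk ((hD.continuous_jet 2 (by norm_num)).prodMk
        (hD.continuous_jet 3 (by norm_num))))
  simpa only [Function.comp_def] using (D.continuous_timeMatrix z).comp h

theorem IsSolution.continuous_timeMatrixDeriv_jet (hD : D.IsSolution) (z : ℂ) :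
    Continuous fun p : ℝ × ℝ => D.timeMatrixDeriv z (D.jet 0 p.1 p.2) (D.jet 1 p.1 p.2)
      (D.jet 2 p.1 p.2) (D.jet 3 p.1 p.2) (D.jet 4 p.1 p.2) := by
  have h : Continuous fun p : ℝ × ℝ => (D.jet 0 p.1 p.2, D.jet 1 p.1 p.2, D.jet 2 p.1 p.2,
      D.jet 3 p.1 p.2, D.jet 4 p.1 p.2) :=
    (hD.continuous_jet 0 (by norm_num)).prodMk
      ((hD.continuous_jet 1 (by norm_num)).prodMk ((hD.continuous_jet 2 (by norm_num)).prodMk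
        ((hD.continuous_jet 3 (by norm_num)).prodMk (hD.continuous_jet 4 le_rfl))))
  simpa only [Function.comp_def] using (D.continuous_timeMatrixDeriv z).comp h

/-- For `|t| ≤ T` the jet stays in a closed ball, compact in finite dimension, on which the
continuous temporal matrix is bounded. -/
theorem IsSolution.exists_bound_E (hD : D.IsSolution) (z : ℂ) (T : ℝ) :
    ∃ K, ∀ x t, |t| ≤ T → entrySum (D.E z x t) ≤ K := by
  obtain ⟨C, hC⟩ := hD.locally_bounded T
  have hb := isCompact_closedBall (0 : Vec2) C
  obtain ⟨K, hK⟩ := (hb.prod (hb.prod (hb.prod hb))).exists_bound_of_continuousOn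
    (continuous_entrySum.comp (D.continuous_timeMatrix z)).continuousOn
  refine ⟨K, fun x t ht => ?_⟩
  have hj : ∀ j ≤ 3, D.jet j x t ∈ Metric.closedBall (0 : Vec2) C := fun j hj => by
    simpa using hC x t ht j hj
  have h := (le_abs_self _).trans (hK (D.jet 0 x t, D.jet 1 x t, D.jet 2 x t, D.jet 3 x t)
    ⟨hj 0 (by norm_num), hj 1 (by norm_num), hj 2 (by norm_num), hj 3 le_rfl⟩)
  simpa only [Function.comp_def, E_eq_timeMatrix] using h

theorem IsSolution.tendsto_E (hD : D.IsSolution) (z : ℂ) (s : Side) (t : ℝ) :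
    Tendsto (fun x => D.E z x t) s.filter (𝓝 (D.limE s z)) := by
  simp only [E_eq_timeMatrix]
  have h : Tendsto (fun x => (D.jet 0 x t, D.jet 1 x t, D.jet 2 x t, D.jet 3 x t)) s.filter
      (𝓝 (D.qInf s, 0, 0, 0)) :=
    ((hD.boundary s t).prodMk_nhds ((hD.boundary_deriv 1 le_rfl (by norm_num) s t).prodMk_nhds
      ((hD.boundary_deriv 2 (by norm_num) (by norm_num) s t).prodMk_nhds
        (hD.boundary_deriv 3 (by norm_num) le_rfl s t))))
  simpa only [Function.comp_def, limE] using
    ((D.continuous_timeMatrix z).tendsto (D.qInf s, 0, 0, 0)).comp h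

/-- The condition on `z` under which the Jost solution `ψ_{s,j}` is determined by its
asymptotics. -/
structure Admissible (D : Data) (s : Side) (j : Fin 3) (z : ℂ) : Prop where
  ne_zero : z ≠ 0
  gam_ne_zero : D.gam z ≠ 0
  dominant : ∀ i, s.sgn * (I * D.phaseX z j).re ≤ s.sgn * (I * D.phaseX z i).re

theorem IsSolution.integrable (hD : D.IsSolution) (s : Side) (t a : ℝ) :
    IntegrableOn (fun x => D.q x t - D.qInf s) (s.halfLine a) := by
  cases s
  · exact hD.integrable_minus t a
  · exact hD.integrable_plus t a

theorem entrySum_blockQ_le (v : Vec2) : entrySum (blockQ v) ≤ 4 * ‖v‖ := by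
  have h : ∀ i, ‖v i‖ ≤ ‖v‖ := fun i => PiLp.norm_apply_le v i
  simp [entrySum, blockQ, Fin.sum_univ_three]
  linarith [h 0, h 1]

theorem blockQ_sub (v w : Vec2) : blockQ (v - w) = blockQ v - blockQ w := by
  ext i j
  fin_cases i <;> fin_cases j <;> simp [blockQ]
  · ring
  · ring

theorem IsSolution.isPerturbation (hD : D.IsSolution) (s : Side) {z : ℂ} (hz : z ≠ 0)
    (hg : D.gam z ≠ 0) (t : ℝ) :
    IsPerturbation s (fun x => D.A z x t) (D.limA s z) (D.Y s z) (D.YInv s z)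
      (fun j => I * D.phaseX z j) where
  continuous := hD.continuous_A z t
  integrable a := by
    refine ((hD.integrable s t a).norm.const_mul 4).mono' ?_ (Eventually.of_forall fun x => ?_)
    · exact (continuous_entrySum.comp
        ((hD.continuous_A z t).sub continuous_const)).aestronglyMeasurable
    · have : D.A z x t - D.limA s z = blockQ (D.q x t - D.qInf s) := by
        rw [blockQ_sub, A, limA, add_sub_add_left_eq_sub]
      rw [this, Real.norm_of_nonneg (entrySum_nonneg _)]
      exact entrySum_blockQ_le _
  mul_inv := mul_eq_one_comm.1 (D.YInv_mul_Y s hz hD.amp_ne_zero hg)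
  inv_mul := D.YInv_mul_Y s hz hD.amp_ne_zero hg
  eigen := D.limA_mul_Y s hz hD.amp_ne_zero

/-- The Jost functions are chosen by `Classical.epsilon`, so existence is what gives them their
defining properties. -/
theorem IsSolution.exists_isJost (hD : D.IsSolution) {s : Side} {j : Fin 3} {z : ℂ}
    (h : D.Admissible s j z) :
    ∃ ψ, IsJost (D.A z) (D.E z) (D.phase j z) (fun i => D.Y s z i j) s.filter ψ := by
  have hcd := hD.continuous_timeMatrixDeriv_jet z
  refine CoupledLPD.exists_isJost (hD.continuous_E z)
    (Ex := fun x t => D.timeMatrixDeriv z (D.jet 0 x t) (D.jet 1 x t)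
      (D.jet 2 x t) (D.jet 3 x t) (D.jet 4 x t)) hcd (fun x t => ?_)
    (fun x t => hD.hasEntryDerivAt_A z x t) (fun x t => ?_)
    (hD.isPerturbation s h.ne_zero h.gam_ne_zero 0) h.dominant
    (D.limE_mulVec_col s h.ne_zero hD.amp_ne_zero j) (hD.tendsto_E z s) (hD.exists_bound_E z)
    (fun x t => by rw [phase_eq]; ring)
  · have := D.hasEntryDerivAt_timeMatrix z (hD.hasDerivAt_jet (j := 0) (by norm_num) x t)
      (hD.hasDerivAt_jet (j := 1) (by norm_num) x t) (hD.hasDerivAt_jet (j := 2) (by norm_num) x t)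
      (hD.hasDerivAt_jet (j := 3) (by norm_num) x t)
    simp only [E_eq_timeMatrix]
    exact this
  · rw [E_eq_timeMatrix]
    exact D.zero_curvature z _ _ _ _ _ _ (hD.deriv_t_apply x t)

theorem exp_phase (D : Data) (j : Fin 3) (z : ℂ) (x t : ℝ) :
    Complex.exp (-I * D.phase j z x t) =
      Complex.exp (-I * D.phaseT z j * t) * Complex.exp (-(I * D.phaseX z j) * x) := by
  rw [← Complex.exp_add, phase_eq]
  ring_nf

/-- For fixed `t` the temporal factor of `e^{-iδ_j}` does not depend on `x` and can be removed;
uniqueness for the spatial equation then applies at each time. -/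
theorem IsSolution.isJost_unique (hD : D.IsSolution) {s : Side} {j : Fin 3} {z : ℂ}
    (h : D.Admissible s j z) {y : Fin 3 → ℂ} {ψ ψ' : ℝ → ℝ → Fin 3 → ℂ}
    (hψ : IsJost (D.A z) (D.E z) (D.phase j z) y s.filter ψ)
    (hψ' : IsJost (D.A z) (D.E z) (D.phase j z) y s.filter ψ') : ψ = ψ' := by
  funext x t
  refine sub_eq_zero.1 ((hD.isPerturbation s h.ne_zero h.gam_ne_zero t).eq_zero (j := j)
    h.dominant (ψ := fun x => ψ x t - ψ' x t) (fun x => ?_) ?_ x)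
  · exact ((hψ.1 x t).fun_sub (hψ'.1 x t)).congr_deriv (by rw [Matrix.mulVec_sub])
  · have h1 := ((hψ.2.2 t).sub (hψ'.2.2 t)).const_smul (Complex.exp (I * D.phaseT z j * t))
    rw [sub_self, smul_zero] at h1
    refine h1.congr fun x => ?_
    rw [exp_phase, ← smul_sub, smul_smul, ← mul_assoc, ← Complex.exp_add]
    simp

theorem IsSolution.isJost_psi (hD : D.IsSolution) {s : Side} {j : Fin 3} {z : ℂ}
    (h : D.Admissible s j z) :
    IsJost (D.A z) (D.E z) (D.phase j z) (fun i => D.Y s z i j) s.filter (D.psi s j z) :=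
  Classical.epsilon_spec (hD.exists_isJost h)

/-! Complex conjugation. -/

theorem conj_k (D : Data) (z : ℂ) : (starRingEnd ℂ) (D.k z) = D.k ((starRingEnd ℂ) z) := by
  simp [k, map_ofNat (starRingEnd ℂ) 2]

theorem conj_lam (D : Data) (z : ℂ) : (starRingEnd ℂ) (D.lam z) = D.lam ((starRingEnd ℂ) z) := by
  simp [lam, map_ofNat (starRingEnd ℂ) 2]

theorem conj_phase (D : Data) (j : Fin 3) (z : ℂ) (x t : ℝ) :
    (starRingEnd ℂ) (D.phase j z x t) = D.phase j ((starRingEnd ℂ) z) x t := by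
  have h2 : (starRingEnd ℂ) (2 : ℂ) = 2 := map_ofNat (starRingEnd ℂ) 2
  have h3 : (starRingEnd ℂ) (3 : ℂ) = 3 := map_ofNat (starRingEnd ℂ) 3
  have h4 : (starRingEnd ℂ) (4 : ℂ) = 4 := map_ofNat (starRingEnd ℂ) 4
  have h8 : (starRingEnd ℂ) (8 : ℂ) = 8 := map_ofNat (starRingEnd ℂ) 8
  fin_cases j <;> simp [phase, conj_k, conj_lam, h2, h3, h4, h8]

/-- Conjugation carries Jost solutions at `z*` to adjoint ones at `z` and back. Existence and
uniqueness for the adjoint problem are therefore inherited and need no separate analysis. -/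
theorem IsSolution.adjPsi_eq (hD : D.IsSolution) {s : Side} {j : Fin 3} {z : ℂ}
    (h : D.Admissible s j ((starRingEnd ℂ) z)) :
    D.adjPsi s j z = fun x t => star (D.psi s j ((starRingEnd ℂ) z) x t) := by
  have hJ := hD.isJost_psi h
  have hex : IsJost (D.adjA z) (D.adjE z) (fun x t => -D.phase j z x t)
      (fun i => D.adjY s z i j) s.filter
      (fun x t => star (D.psi s j ((starRingEnd ℂ) z) x t)) := by
    have := hJ.conj
    simp only [conj_phase, Complex.conj_conj] at this
    exact this
  have h1 : IsJost (D.adjA z) (D.adjE z) (fun x t => -D.phase j z x t)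
      (fun i => D.adjY s z i j) s.filter (D.adjPsi s j z) :=
    Classical.epsilon_spec (p := IsJost (D.adjA z) (D.adjE z) (fun x t => -D.phase j z x t)
      (fun i => D.adjY s z i j) s.filter) ⟨_, hex⟩
  have h2 := h1.conj
  have hm : ∀ M : Matrix (Fin 3) (Fin 3) ℂ, (M.map (starRingEnd ℂ)).map (starRingEnd ℂ) = M := by
    intro M
    ext i j
    simp
  have hy : star (fun i => D.adjY s z i j) = fun i => D.Y s ((starRingEnd ℂ) z) i j := by
    funext i
    simp [adjY]
  simp only [adjA, adjE, hm, map_neg, neg_neg, conj_phase, hy] at h2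
  have h3 := hD.isJost_unique h h2 hJ
  funext x t
  rw [← congrFun (congrFun h3 x) t, star_star]

/-! The symmetry `z ↦ -q₀² / z`. -/

theorem k_inv (D : Data) {z : ℂ} (hz : z ≠ 0) (ha : (D.amp : ℂ) ≠ 0) : D.k (D.inv z) = D.k z := by
  simp only [k, inv]
  field_simp
  ring

theorem lam_inv (D : Data) {z : ℂ} (hz : z ≠ 0) (ha : (D.amp : ℂ) ≠ 0) :
    D.lam (D.inv z) = -D.lam z := by
  simp only [lam, inv]
  field_simp
  ring

theorem A_inv (D : Data) {z : ℂ} (hz : z ≠ 0) (ha : (D.amp : ℂ) ≠ 0) :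
    D.A (D.inv z) = D.A z := by
  funext x t
  simp only [A, D.k_inv hz ha]

theorem E_inv (D : Data) {z : ℂ} (hz : z ≠ 0) (ha : (D.amp : ℂ) ≠ 0) :
    D.E (D.inv z) = D.E z := by
  funext x t
  simp only [E, D.k_inv hz ha]

theorem inv_ne_zero (D : Data) {z : ℂ} (hz : z ≠ 0) (ha : (D.amp : ℂ) ≠ 0) : D.inv z ≠ 0 :=
  div_ne_zero (neg_ne_zero.2 (pow_ne_zero 2 ha)) hz

/-- The permutation of the columns induced by `z ↦ -q₀² / z`. -/
def swap : Fin 3 → Fin 3 := ![2, 1, 0]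

/-- The factors in the symmetry `z ↦ -q₀² / z`. -/
noncomputable def symFactor (D : Data) (z : ℂ) : Fin 3 → ℂ :=
  ![I * z / D.amp, 1, I * z / D.amp]

theorem phaseX_inv (D : Data) {z : ℂ} (hz : z ≠ 0) (ha : (D.amp : ℂ) ≠ 0) (j : Fin 3) :
    D.phaseX (D.inv z) j = D.phaseX z (swap j) := by
  fin_cases j <;> simp [phaseX, swap, D.k_inv hz ha, D.lam_inv hz ha]

theorem phase_inv (D : Data) {z : ℂ} (hz : z ≠ 0) (ha : (D.amp : ℂ) ≠ 0) (j : Fin 3) :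
    D.phase (swap j) (D.inv z) = D.phase j z := by
  have hs : ∀ j, swap (swap j) = j := by decide
  have hT : D.phaseT (D.inv z) (swap j) = D.phaseT z j := by
    fin_cases j <;> simp [phaseT, swap, D.k_inv hz ha, D.lam_inv hz ha] <;> ring
  funext x t
  rw [phase_eq, phase_eq, D.phaseX_inv hz ha, hs, hT]

theorem Y_inv (D : Data) (s : Side) {z : ℂ} (hz : z ≠ 0) (ha : (D.amp : ℂ) ≠ 0) (j : Fin 3) :
    (fun i => D.Y s (D.inv z) i (swap j)) = D.symFactor z j • fun i => D.Y s z i j := by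
  have hI := Complex.I_sq
  funext i
  fin_cases j <;> fin_cases i <;> simp [Y, swap, symFactor, inv] <;> field_simp <;>
    simp only [hI] <;> ring

theorem Admissible.inv {s : Side} {j : Fin 3} {z : ℂ} (h : D.Admissible s j z)
    (ha : (D.amp : ℂ) ≠ 0) : D.Admissible s (swap j) (D.inv z) where
  ne_zero := D.inv_ne_zero h.ne_zero ha
  gam_ne_zero := by
    have h1 := h.gam_ne_zero
    have hz := h.ne_zero
    have h2 : D.gam (D.inv z) = z ^ 2 / (D.amp : ℂ) ^ 2 * D.gam z := by
      simp only [gam, Data.inv]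
      field_simp
      ring
    rw [h2]
    exact mul_ne_zero (div_ne_zero (pow_ne_zero 2 hz) (pow_ne_zero 2 ha)) h1
  dominant i := by
    have hs : ∀ j, swap (swap j) = j := by decide
    rw [D.phaseX_inv h.ne_zero ha, D.phaseX_inv h.ne_zero ha, hs]
    exact h.dominant _

/-- Both sides solve the same Lax pair, which depends on `z` only through `k`, with the same phase
and normalization; uniqueness identifies them. -/
theorem IsSolution.psi_inv (hD : D.IsSolution) {s : Side} {j : Fin 3} {z : ℂ}
    (h : D.Admissible s j z) :
    D.psi s (swap j) (D.inv z) = fun x t => D.symFactor z j • D.psi s j z x t := by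
  have ha := hD.amp_ne_zero
  refine hD.isJost_unique (h.inv ha) (hD.isJost_psi (h.inv ha)) ?_
  rw [D.A_inv h.ne_zero ha, D.E_inv h.ne_zero ha, D.phase_inv h.ne_zero ha,
    D.Y_inv s h.ne_zero ha]
  exact (hD.isJost_psi h).smul _

end Data

end CoupledLPD

namespace CoupledLPD

/-! Linear algebra in `ℂ³`. -/

theorem exists_eq_smul_of_cross_eq_zero {u v : Fin 3 → ℂ} (hu : u ≠ 0) (h : crossProduct u v = 0) :
    ∃ c : ℂ, v = c • u := by
  have h0 := congrFun h 0
  have h1 := congrFun h 1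
  have h2 := congrFun h 2
  simp only [cross_apply, Matrix.cons_val_zero, Matrix.cons_val_one, Matrix.cons_val,
    Pi.zero_apply] at h0 h1 h2
  obtain ⟨i, hi⟩ := Function.ne_iff.1 hu
  rw [Pi.zero_apply] at hi
  -- The ratio is read off at a coordinate where `u` does not vanish; the vanishing 2×2 minors give
  -- the other coordinates.
  refine ⟨v i / u i, ?_⟩
  funext j
  rw [Pi.smul_apply, smul_eq_mul]
  field_simp
  fin_cases i <;> fin_cases j <;> simp <;>
    first
    | linear_combination h0
    | linear_combination -h0
    | linear_combination h1
    | linear_combination -h1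
    | linear_combination h2
    | linear_combination -h2

/-- By the triple product identity `(u × v) × w = (u·w) v - (v·w) u`, the cross product of `u × v`
with `w` vanishes. -/
theorem exists_eq_smul_cross {u v w : Fin 3 → ℂ} (h : crossProduct u v ≠ 0) (hu : u ⬝ᵥ w = 0)
    (hv : v ⬝ᵥ w = 0) : ∃ c : ℂ, w = c • crossProduct u v := by
  refine exists_eq_smul_of_cross_eq_zero h ?_
  simp only [dotProduct, Fin.sum_univ_three] at hu hv
  simp only [cross_apply]
  ext i
  fin_cases i <;> simp
  · linear_combination v 0 * hu - u 0 * hv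
  · linear_combination v 1 * hu - u 1 * hv
  · linear_combination v 2 * hu - u 2 * hv

theorem cross_ne_zero_of_dotProduct {u v w : Fin 3 → ℂ} (hu0 : u ≠ 0) (hu : u ⬝ᵥ w = 0)
    (hv : v ⬝ᵥ w ≠ 0) : crossProduct u v ≠ 0 := by
  intro h
  obtain ⟨c, rfl⟩ := exists_eq_smul_of_cross_eq_zero hu0 h
  rw [smul_dotProduct, hu, smul_zero] at hv
  exact hv rfl

/-- In this direction independence of `u` and `v` is not needed: if they are dependent, the factor
is zero. -/
theorem exists_cross_eq_smul {u v w : Fin 3 → ℂ} (hw : w ≠ 0) (hu : w ⬝ᵥ u = 0)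
    (hv : w ⬝ᵥ v = 0) : ∃ c : ℂ, crossProduct u v = c • w := by
  by_cases h : crossProduct u v = 0
  · exact ⟨0, by rw [h, zero_smul]⟩
  · obtain ⟨c, hc⟩ := exists_eq_smul_cross h (by rwa [dotProduct_comm]) (by rwa [dotProduct_comm])
    have hc0 : c ≠ 0 := by
      rintro rfl
      exact hw (by rw [hc, zero_smul])
    refine ⟨c⁻¹, ?_⟩
    rw [hc, smul_smul, inv_mul_cancel₀ hc0, one_smul]

theorem star_cross (u v : Fin 3 → ℂ) :
    crossProduct (star u) (star v) = star (crossProduct u v) := by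
  ext i
  fin_cases i <;> simp [cross_apply]

/-- The cross product of two solutions of the adjoint equation, up to the trace. -/
theorem hasDerivAt_smul_cross {M : Matrix (Fin 3) (Fin 3) ℂ} {e : ℝ → ℂ} {u v : ℝ → Fin 3 → ℂ}
    {x : ℝ} (he : HasDerivAt e (M.trace * e x) x) (hu : HasDerivAt u ((-Mᵀ) *ᵥ u x) x)
    (hv : HasDerivAt v ((-Mᵀ) *ᵥ v x) x) :
    HasDerivAt (fun y => e y • crossProduct (u y) (v y))
      (M *ᵥ (e x • crossProduct (u x) (v x))) x := by
  have hu' := hasDerivAt_pi.1 hu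
  have hv' := hasDerivAt_pi.1 hv
  -- The reason is `(Nu) × v + u × (Nv) = (tr N - Nᵀ)(u × v)`. With `N = -Mᵀ` this is `(M - tr M)(u
  -- × v)`, and the factor `e` absorbs the trace.
  rw [hasDerivAt_pi]
  intro i
  fin_cases i
  · simp only [cross_apply]
    refine (he.mul (((hu' 1).mul (hv' 2)).sub ((hu' 2).mul (hv' 1)))).congr_deriv ?_
    simp [Matrix.mulVec, dotProduct, Fin.sum_univ_three, Matrix.trace_fin_three]
    ring
  · simp only [cross_apply]
    refine (he.mul (((hu' 2).mul (hv' 0)).sub ((hu' 0).mul (hv' 2)))).congr_deriv ?_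
    simp [Matrix.mulVec, dotProduct, Fin.sum_univ_three, Matrix.trace_fin_three]
    ring
  · simp only [cross_apply]
    refine (he.mul (((hu' 0).mul (hv' 1)).sub ((hu' 1).mul (hv' 0)))).congr_deriv ?_
    simp [Matrix.mulVec, dotProduct, Fin.sum_univ_three, Matrix.trace_fin_three]
    ring

theorem map_conj_eq_neg_transpose {M N : Matrix (Fin 3) (Fin 3) ℂ}
    {a b c d e f g h i a' b' c' d' e' f' g' h' i' : ℂ}
    (hM : M = !![a, b, c; d, e, f; g, h, i]) (hN : N = !![a', b', c'; d', e', f'; g', h', i'])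
    (h₁ : (starRingEnd ℂ) a = -a' ∧ (starRingEnd ℂ) b = -d' ∧ (starRingEnd ℂ) c = -g')
    (h₂ : (starRingEnd ℂ) d = -b' ∧ (starRingEnd ℂ) e = -e' ∧ (starRingEnd ℂ) f = -h')
    (h₃ : (starRingEnd ℂ) g = -c' ∧ (starRingEnd ℂ) h = -f' ∧ (starRingEnd ℂ) i = -i') :
    M.map (starRingEnd ℂ) = -Nᵀ := by
  subst hM hN
  ext p q
  fin_cases p <;> fin_cases q
  exacts [h₁.1, h₁.2.1, h₁.2.2, h₂.1, h₂.2.1, h₂.2.2, h₃.1, h₃.2.1, h₃.2.2]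

/-! ### The adjoint problem, constant pairings and scattering coefficients. -/

namespace Data

variable {D : Data}

theorem adjA_eq (D : Data) (z : ℂ) (x t : ℝ) : D.adjA z x t = -(D.A z x t)ᵀ := by
  ext i j
  fin_cases i <;> fin_cases j <;> simp [adjA, A, J_eq, blockQ, conj_k]

theorem adjE_eq (D : Data) (z : ℂ) (x t : ℝ) : D.adjE z x t = -(D.E z x t)ᵀ := by
  have c2 : (starRingEnd ℂ) (2 : ℂ) = 2 := map_ofNat (starRingEnd ℂ) 2
  have c3 : (starRingEnd ℂ) (3 : ℂ) = 3 := map_ofNat (starRingEnd ℂ) 3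
  have c4 : (starRingEnd ℂ) (4 : ℂ) = 4 := map_ofNat (starRingEnd ℂ) 4
  have c8 : (starRingEnd ℂ) (8 : ℂ) = 8 := map_ofNat (starRingEnd ℂ) 8
  rw [adjE, E_eq_timeMatrix, E_eq_timeMatrix]
  simp only [timeMatrix, herm, blockQ, J_eq, J₁_eq, Matrix.mul_fin_three]
  -- The eighteen entries are found by unification after simplification, so that only scalar
  -- identities remain.
  refine map_conj_eq_neg_transpose 
    (by simp; exact ⟨⟨rfl, rfl, rfl⟩, ⟨rfl, rfl, rfl⟩, rfl, rfl, rfl⟩)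
    (by simp; exact ⟨⟨rfl, rfl, rfl⟩, ⟨rfl, rfl, rfl⟩, rfl, rfl, rfl⟩) ?_ ?_ ?_
  · simp only [map_add, map_sub, map_mul, map_neg, map_pow, map_one, Complex.conj_I,
      Complex.conj_ofReal, Complex.conj_conj, conj_k, c2, c3, c4, c8]
    refine ⟨?_, ?_, ?_⟩ <;> ring
  · simp only [map_add, map_sub, map_mul, map_neg, map_pow, map_one, Complex.conj_I,
      Complex.conj_ofReal, Complex.conj_conj, conj_k, c2, c3, c4, c8]
    refine ⟨?_, ?_, ?_⟩ <;> ring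
  · simp only [map_add, map_sub, map_mul, map_neg, map_pow, map_one, Complex.conj_I,
      Complex.conj_ofReal, Complex.conj_conj, conj_k, c2, c3, c4, c8]
    refine ⟨?_, ?_, ?_⟩ <;> ring

theorem trace_A (D : Data) (z : ℂ) (x t : ℝ) :
    (D.A z x t).trace = I * (D.phaseX z 0 + D.phaseX z 1 + D.phaseX z 2) := by
  simp [A, J_eq, blockQ, Matrix.trace_fin_three, phaseX]

theorem trace_E (D : Data) (z : ℂ) (x t : ℝ) :
    (D.E z x t).trace = I * (D.phaseT z 0 + D.phaseT z 1 + D.phaseT z 2) := by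
  rw [E_eq_timeMatrix]
  simp only [timeMatrix, herm, blockQ, J_eq, J₁_eq, Matrix.mul_fin_three]
  simp [Matrix.trace_fin_three, phaseT]
  ring

/-- `ψ` solves both equations of the Lax pair. -/
def IsLax (D : Data) (z : ℂ) (ψ : ℝ → ℝ → Fin 3 → ℂ) : Prop :=
  (∀ x t, HasDerivAt (fun x' => ψ x' t) (D.A z x t *ᵥ ψ x t) x) ∧
  (∀ x t, HasDerivAt (fun t' => ψ x t') (D.E z x t *ᵥ ψ x t) t)

theorem IsSolution.isLax_psi (hD : D.IsSolution) {s : Side} {j : Fin 3} {z : ℂ}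
    (h : D.Admissible s j z) : D.IsLax z (D.psi s j z) :=
  ⟨(hD.isJost_psi h).1, (hD.isJost_psi h).2.1⟩

theorem IsSolution.isLax_eq_zero (hD : D.IsSolution) {z : ℂ} {ψ : ℝ → ℝ → Fin 3 → ℂ}
    (h : D.IsLax z ψ) (h0 : ψ 0 0 = 0) (x t : ℝ) : ψ x t = 0 := by
  have h1 : ∀ x, ψ x 0 = 0 :=
    eq_zero_of_eq_zero (hD.continuous_A z 0) (f := fun x => ψ x 0) (fun x => h.1 x 0) h0
  exact eq_zero_of_eq_zero ((hD.continuous_E z).comp (continuous_const.prodMk continuous_id))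
    (h.2 x) (h1 x) t

/-- Uniqueness first in `x` along `t = 0`, then in `t` for each `x`, reduces proportionality of
functions to proportionality of vectors in `ℂ³`. -/
theorem IsSolution.isLax_eq_smul (hD : D.IsSolution) {z c : ℂ} {ψ φ : ℝ → ℝ → Fin 3 → ℂ}
    (hψ : D.IsLax z ψ) (hφ : D.IsLax z φ) (h0 : ψ 0 0 = c • φ 0 0) (x t : ℝ) :
    ψ x t = c • φ x t := by
  refine sub_eq_zero.1 (hD.isLax_eq_zero (z := z) (ψ := fun x t => ψ x t - c • φ x t)
    ⟨fun x t => ?_, fun x t => ?_⟩ (sub_eq_zero.2 h0) x t)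
  · exact ((hψ.1 x t).fun_sub ((hφ.1 x t).fun_const_smul c)).congr_deriv
      (by rw [Matrix.mulVec_sub, Matrix.mulVec_smul])
  · exact ((hψ.2 x t).fun_sub ((hφ.2 x t).fun_const_smul c)).congr_deriv
      (by rw [Matrix.mulVec_sub, Matrix.mulVec_smul])

theorem IsLax.star_x {z : ℂ} {ψ : ℝ → ℝ → Fin 3 → ℂ} (h : D.IsLax ((starRingEnd ℂ) z) ψ)
    (x t : ℝ) : HasDerivAt (fun y => star (ψ y t)) ((-(D.A z x t)ᵀ) *ᵥ star (ψ x t)) x := by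
  rw [← adjA_eq, adjA, map_conj_mulVec]
  exact (h.1 x t).star

theorem IsLax.star_t {z : ℂ} {ψ : ℝ → ℝ → Fin 3 → ℂ} (h : D.IsLax ((starRingEnd ℂ) z) ψ)
    (x t : ℝ) : HasDerivAt (fun y => star (ψ x y)) ((-(D.E z x t)ᵀ) *ᵥ star (ψ x t)) t := by
  rw [← adjE_eq, adjE, map_conj_mulVec]
  exact (h.2 x t).star

theorem totalExp_eq (D : Data) (z : ℂ) (x t : ℝ) : D.totalExp z x t =
    Complex.exp (I * (D.phaseX z 0 + D.phaseX z 1 + D.phaseX z 2) * x +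
      I * (D.phaseT z 0 + D.phaseT z 1 + D.phaseT z 2) * t) := by
  rw [totalExp, phase_eq, phase_eq, phase_eq]
  ring_nf

theorem totalExp_ne_zero (D : Data) (z : ℂ) (x t : ℝ) : D.totalExp z x t ≠ 0 :=
  Complex.exp_ne_zero _

theorem hasDerivAt_linear_exp (a b : ℂ) (x : ℝ) :
    HasDerivAt (fun x : ℝ => Complex.exp (a * x + b)) (a * Complex.exp (a * x + b)) x := by
  have : HasDerivAt (fun x : ℝ => a * (x : ℂ) + b) a x := by
    simpa using ((Complex.ofRealCLM.hasDerivAt (x := x)).const_mul a).add_const b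
  exact this.cexp.congr_deriv (mul_comm _ _)

theorem IsLax.cross {z : ℂ} {ψ φ : ℝ → ℝ → Fin 3 → ℂ} (hψ : D.IsLax ((starRingEnd ℂ) z) ψ)
    (hφ : D.IsLax ((starRingEnd ℂ) z) φ) :
    D.IsLax z fun x t => D.totalExp z x t • crossProduct (star (ψ x t)) (star (φ x t)) := by
  refine ⟨fun x t => hasDerivAt_smul_cross ?_ (hψ.star_x x t) (hφ.star_x x t),
    fun x t => hasDerivAt_smul_cross ?_ (hψ.star_t x t) (hφ.star_t x t)⟩
  · rw [trace_A]
    simp only [totalExp_eq]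
    exact hasDerivAt_linear_exp _ _ x
  · rw [trace_E]
    simp only [totalExp_eq]
    have h := hasDerivAt_linear_exp (I * (D.phaseT z 0 + D.phaseT z 1 + D.phaseT z 2))
      (I * (D.phaseX z 0 + D.phaseX z 1 + D.phaseX z 2) * x) t
    simp only [add_comm (_ * (t : ℂ))] at h
    refine h.congr_of_eventuallyEq (Eventually.of_forall fun y => ?_)
    simp only [totalExp_eq, add_comm (_ * (x : ℂ))]

/-- The conjugated solution evolves by `-Aᵀ`, so the two terms of the product rule cancel. -/
theorem IsLax.pairing_const {z : ℂ} {ψ φ : ℝ → ℝ → Fin 3 → ℂ} (hψ : D.IsLax ((starRingEnd ℂ) z) ψ)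
    (hφ : D.IsLax z φ) (x : ℝ) : star (ψ x 0) ⬝ᵥ φ x 0 = star (ψ 0 0) ⬝ᵥ φ 0 0 := by
  have hd : ∀ x, HasDerivAt (fun x => star (ψ x 0) ⬝ᵥ φ x 0) 0 x := by
    intro x
    have h1 := hasDerivAt_pi.1 (hψ.star_x x 0)
    have h2 := hasDerivAt_pi.1 (hφ.1 x 0)
    have h3 := HasDerivAt.fun_sum (u := Finset.univ) fun i _ => (h1 i).mul (h2 i)
    refine h3.congr_deriv ?_
    rw [Finset.sum_add_distrib]
    change (-(D.A z x 0)ᵀ *ᵥ star (ψ x 0)) ⬝ᵥ φ x 0 + star (ψ x 0) ⬝ᵥ D.A z x 0 *ᵥ φ x 0 = 0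
    rw [Matrix.neg_mulVec, neg_dotProduct, Matrix.mulVec_transpose, Matrix.dotProduct_mulVec,
      neg_add_cancel]
  exact is_const_of_deriv_eq_zero (fun x => (hd x).differentiableAt) (fun x => (hd x).deriv) x 0

/-- The asymptotics of a Jost solution at time `0`. -/
theorem IsSolution.tendsto_psi (hD : D.IsSolution) {s : Side} {j : Fin 3} {z : ℂ}
    (h : D.Admissible s j z) :
    Tendsto (fun x : ℝ => Complex.exp (-(I * D.phaseX z j) * x) • D.psi s j z x 0) s.filter
      (𝓝 ((D.Y s z).col j)) := by
  refine ((hD.isJost_psi h).2.2 0).congr fun x => ?_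
  rw [exp_phase]
  simp

theorem conj_phaseX (D : Data) (z : ℂ) (j : Fin 3) :
    (starRingEnd ℂ) (D.phaseX ((starRingEnd ℂ) z) j) = D.phaseX z j := by
  fin_cases j <;> simp [phaseX, conj_k, conj_lam]

theorem IsSolution.tendsto_star_psi (hD : D.IsSolution) {s : Side} {j : Fin 3} {z : ℂ}
    (h : D.Admissible s j ((starRingEnd ℂ) z)) :
    Tendsto (fun x : ℝ => Complex.exp (I * D.phaseX z j * x) •
      star (D.psi s j ((starRingEnd ℂ) z) x 0)) s.filter (𝓝 ((D.adjY s z).col j)) := by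
  refine ((continuous_star.tendsto _).comp (hD.tendsto_psi h)).congr fun x => ?_
  simp only [Function.comp_apply, star_smul]
  congr 1
  rw [Complex.star_def, ← Complex.exp_conj]
  simp [conj_phaseX]

/-- A zero at the origin would make the solution vanish identically, against its nonzero limit, a
column of an invertible matrix. -/
theorem IsSolution.psi_zero_ne_zero (hD : D.IsSolution) {s : Side} {j : Fin 3} {z : ℂ}
    (h : D.Admissible s j z) : D.psi s j z 0 0 ≠ 0 := by
  intro h0
  have h1 := hD.tendsto_psi h
  simp only [hD.isLax_eq_zero (hD.isLax_psi h) h0, smul_zero] at h1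
  have h2 : (D.Y s z).col j = 0 := tendsto_nhds_unique h1 tendsto_const_nhds
  have h3 := congrFun (congrFun (D.YInv_mul_Y s h.ne_zero hD.amp_ne_zero h.gam_ne_zero) j) j
  have h4 : (D.YInv s z * D.Y s z) j j = (D.YInv s z *ᵥ (D.Y s z).col j) j := rfl
  rw [h4, h2, Matrix.mulVec_zero] at h3
  simp at h3

theorem adjY_col_dotProduct (D : Data) (s : Side) {z : ℂ} (hz : z ≠ 0) (ha : (D.amp : ℂ) ≠ 0)
    {i j : Fin 3} (hij : i ≠ j) : (D.adjY s z).col i ⬝ᵥ (D.Y s z).col j = 0 := by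
  have h := congrFun (congrFun (D.adjY_transpose_mul s hz ha) i) j
  rw [Matrix.diagonal_apply_ne _ hij] at h
  exact h

theorem tendsto_dotProduct {l : Filter ℝ} {u v : ℝ → Fin 3 → ℂ} {a b : Fin 3 → ℂ}
    (hu : Tendsto u l (𝓝 a)) (hv : Tendsto v l (𝓝 b)) :
    Tendsto (fun x => u x ⬝ᵥ v x) l (𝓝 (a ⬝ᵥ b)) :=
  tendsto_finsetSum _ fun i _ => (tendsto_pi_nhds.1 hu i).mul (tendsto_pi_nhds.1 hv i)

theorem eventually_one_le_norm_exp {s : Side} {c : ℂ} (hc : 0 ≤ s.sgn * c.re) :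
    ∀ᶠ x : ℝ in s.filter, 1 ≤ ‖Complex.exp (c * x)‖ := by
  cases s
  · filter_upwards [eventually_le_atBot 0] with x hx
    rw [Complex.norm_exp, Complex.re_mul_ofReal]
    refine Real.one_le_exp (mul_nonneg_of_nonpos_of_nonpos ?_ hx)
    simpa [Side.sgn] using hc
  · filter_upwards [eventually_ge_atTop 0] with x hx
    rw [Complex.norm_exp, Complex.re_mul_ofReal]
    refine Real.one_le_exp (mul_nonneg ?_ hx)
    simpa [Side.sgn] using hc

theorem IsSolution.weighted_pairing (hD : D.IsSolution) {s s' : Side} {i j : Fin 3} {z : ℂ}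
    (hi : D.Admissible s i ((starRingEnd ℂ) z)) (hj : D.Admissible s' j z) (x : ℝ) :
    (Complex.exp (I * D.phaseX z i * x) • star (D.psi s i ((starRingEnd ℂ) z) x 0)) ⬝ᵥ
        (Complex.exp (-(I * D.phaseX z j) * x) • D.psi s' j z x 0) =
      Complex.exp ((I * D.phaseX z i - I * D.phaseX z j) * x) *
        (star (D.psi s i ((starRingEnd ℂ) z) 0 0) ⬝ᵥ D.psi s' j z 0 0) := by
  rw [smul_dotProduct, dotProduct_smul, (hD.isLax_psi hi).pairing_const (hD.isLax_psi hj) x,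
    smul_smul, ← Complex.exp_add, smul_eq_mul]
  congr 2
  ring

/-- Jost solutions with different indices, normalized at the same end, are orthogonal to each
other. -/
theorem IsSolution.pairing_eq_zero (hD : D.IsSolution) {s : Side} {i j : Fin 3} {z : ℂ}
    (hij : i ≠ j) (hi : D.Admissible s i ((starRingEnd ℂ) z)) (hj : D.Admissible s j z) :
    star (D.psi s i ((starRingEnd ℂ) z) 0 0) ⬝ᵥ D.psi s j z 0 0 = 0 := by
  have h1 := tendsto_dotProduct (hD.tendsto_star_psi hi) (hD.tendsto_psi hj)
  rw [D.adjY_col_dotProduct s hj.ne_zero hD.amp_ne_zero hij] at h1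
  simp only [hD.weighted_pairing hi hj] at h1
  have hc : 0 ≤ s.sgn * (I * D.phaseX z i - I * D.phaseX z j).re := by
    rw [Complex.sub_re, mul_sub]
    exact sub_nonneg.2 (hj.dominant i)
  -- The weighted pairing tends to `Ỹ_i · Y_j = 0`, and its exponential weight has modulus at least
  -- 1 near this end by dominance of `j`; hence the constant pairing is zero.
  refine tendsto_nhds_unique (f := fun _ : ℝ => _) (l := s.filter) tendsto_const_nhds
    (squeeze_zero_norm' ?_ (tendsto_norm_zero.comp h1))
  filter_upwards [eventually_one_le_norm_exp hc] with x hx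
  rw [Function.comp_apply, norm_mul]
  exact le_mul_of_one_le_left (norm_nonneg _) hx

/-- The diagonal scattering coefficients are the pairings of Jost solutions with the same index,
normalized at opposite ends. -/
theorem IsSolution.diagScattering_eq (hD : D.IsSolution) {s : Side} {j : Fin 3} {z : ℂ}
    (hi : D.Admissible s.opp j ((starRingEnd ℂ) z)) (hj : D.Admissible s j z) :
    D.diagScattering s j z = (![(D.gam z)⁻¹, 1, (D.gam z)⁻¹] j) *
      (star (D.psi s.opp j ((starRingEnd ℂ) z) 0 0) ⬝ᵥ D.psi s j z 0 0) := by
  have hY : (D.Y s.opp z)⁻¹ = D.YInv s.opp z :=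
    Matrix.inv_eq_left_inv (D.YInv_mul_Y s.opp hj.ne_zero hD.amp_ne_zero hj.gam_ne_zero)
  have hnu : ∀ x : ℝ, D.nu s j z x 0 =
      Complex.exp (-(I * D.phaseX z j) * x) • D.psi s j z x 0 := by
    intro x
    rw [nu, exp_phase]
    simp
  refine Tendsto.limUnder_eq ?_
  have hval : ∀ x : ℝ, ((D.Y s.opp z)⁻¹ *ᵥ D.nu s j z x 0) j =
      (![(D.gam z)⁻¹, 1, (D.gam z)⁻¹] j) * ((D.adjY s.opp z).col j ⬝ᵥ
        (Complex.exp (-(I * D.phaseX z j) * x) • D.psi s j z x 0)) := by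
    intro x
    rw [hY, YInv, ← Matrix.mulVec_mulVec, Matrix.mulVec_diagonal, hnu]
    rfl
  simp only [hval]
  refine Tendsto.const_mul _ ?_
  have hd : ∀ i, s.opp.sgn * (I * D.phaseX z i).re ≤ s.opp.sgn * (I * D.phaseX z j).re := by
    intro i
    have := hj.dominant i
    cases s <;> simp only [Side.opp, Side.sgn] at this ⊢ <;> linarith
  obtain ⟨C, hC⟩ := (hD.isPerturbation s.opp hj.ne_zero hj.gam_ne_zero 0).bounded (j := j) hd
    (fun x => (hD.isJost_psi hj).1 x 0)
  have h1 : Tendsto (fun x : ℝ => Complex.exp (I * D.phaseX z j * x) •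
      star (D.psi s.opp j ((starRingEnd ℂ) z) x 0) - (D.adjY s.opp z).col j) s.opp.filter
        (𝓝 0) := tendsto_sub_nhds_zero_iff.2 (hD.tendsto_star_psi hi)
  -- The limiting column of `Ỹ` may be replaced by the rescaled adjoint solution, at the cost of a
  -- null factor times a bounded one. With equal indices the exponentials cancel, so the new pairing
  -- is exactly constant.
  have h2 : Tendsto (fun x : ℝ => (Complex.exp (I * D.phaseX z j * x) •
      star (D.psi s.opp j ((starRingEnd ℂ) z) x 0) - (D.adjY s.opp z).col j) ⬝ᵥ
        (Complex.exp (-(I * D.phaseX z j) * x) • D.psi s j z x 0)) s.opp.filter (𝓝 0) := by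
    have h := tendsto_finsetSum Finset.univ fun (i : Fin 3) _ =>
      (tendsto_pi_nhds.1 h1 i).zero_mul_isBoundedUnder_le
        (isBoundedUnder_of_eventually_le (a := C)
          (hC.mono fun x hx => (norm_le_pi_norm _ i).trans hx))
    rwa [Finset.sum_const_zero] at h
  have h3 := (tendsto_const_nhds
    (x := star (D.psi s.opp j ((starRingEnd ℂ) z) 0 0) ⬝ᵥ D.psi s j z 0 0)).sub h2
  rw [sub_zero] at h3
  refine h3.congr fun x => ?_
  rw [sub_dotProduct, hD.weighted_pairing hi hj, sub_self, zero_mul, Complex.exp_zero, one_mul,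
    sub_sub_cancel]

end Data

end CoupledLPD

/-! ### Points of `U₁`: admissibility, symmetries of the `μ_j`, and the three types. -/

namespace CoupledLPD

namespace Data

variable {D : Data}

/-- With `r = q₀²/|z|² ∈ [0,1)`, the imaginary parts of `λ` and `k` are `(1 ∓ r) Im z / 2`. This
ordering makes index 1 dominant at `-∞` and index 2 at `+∞` for `z`, with the ends exchanged for
`z*`. -/
theorem lam_im_pos_le {D : Data} {z : ℂ} (hz : z ∈ D.U₁) :
    0 < (D.lam z).im ∧ (D.lam z).im ≤ (D.k z).im := by
  obtain ⟨h1, h2⟩ := hz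
  have ha : 0 ≤ D.amp := norm_nonneg _
  have hn : D.amp ^ 2 < Complex.normSq z := by
    rw [Complex.normSq_eq_norm_sq]
    exact pow_lt_pow_left₀ h2 ha two_ne_zero
  have hn0 : 0 < Complex.normSq z := (sq_nonneg _).trans_lt hn
  have him : ((D.amp : ℂ) ^ 2 / z).im = -(D.amp ^ 2 / Complex.normSq z * z.im) := by
    rw [← Complex.ofReal_pow, Complex.div_im, Complex.ofReal_re, Complex.ofReal_im]
    ring
  have hr0 : 0 ≤ D.amp ^ 2 / Complex.normSq z := by positivity
  have hr1 : D.amp ^ 2 / Complex.normSq z < 1 := (div_lt_one hn0).2 hn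
  have hl : (D.lam z).im = (z.im - D.amp ^ 2 / Complex.normSq z * z.im) / 2 := by
    rw [lam, Complex.div_ofNat_im, Complex.add_im, him]
    ring
  have hk : (D.k z).im = (z.im + D.amp ^ 2 / Complex.normSq z * z.im) / 2 := by
    rw [k, Complex.div_ofNat_im, Complex.sub_im, him]
    ring
  rw [hl, hk]
  constructor
  · nlinarith
  · nlinarith [mul_nonneg hr0 h1.le]

theorem gam_ne_zero_of_lt_norm {z : ℂ} (h : D.amp < ‖z‖) : D.gam z ≠ 0 := by
  have ha : 0 ≤ D.amp := norm_nonneg _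
  intro h0
  have hz : z ≠ 0 := norm_pos_iff.1 (ha.trans_lt h)
  have h1 : (D.amp : ℂ) ^ 2 = -z ^ 2 := by
    rw [gam] at h0
    field_simp at h0
    linear_combination h0
  have h2 : D.amp ^ 2 = ‖z‖ ^ 2 := by
    have := congrArg norm h1
    simpa [abs_of_nonneg ha] using this
  exact absurd (pow_lt_pow_left₀ h ha two_ne_zero) (by rw [h2]; exact lt_irrefl _)

theorem admissible_minus_zero {z : ℂ} (hz : z ∈ D.U₁) : D.Admissible Side.minus 0 z where
  ne_zero := by
    rintro rfl
    simpa using hz.1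
  gam_ne_zero := gam_ne_zero_of_lt_norm hz.2
  dominant i := by
    have h := lam_im_pos_le hz
    fin_cases i <;> simp [phaseX, Side.sgn] <;> linarith

theorem admissible_plus_one {z : ℂ} (hz : z ∈ D.U₁) : D.Admissible Side.plus 1 z where
  ne_zero := (admissible_minus_zero hz).ne_zero
  gam_ne_zero := gam_ne_zero_of_lt_norm hz.2
  dominant i := by
    have h := lam_im_pos_le hz
    fin_cases i <;> simp [phaseX, Side.sgn] <;> linarith

theorem admissible_plus_zero_conj {z : ℂ} (hz : z ∈ D.U₁) :
    D.Admissible Side.plus 0 ((starRingEnd ℂ) z) where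
  ne_zero := (map_ne_zero _).2 (admissible_minus_zero hz).ne_zero
  gam_ne_zero := gam_ne_zero_of_lt_norm (by rw [Complex.norm_conj]; exact hz.2)
  dominant i := by
    have h := lam_im_pos_le hz
    fin_cases i <;> simp [phaseX, Side.sgn, ← conj_k, ← conj_lam] <;> linarith

theorem admissible_minus_one_conj {z : ℂ} (hz : z ∈ D.U₁) :
    D.Admissible Side.minus 1 ((starRingEnd ℂ) z) where
  ne_zero := (map_ne_zero _).2 (admissible_minus_zero hz).ne_zero
  gam_ne_zero := gam_ne_zero_of_lt_norm (by rw [Complex.norm_conj]; exact hz.2)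
  dominant i := by
    have h := lam_im_pos_le hz
    fin_cases i <;> simp [phaseX, Side.sgn, ← conj_k, ← conj_lam] <;> linarith

theorem conj_inv (D : Data) (z : ℂ) :
    (starRingEnd ℂ) (D.inv z) = D.inv ((starRingEnd ℂ) z) := by
  simp [inv]

theorem totalExp_inv (D : Data) {z : ℂ} (hz : z ≠ 0) (ha : (D.amp : ℂ) ≠ 0) :
    D.totalExp (D.inv z) = D.totalExp z := by
  funext x t
  have h0 : D.phase 2 (D.inv z) = D.phase 0 z := D.phase_inv hz ha 0
  have h1 : D.phase 1 (D.inv z) = D.phase 1 z := D.phase_inv hz ha 1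
  have h2 : D.phase 0 (D.inv z) = D.phase 2 z := D.phase_inv hz ha 2
  rw [totalExp, totalExp, h0, h1, h2]
  ring_nf

theorem IsSolution.mu₁_eq (hD : D.IsSolution) {z : ℂ} (hz : z ∈ D.U₁) (x t : ℝ) :
    D.mu₁ z x t = D.totalExp z x t •
      crossProduct (star (D.psi Side.plus 0 ((starRingEnd ℂ) z) x t))
        (star (D.psi Side.minus 1 ((starRingEnd ℂ) z) x t)) := by
  rw [mu₁, hD.adjPsi_eq (admissible_plus_zero_conj hz),
    hD.adjPsi_eq (admissible_minus_one_conj hz)]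

theorem IsSolution.mu₂_conj_eq (hD : D.IsSolution) {z : ℂ} (hz : z ∈ D.U₁) (x t : ℝ) :
    D.mu₂ ((starRingEnd ℂ) z) x t = D.totalExp ((starRingEnd ℂ) z) x t •
      crossProduct (star (D.psi Side.minus 0 z x t)) (star (D.psi Side.plus 1 z x t)) := by
  rw [mu₂, hD.adjPsi_eq (by rw [Complex.conj_conj]; exact admissible_minus_zero hz),
    hD.adjPsi_eq (by rw [Complex.conj_conj]; exact admissible_plus_one hz)]
  simp only [Complex.conj_conj]

theorem IsSolution.isLax_mu₁ (hD : D.IsSolution) {z : ℂ} (hz : z ∈ D.U₁) :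
    D.IsLax z (D.mu₁ z) := by
  rw [show D.mu₁ z = _ from funext₂ (hD.mu₁_eq hz)]
  exact (hD.isLax_psi (admissible_plus_zero_conj hz)).cross
    (hD.isLax_psi (admissible_minus_one_conj hz))

theorem IsSolution.isLax_mu₂_conj (hD : D.IsSolution) {z : ℂ} (hz : z ∈ D.U₁) :
    D.IsLax ((starRingEnd ℂ) z) (D.mu₂ ((starRingEnd ℂ) z)) := by
  rw [show D.mu₂ ((starRingEnd ℂ) z) = _ from funext₂ (hD.mu₂_conj_eq hz)]
  refine IsLax.cross ?_ ?_
  · rw [Complex.conj_conj]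
    exact hD.isLax_psi (admissible_minus_zero hz)
  · rw [Complex.conj_conj]
    exact hD.isLax_psi (admissible_plus_one hz)

theorem IsSolution.psi_plus_two_inv (hD : D.IsSolution) {z : ℂ} (hz : z ∈ D.U₁) (x t : ℝ) :
    D.psi Side.plus 2 (D.inv ((starRingEnd ℂ) z)) x t =
      (I * (starRingEnd ℂ) z / D.amp) • D.psi Side.plus 0 ((starRingEnd ℂ) z) x t :=
  congrFun₂ (hD.psi_inv (admissible_plus_zero_conj hz)) x t

theorem IsSolution.psi_minus_one_inv (hD : D.IsSolution) {z : ℂ} (hz : z ∈ D.U₁) (x t : ℝ) :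
    D.psi Side.minus 1 (D.inv ((starRingEnd ℂ) z)) x t =
      D.psi Side.minus 1 ((starRingEnd ℂ) z) x t :=
  (congrFun₂ (hD.psi_inv (admissible_minus_one_conj hz)) x t).trans (one_smul ℂ _)

theorem IsSolution.psi_minus_two_inv (hD : D.IsSolution) {z : ℂ} (hz : z ∈ D.U₁) (x t : ℝ) :
    D.psi Side.minus 2 (D.inv z) x t = (I * z / D.amp) • D.psi Side.minus 0 z x t :=
  congrFun₂ (hD.psi_inv (admissible_minus_zero hz)) x t

theorem IsSolution.psi_plus_one_inv (hD : D.IsSolution) {z : ℂ} (hz : z ∈ D.U₁) (x t : ℝ) :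
    D.psi Side.plus 1 (D.inv z) x t = D.psi Side.plus 1 z x t :=
  (congrFun₂ (hD.psi_inv (admissible_plus_one hz)) x t).trans (one_smul ℂ _)

/-- Conjugating the factor `iz/q₀` of `ψ_{-,3}` produces a minus sign, which is undone by the
reversed order of the cross product in `μ₃` relative to `μ₂`. -/
theorem IsSolution.mu₃_inv (hD : D.IsSolution) {z : ℂ} (hz : z ∈ D.U₁) (x t : ℝ) :
    D.mu₃ (D.inv ((starRingEnd ℂ) z)) x t =
      (I * (starRingEnd ℂ) z / D.amp) • D.mu₂ ((starRingEnd ℂ) z) x t := by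
  have ha := hD.amp_ne_zero
  have hc : (starRingEnd ℂ) (D.inv ((starRingEnd ℂ) z)) = D.inv z := by
    rw [conj_inv, Complex.conj_conj]
  have h1 : D.Admissible Side.plus 1 ((starRingEnd ℂ) (D.inv ((starRingEnd ℂ) z))) := by
    rw [hc]
    exact (admissible_plus_one hz).inv ha
  have h2 : D.Admissible Side.minus 2 ((starRingEnd ℂ) (D.inv ((starRingEnd ℂ) z))) := by
    rw [hc]
    exact (admissible_minus_zero hz).inv ha
  rw [mu₃, hD.adjPsi_eq h1, hD.adjPsi_eq h2, hc]
  simp only [hD.psi_plus_one_inv hz, hD.psi_minus_two_inv hz, hD.mu₂_conj_eq hz]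
  rw [D.totalExp_inv (admissible_plus_zero_conj hz).ne_zero ha, star_smul, map_smul,
    ← cross_anticomm, smul_comm (D.totalExp _ x t), smul_neg, smul_neg, ← neg_smul]
  congr 1
  simp
  ring

theorem IsSolution.mu₄_inv (hD : D.IsSolution) {z : ℂ} (hz : z ∈ D.U₁) (x t : ℝ) :
    D.mu₄ (D.inv z) x t = (I * z / D.amp) • D.mu₁ z x t := by
  have ha := hD.amp_ne_zero
  have h1 : D.Admissible Side.minus 1 ((starRingEnd ℂ) (D.inv z)) := by
    rw [conj_inv]
    exact (admissible_minus_one_conj hz).inv ha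
  have h2 : D.Admissible Side.plus 2 ((starRingEnd ℂ) (D.inv z)) := by
    rw [conj_inv]
    exact (admissible_plus_zero_conj hz).inv ha
  rw [mu₄, hD.adjPsi_eq h1, hD.adjPsi_eq h2, conj_inv]
  simp only [hD.psi_minus_one_inv hz, hD.psi_plus_two_inv hz, hD.mu₁_eq hz]
  rw [D.totalExp_inv (admissible_minus_zero hz).ne_zero ha, star_smul, map_smul,
    ← cross_anticomm, smul_comm (D.totalExp _ x t), smul_neg, smul_neg, ← neg_smul]
  congr 1
  simp
  ring

theorem IsSolution.s₁₁_eq (hD : D.IsSolution) {z : ℂ} (hz : z ∈ D.U₁) :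
    D.s₁₁ z = (D.gam z)⁻¹ * (star (D.psi Side.plus 0 ((starRingEnd ℂ) z) 0 0) ⬝ᵥ
      D.psi Side.minus 0 z 0 0) :=
  hD.diagScattering_eq (s := Side.minus) (admissible_plus_zero_conj hz) (admissible_minus_zero hz)

theorem IsSolution.h₂₂_eq (hD : D.IsSolution) {z : ℂ} (hz : z ∈ D.U₁) :
    D.h₂₂ z = star (D.psi Side.minus 1 ((starRingEnd ℂ) z) 0 0) ⬝ᵥ D.psi Side.plus 1 z 0 0 :=
  (hD.diagScattering_eq (s := Side.plus) (admissible_minus_one_conj hz)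
    (admissible_plus_one hz)).trans (one_mul _)

theorem IsSolution.pairing_plus (hD : D.IsSolution) {z : ℂ} (hz : z ∈ D.U₁) :
    star (D.psi Side.plus 0 ((starRingEnd ℂ) z) 0 0) ⬝ᵥ D.psi Side.plus 1 z 0 0 = 0 :=
  hD.pairing_eq_zero (by decide) (admissible_plus_zero_conj hz) (admissible_plus_one hz)

theorem IsSolution.pairing_minus (hD : D.IsSolution) {z : ℂ} (hz : z ∈ D.U₁) :
    star (D.psi Side.minus 1 ((starRingEnd ℂ) z) 0 0) ⬝ᵥ D.psi Side.minus 0 z 0 0 = 0 :=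
  hD.pairing_eq_zero (by decide) (admissible_minus_one_conj hz) (admissible_minus_zero hz)

theorem star_dotProduct_comm_eq_zero {u v : Fin 3 → ℂ} : star u ⬝ᵥ v = 0 ↔ star v ⬝ᵥ u = 0 := by
  rw [Matrix.star_dotProduct, star_eq_zero]

/-- First type: `ψ_{-,1}` is a multiple of `μ₁`, and `μ₂` is a multiple of `ψ_{+,1}`. -/
theorem IsSolution.first_type (hD : D.IsSolution) {z : ℂ} (hz : D.FirstType z) :
    (∃ c : ℂ, ∀ x t, D.psi Side.minus 0 z x t = c • D.mu₁ z x t) ∧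
    (∃ c : ℂ, ∀ x t, D.mu₂ ((starRingEnd ℂ) z) x t =
      c • D.psi Side.plus 0 ((starRingEnd ℂ) z) x t) := by
  obtain ⟨hz, hs, hh⟩ := hz
  rw [hD.s₁₁_eq hz, mul_eq_zero, or_iff_right
    (_root_.inv_ne_zero (admissible_minus_zero hz).gam_ne_zero)] at hs
  rw [hD.h₂₂_eq hz] at hh
  have hα := hD.psi_zero_ne_zero (admissible_plus_zero_conj hz)
  constructor
  -- The two factors of `μ₁` are independent: `ψ_{+,2}` is orthogonal to the first and, as `h₂₂ ≠
  -- 0`, not to the second. `ψ_{-,1}` is orthogonal to both, by `s₁₁ = 0` and by the pairing at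
  -- `-∞`.
  · obtain ⟨c, hc⟩ := exists_eq_smul_cross
      (cross_ne_zero_of_dotProduct (star_ne_zero.2 hα) (hD.pairing_plus hz) hh) hs
      (hD.pairing_minus hz)
    refine ⟨c / D.totalExp z 0 0, hD.isLax_eq_smul (hD.isLax_psi (admissible_minus_zero hz))
      (hD.isLax_mu₁ hz) ?_⟩
    rw [hD.mu₁_eq hz, smul_smul, div_mul_cancel₀ _ (D.totalExp_ne_zero z 0 0)]
    exact hc
  · obtain ⟨c, hc⟩ := exists_cross_eq_smul hα
      ((dotProduct_comm _ _).trans (star_dotProduct_comm_eq_zero.1 hs))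
      ((dotProduct_comm _ _).trans (star_dotProduct_comm_eq_zero.1 (hD.pairing_plus hz)))
    refine ⟨D.totalExp ((starRingEnd ℂ) z) 0 0 * c, hD.isLax_eq_smul (hD.isLax_mu₂_conj hz)
      (hD.isLax_psi (admissible_plus_zero_conj hz)) ?_⟩
    rw [hD.mu₂_conj_eq hz, hc, smul_smul]

/-- Second type: `μ₁` is a multiple of `ψ_{+,2}`, and `ψ_{-,2}` is a multiple of `μ₂`. -/
theorem IsSolution.second_type (hD : D.IsSolution) {z : ℂ} (hz : D.SecondType z) :
    (∃ c : ℂ, ∀ x t, D.mu₁ z x t = c • D.psi Side.plus 1 z x t) ∧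
    (∃ c : ℂ, ∀ x t, D.psi Side.minus 1 ((starRingEnd ℂ) z) x t =
      c • D.mu₂ ((starRingEnd ℂ) z) x t) := by
  obtain ⟨hz, hs, hh⟩ := hz
  have hs' := right_ne_zero_of_mul ((hD.s₁₁_eq hz).symm.trans_ne hs)
  rw [hD.h₂₂_eq hz] at hh
  have hw := hD.psi_zero_ne_zero (admissible_plus_one hz)
  constructor
  · obtain ⟨c, hc⟩ := exists_cross_eq_smul hw
      ((dotProduct_comm _ _).trans (hD.pairing_plus hz)) ((dotProduct_comm _ _).trans hh)
    refine ⟨D.totalExp z 0 0 * c, hD.isLax_eq_smul (hD.isLax_mu₁ hz)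
      (hD.isLax_psi (admissible_plus_one hz)) ?_⟩
    rw [hD.mu₁_eq hz, hc, smul_smul]
  -- Here `s₁₁ ≠ 0` separates the factors of `μ₂`: `ψ_{+,1}(z*)` is orthogonal to the conjugate of
  -- `ψ_{+,2}` but not to that of `ψ_{-,1}`.
  · have hcross : crossProduct (star (D.psi Side.minus 0 z 0 0))
        (star (D.psi Side.plus 1 z 0 0)) ≠ 0 := by
      rw [← cross_anticomm, neg_ne_zero]
      exact cross_ne_zero_of_dotProduct (star_ne_zero.2 hw)
        (star_dotProduct_comm_eq_zero.1 (hD.pairing_plus hz))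
        (star_dotProduct_comm_eq_zero.not.1 hs')
    obtain ⟨c, hc⟩ := exists_eq_smul_cross hcross
      (star_dotProduct_comm_eq_zero.1 (hD.pairing_minus hz)) (star_dotProduct_comm_eq_zero.1 hh)
    refine ⟨c / D.totalExp ((starRingEnd ℂ) z) 0 0, hD.isLax_eq_smul
      (hD.isLax_psi (admissible_minus_one_conj hz)) (hD.isLax_mu₂_conj hz) ?_⟩
    rw [hD.mu₂_conj_eq hz, smul_smul, div_mul_cancel₀ _ (D.totalExp_ne_zero _ 0 0)]
    exact hc

/-- Third type: Jost solutions normalized at opposite ends are proportional. -/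
theorem IsSolution.third_type (hD : D.IsSolution) {z : ℂ} (hz : z ∈ D.U₁)
    (h₁ : D.mu₁ z 0 0 = 0) (h₂ : D.mu₂ ((starRingEnd ℂ) z) 0 0 = 0) :
    (∃ c : ℂ, ∀ x t, D.psi Side.minus 0 z x t = c • D.psi Side.plus 1 z x t) ∧
    (∃ c : ℂ, ∀ x t, D.psi Side.minus 1 ((starRingEnd ℂ) z) x t =
      c • D.psi Side.plus 0 ((starRingEnd ℂ) z) x t) := by
  rw [hD.mu₁_eq hz, smul_eq_zero_iff_right (D.totalExp_ne_zero _ 0 0), star_cross,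
    star_eq_zero] at h₁
  rw [hD.mu₂_conj_eq hz, smul_eq_zero_iff_right (D.totalExp_ne_zero _ 0 0), star_cross,
    star_eq_zero, ← cross_anticomm, neg_eq_zero] at h₂
  constructor
  · obtain ⟨c, hc⟩ := exists_eq_smul_of_cross_eq_zero
      (hD.psi_zero_ne_zero (admissible_plus_one hz)) h₂
    exact ⟨c, hD.isLax_eq_smul (hD.isLax_psi (admissible_minus_zero hz))
      (hD.isLax_psi (admissible_plus_one hz)) hc⟩
  · obtain ⟨c, hc⟩ := exists_eq_smul_of_cross_eq_zero
      (hD.psi_zero_ne_zero (admissible_plus_zero_conj hz)) h₁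
    exact ⟨c, hD.isLax_eq_smul (hD.isLax_psi (admissible_minus_one_conj hz))
      (hD.isLax_psi (admissible_plus_zero_conj hz)) hc⟩

end Data

end CoupledLPD

theorem mainTheorem10 (D : CoupledLPD.Data) (hD : D.IsSolution) :
    (∀ z : ℂ, D.FirstType z → ∃ d d' d'' d''' : ℂ, ∀ x t : ℝ,
      D.psi .minus 0 z x t = (d / D.h₂₂ z) • D.mu₁ z x t ∧
      D.mu₂ (star z) x t = d' • D.psi .plus 0 (star z) x t ∧
      D.mu₃ (D.inv (star z)) x t = d'' • D.psi .plus 2 (D.inv (star z)) x t ∧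
      D.psi .minus 2 (D.inv z) x t = d''' • D.mu₄ (D.inv z) x t) ∧
    (∀ θ : ℂ, D.SecondType θ → ∃ g g' g'' g''' : ℂ, ∀ x t : ℝ,
      D.mu₁ θ x t = g • D.psi .plus 1 θ x t ∧
      D.psi .minus 1 (star θ) x t = g' • D.mu₂ (star θ) x t ∧
      D.psi .minus 1 (D.inv (star θ)) x t = g'' • D.mu₃ (D.inv (star θ)) x t ∧
      D.mu₄ (D.inv θ) x t = g''' • D.psi .plus 1 (D.inv θ) x t) ∧
    (∀ ξ : ℂ, D.ThirdType ξ →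
      (∀ x t : ℝ, D.mu₁ ξ x t = 0) → (∀ x t : ℝ, D.mu₂ (star ξ) x t = 0) →
      ∃ f f' f'' f''' : ℂ, ∀ x t : ℝ,
        D.psi .minus 0 ξ x t = f • D.psi .plus 1 ξ x t ∧
        D.psi .minus 1 (star ξ) x t = f' • D.psi .plus 0 (star ξ) x t ∧
        D.psi .minus 1 (D.inv (star ξ)) x t =
          f'' • D.psi .plus 2 (D.inv (star ξ)) x t ∧
        D.psi .minus 2 (D.inv ξ) x t = f''' • D.psi .plus 1 (D.inv ξ) x t) := by
  have hf : ∀ z ∈ D.U₁, I * z / (D.amp : ℂ) ≠ 0 ∧ I * (starRingEnd ℂ) z / (D.amp : ℂ) ≠ 0 :=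
    fun z hz => ⟨div_ne_zero (mul_ne_zero I_ne_zero
      (CoupledLPD.Data.admissible_minus_zero hz).ne_zero) hD.amp_ne_zero,
      div_ne_zero (mul_ne_zero I_ne_zero
        (CoupledLPD.Data.admissible_plus_zero_conj hz).ne_zero) hD.amp_ne_zero⟩
  simp only [Complex.star_def]
  refine ⟨fun z hz => ?_, fun z hz => ?_, fun z hz h₁ h₂ => ?_⟩
  · obtain ⟨⟨c, hc⟩, c', hc'⟩ := hD.first_type hz
    obtain ⟨hU, -, hh⟩ := hz
    -- The factor `h₂₂` compensates the denominator in the statement. The constants repeat because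
    -- both sides of each reflected identity acquire the same symmetry factor.
    refine ⟨c * D.h₂₂ z, c', c', c, fun x t => ⟨?_, hc' x t, ?_, ?_⟩⟩
    · rw [mul_div_cancel_right₀ _ hh, hc]
    · rw [hD.mu₃_inv hU, hD.psi_plus_two_inv hU, hc', smul_comm]
    · rw [hD.mu₄_inv hU, hD.psi_minus_two_inv hU, hc, smul_comm]
  · obtain ⟨⟨c, hc⟩, c', hc'⟩ := hD.second_type hz
    obtain ⟨hU, -, -⟩ := hz
    -- Here `ψ_{∓,2}` is unchanged by the reflection while `μ₃` and `μ₄` are rescaled, so the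
    -- symmetry factor stays in the constants.
    refine ⟨c, c', c' / (I * (starRingEnd ℂ) z / D.amp), I * z / D.amp * c,
      fun x t => ⟨hc x t, hc' x t, ?_, ?_⟩⟩
    · rw [hD.mu₃_inv hU, hD.psi_minus_one_inv hU, hc', smul_smul,
        div_mul_cancel₀ _ (hf z hU).2]
    · rw [hD.mu₄_inv hU, hD.psi_plus_one_inv hU, hc, smul_smul]
  · obtain ⟨hU, -, -⟩ := hz
    obtain ⟨⟨c, hc⟩, c', hc'⟩ := hD.third_type hU (h₁ 0 0) (h₂ 0 0)
    refine ⟨c, c', c' / (I * (starRingEnd ℂ) z / D.amp), I * z / D.amp * c,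
      fun x t => ⟨hc x t, hc' x t, ?_, ?_⟩⟩
    · rw [hD.psi_plus_two_inv hU, hD.psi_minus_one_inv hU, hc', smul_smul,
        div_mul_cancel₀ _ (hf z hU).2]
    · rw [hD.psi_minus_two_inv hU, hD.psi_plus_one_inv hU, hc, smul_smul]
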